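/- **Setting.** Let $\mathfrak r$ be a finite index set with $r=|\mathfrak r|$, and let $\binom{\mathfrak r}{[k]}$ be the set of all $I\subseteq\mathfrak r$ with $1\le |I|\le k$. For vertex sets $(X_i)_{i\in\mathfrak r}$, an index-$I$ edge is a set consisting of exactly one vertex of $X_i$ for each $i\in I$; for $\emptyset\ne J\subseteq I$ let $e|_J$ be its part in $\bigcup_{j\in J}X_j$. A *$k$-bound colored graph* $\mathbf G$ on finite nonempty sets $(\Omega_i)_{i\in\mathfrak r}$ has finite color sets $C_I$, $I\in\binom{\mathfrak r}{[k]}$, and gives each index-$I$ edge $e$ a color $\mathbf G(e)\in C_I$. A *$k$-bound complex* over $(C_I)_I$ on vertex sets $(X_i)_i$ gives each index-$I$ edge either a color in $C_I$ (the edge is then *visible*) or the color "invisible", such that every edge containing an invisible edge is invisible. For a complex $S$ let $V(S)=\bigsqcup_i V_i(S)$ be its vertex set and $\mathbb V(S)$ the set of its visible edges; $S\setminus u$ is $S$ with the vertex $u$ and all edges containing it deleted. A *partitionwise map* sends the vertices of the $i$-th part into the $i$-th part. Such a map $\varphi$ *embeds* $S$ in a colored graph or complex $T$, written $S\overset{\varphi}{\hookrightarrow}T$,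 if $S(e)=T(\varphi(e))$ for all $e\in\mathbb V(S)$. The maximum degree $\Delta(B)$ is the maximum over $v\in V(B)$ of the number of $w\ne v$ such that $\{v,w\}$ is a visible edge of size $2$. A *$\Delta$-blowup* of $S$ is a $k$-bound complex $B$ on a finite vertex set with $\Delta(B)\le\Delta$ such that some partitionwise map embeds $B$ in $S$. Let $\Phi(W)$ be the set of partitionwise maps from $W$ to $(\Omega_i)_i$; $\mathbb P_{\varphi\in\Phi(W)}$ means that each $w\in W$ in the $i$-th part is mapped independently to a uniformly random element of $\Omega_i$. For a visible index-$I$ edge $e$ of $S$ put $$\mathbf d_{\mathbf G}(S\langle e\rangle)=\mathbb P_{\mathbf e}\bigl[\mathbf G(\mathbf e)=S(e)\,\big|\,\mathbf G(\mathbf e|_J)=S(e|_J)\ \text{for all}\ \emptyset\ne J\subsetneq I\bigr],$$ where $\mathbf e$ is a uniformly random index-$I$ edge on $(\Omega_i)_i$. **Statement.** For all positive integers $k$ and $\Delta$ there are functions $\eta_1,\dots,\eta_k:(0,1)\to(0,\infty)$ such that the following holds for all reals $0<\rho_1\le\cdots\le\rho_k<1$, where $\eta_i$ stands for $\eta_i(\rho_i)$.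 Let $r\ge k$ and $h\ge1$ be integers, let $\mathbf G$ be a $k$-bound colored graph on finite nonempty sets $(\Omega_i)_{i\in\mathfrak r}$ with $|\mathfrak r|=r$ and $|C_I|\le 1/\rho_{|I|}$ for all $I$, and let $S$ be a $k$-bound complex over the color sets of $\mathbf G$ each of whose $r$ vertex sets has exactly $h$ elements. Suppose that for every $(2\Delta)$-blowup $S'$ of $S$ with $|V(S')|\le 2\Delta^{2k}$ one has $$\mathbb P_{\phi\in\Phi(V(S'))}\bigl[S'\overset{\phi}{\hookrightarrow}\mathbf G\bigr]=\prod_{e\in\mathbb V(S')}c_e$$ for some reals $c_e$ with $\max\{0,(1-\eta_{|e|})\mathbf d_{\mathbf G}(S'\langle e\rangle)\}\le c_e\le\min\{1,(1+\eta_{|e|})\mathbf d_{\mathbf G}(S'\langle e\rangle)\}$, and that $\mathbf d_{\mathbf G}(S\langle e\rangle)>\rho_{|e|}$ for all $e\in\mathbb V(S)$. Let $B$ be a $\Delta$-blowup of $S$ with $|V_i(B)|<\eta_1(\rho_1)\,|\Omega_i|$ for every $i\in\mathfrak r$. Then for every vertex $u\in V(B)$, $$\mathbb E_{\varphi\in\Phi(B\setminus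 u)}\Bigl[\mathbb P_{\phi\in\Phi(\{u\})}\bigl[B\overset{\varphi\dot\cup\phi}{\hookrightarrow}\mathbf G\text{ and }\phi(u)\notin\varphi(V(B\setminus u))\bigr]\ \Big|\ B\setminus u\overset{\varphi}{\hookrightarrow}\mathbf G\Bigr]\ \ge\ (1-\eta_k^{1/4})\prod_{e\in\mathbb V(B):\,u\in e}\mathbf d_{\mathbf G}(B\langle e\rangle),$$ and moreover $$\mathbb P_{\varphi\in\Phi(B)}\bigl[B\overset{\varphi}{\hookrightarrow}\mathbf G\text{ and }\varphi\text{ is injective}\bigr]\ \ge\ (1-\eta_k^{1/4})^{|V(B)|}\prod_{e\in\mathbb V(B)}\mathbf d_{\mathbf G}(B\langle e\rangle)\ >\ 0.$$ -/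

import Mathlib

namespace BlowupCounting

/-! ### Uniform probability on a finite set -/

/-- `ℙ[p]` for a uniformly random element of the finite nonempty set `α`. -/
noncomputable def prob {α : Type} (p : α → Prop) : ℝ :=
  (Nat.card {a : α // p a} : ℝ) / (Nat.card α : ℝ)

/-- `ℙ[q | p]` for a uniformly random element of the finite set `α`. -/
noncomputable def condProb {α : Type} (q p : α → Prop) : ℝ :=
  (Nat.card {a : α // q a ∧ p a} : ℝ) / (Nat.card {a : α // p a} : ℝ)

/-- `𝔼[f | p]` for a uniformly random element of the finite set `α`. -/
noncomputable def condExpect {α : Type} (f : α → ℝ) (p : α → Prop) : ℝ :=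
  (∑ᶠ a : {a : α // p a}, f a.1) / (Nat.card {a : α // p a} : ℝ)

/-! ### Partite vertex sets, edges, partitionwise maps -/

/-- The indices of edges of a `k`-bound graph: nonempty sets of at most `k` parts. -/
abbrev Index (ι : Type) (k : ℕ) : Type :=
  {I : Finset ι // I.Nonempty ∧ I.card ≤ k}

/-- The disjoint union of the vertex sets `X i`. -/
abbrev Vertex {ι : Type} (X : ι → Type) : Type := Σ i, X i

/-- An index-`I` edge has exactly one vertex in each `X i` with `i ∈ I`, and no other vertex. -/
abbrev EdgeOn {ι : Type} (X : ι → Type) (I : Finset ι) : Type := ∀ i : I, X i.1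

/-- The restriction `e|_J` of an index-`I` edge to an index `J ⊆ I`. -/
def EdgeOn.restrict {ι : Type} {X : ι → Type} {I J : Finset ι} (h : J ⊆ I)
    (e : EdgeOn X I) : EdgeOn X J :=
  fun j => e ⟨j.1, h j.2⟩

/-- All edges of size between `1` and `k`. -/
abbrev Edge {ι : Type} (k : ℕ) (X : ι → Type) : Type := Σ I : Index ι k, EdgeOn X I.1

/-- The number of vertices of an edge. -/
def Edge.size {ι : Type} {k : ℕ} {X : ι → Type} (e : Edge k X) : ℕ := e.1.1.card

/-- `v ∈ e`. -/
def Edge.Contains {ι : Type} {k : ℕ} {X : ι → Type} (e : Edge k X) (v : Vertex X) : Prop :=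
  ∃ h : v.1 ∈ e.1.1, e.2 ⟨v.1, h⟩ = v.2

/-- Partitionwise maps: each vertex of part `i` is mapped into part `i`.  A random partitionwise
map into finite sets `Y i` (each vertex mapped independently and uniformly) is a uniformly random
element of this type. -/
abbrev PMap {ι : Type} (X Y : ι → Type) : Type := ∀ i, X i → Y i

/-- The image of an edge. -/
def PMap.onEdge {ι : Type} {X Y : ι → Type} (φ : PMap X Y) {I : Finset ι}
    (e : EdgeOn X I) : EdgeOn Y I :=
  fun i => φ i.1 (e i)

/-- The map on the disjoint unions of the vertex sets. -/
def PMap.onVertex {ι : Type} {X Y : ι → Type} (φ : PMap X Y) (v : Vertex X) : Vertex Y :=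
  ⟨v.1, φ v.1 v.2⟩

/-- The vertex sets induced by a set `U` of vertices. -/
abbrev Sub {ι : Type} {X : ι → Type} (U : Set (Vertex X)) : ι → Type :=
  fun i => {x : X i // (⟨i, x⟩ : Vertex X) ∈ U}

open Classical in
/-- The union of a partitionwise map on all vertices but `u` and one on `{u}`. -/
noncomputable def PMap.glue {ι : Type} {X Y : ι → Type} (u : Vertex X)
    (φ : PMap (Sub ({u}ᶜ : Set (Vertex X))) Y) (ψ : PMap (Sub ({u} : Set (Vertex X))) Y) :
    PMap X Y :=
  fun i x => if h : (⟨i, x⟩ : Vertex X) ∈ ({u} : Set (Vertex X)) then ψ i ⟨x, h⟩ else φ i ⟨x, h⟩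

/-! ### Colored graphs and complexes -/

/-- A `k`-bound colored partite hypergraph with vertex sets `X i` and color sets `C I`. -/
structure ColoredGraph {ι : Type} (k : ℕ) (X : ι → Type) (C : Index ι k → Type) where
  /-- the color of an index-`I` edge -/
  color : ∀ I : Index ι k, EdgeOn X I.1 → C I

/-- A `k`-bound simplicial complex whose visible colors of index `I` are members of `C I`;
the value `none` is the invisible color. -/
structure Complex {ι : Type} (k : ℕ) (X : ι → Type) (C : Index ι k → Type) extends
    ColoredGraph k X (fun I => Option (C I)) where
  /-- an edge that contains an invisible edge is invisible -/
  invisible_of_subset : ∀ (I J : Index ι k) (h : J.1 ⊆ I.1) (e : EdgeOn X I.1),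
    color J (e.restrict h) = none → color I e = none

/-- The total color `H⟨e⟩`: the colors of all `e|_J`, `∅ ≠ J ⊆ I`. -/
def ColoredGraph.totalColor {ι : Type} {k : ℕ} {X : ι → Type} {C : Index ι k → Type}
    (H : ColoredGraph k X C) (e : Edge k X) (J : Index ι k) (h : J.1 ⊆ e.1.1) : C J :=
  H.color J (e.2.restrict h)

/-- Visible edges. -/
def Complex.Visible {ι : Type} {k : ℕ} {X : ι → Type} {C : Index ι k → Type}
    (S : Complex k X C) (e : Edge k X) : Prop :=
  S.color e.1 e.2 ≠ none

/-- `φ` embeds the complex `S` in the colored graph `G`: every visible edge `e` of `S` satisfies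
`S(e) = G(φ(e))`. -/
def Complex.Embeds {ι : Type} {k : ℕ} {X Y : ι → Type} {C : Index ι k → Type}
    (S : Complex k X C) (φ : PMap X Y) (G : ColoredGraph k Y C) : Prop :=
  ∀ e : Edge k X, S.Visible e → S.color e.1 e.2 = some (G.color e.1 (φ.onEdge e.2))

/-- `φ` embeds the complex `S` in the complex `T`: every visible edge `e` of `S` satisfies
`S(e) = T(φ(e))`. -/
def Complex.EmbedsComplex {ι : Type} {k : ℕ} {X Y : ι → Type} {C : Index ι k → Type}
    (S : Complex k X C) (φ : PMap X Y) (T : Complex k Y C) : Prop :=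
  ∀ e : Edge k X, S.Visible e → S.color e.1 e.2 = T.color e.1 (φ.onEdge e.2)

/-- The subcomplex induced by a set `U` of vertices. -/
def Complex.induce {ι : Type} {k : ℕ} {X : ι → Type} {C : Index ι k → Type}
    (S : Complex k X C) (U : Set (Vertex X)) : Complex k (Sub U) C where
  color I e := S.color I (fun i => (e i).1)
  invisible_of_subset I J h e := S.invisible_of_subset I J h (fun i => (e i).1)

/-- `S ∖ u`. -/
def Complex.delete {ι : Type} {k : ℕ} {X : ι → Type} {C : Index ι k → Type}
    (S : Complex k X C) (u : Vertex X) : Complex k (Sub ({u}ᶜ : Set (Vertex X))) C :=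
  S.induce {u}ᶜ

/-- The number of vertices `w ≠ v` such that `{v, w}` is a visible edge (of size two). -/
noncomputable def Complex.degree {ι : Type} {k : ℕ} {X : ι → Type} {C : Index ι k → Type}
    (S : Complex k X C) (v : Vertex X) : ℕ :=
  Nat.card {w : Vertex X // w ≠ v ∧
    ∃ e : Edge k X, S.Visible e ∧ e.size = 2 ∧ e.Contains v ∧ e.Contains w}

/-- `B` is a `Δ`-blowup of `S`: its maximum degree is at most `Δ`, and it is embeddable in `S`. -/
def Complex.IsBlowup {ι : Type} {k : ℕ} {X Y : ι → Type} {C : Index ι k → Type}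
    (Δ : ℕ) (B : Complex k X C) (S : Complex k Y C) : Prop :=
  (∀ v : Vertex X, B.degree v ≤ Δ) ∧ ∃ φ : PMap X Y, B.EmbedsComplex φ S

/-! ### Relative density -/

/-- The relative density `d_G(c)` of a vector `c = (c_J)_{∅ ≠ J ⊆ I}` of colors: the probability
that a random edge of index `I` has color `c_I`, given that its proper restrictions have the
colors `c_J`. -/
noncomputable def ColoredGraph.relDensity {ι : Type} {k : ℕ} {Ω : ι → Type}
    {C : Index ι k → Type} (G : ColoredGraph k Ω C) (I : Index ι k)
    (c : ∀ J : Index ι k, J.1 ⊆ I.1 → Option (C J)) : ℝ :=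
  condProb
    (fun e : EdgeOn Ω I.1 => some (G.color I e) = c I (Finset.Subset.refl I.1))
    (fun e : EdgeOn Ω I.1 => ∀ (J : Index ι k) (h : J.1 ⊂ I.1),
      some (G.color J (e.restrict h.1)) = c J h.1)

/-- `d_G(S⟨e⟩)` for an edge `e` of a complex `S`. -/
noncomputable def Complex.density {ι : Type} {k : ℕ} {X Ω : ι → Type} {C : Index ι k → Type}
    (S : Complex k X C) (G : ColoredGraph k Ω C) (e : Edge k X) : ℝ :=
  G.relDensity e.1 (S.totalColor e)

/-- `ℙ_φ[S ↪ G] = ∏_{e visible} (1 ± δ_{|e|}) d_G(S⟨e⟩)`, where the factor of `e` stands for some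
number between `max {0, (1 - δ_{|e|}) d_G(S⟨e⟩)}` and `min {1, (1 + δ_{|e|}) d_G(S⟨e⟩)}`. -/
def Complex.CountsWithin {ι : Type} {k : ℕ} {X Ω : ι → Type} {C : Index ι k → Type}
    (S : Complex k X C) (G : ColoredGraph k Ω C) (δ : ℕ → ℝ) : Prop :=
  ∃ c : {e : Edge k X // S.Visible e} → ℝ,
    (∀ e, max 0 ((1 - δ e.1.size) * S.density G e.1) ≤ c e ∧
      c e ≤ min 1 ((1 + δ e.1.size) * S.density G e.1)) ∧
    prob (fun φ : PMap X Ω => S.Embeds φ G) = ∏ᶠ e, c e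

end BlowupCounting

set_option linter.unusedSectionVars false
set_option linter.style.haveILetI false

namespace BlowupCounting

open Finset
open scoped BigOperators

/-! ### Averages over product spaces: resampling a set of coordinates. -/

section Average

variable {V : Type} [DecidableEq V] {Y : V → Type}

/-! `B` is embedded one vertex at a time. Once `B ∖ u` is placed, the fraction of good images of `u`
(`star`) depends only on the images of the at most `Δ` neighbours of `u`. Counting the blowup in
which `u` is doubled shows that this fraction has small variance around the product `d` of the
densities of the edges at `u` (`expect_star_le`). That variance is taken over random images of the
neighbours restricted only by the edges of size less than `k` among them, whereas the theorem
averages over embeddings of all of `B ∖ u`, which is too large for the counting hypothesis.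

The heart of the proof is the transfer between these two averages, `expect_mul_weight_le`. Let `q ≥
0` depend on a small vertex set `A`, with normalized `L²` norm at most `ε` over placements of `A`
that respect its edges of size at most `i`. Then the mean of `q` over embeddings of any `U ⊇ A` is
at most `ε * (8 / ρ (i + 1) ^ L)`, provided that vertices can be added one at a time inside `U` at
the expected cost. For the upper bound, among the edges meeting `A` keep only those of size at most
`i`, and replace the indicator of the edges crossing out of `A` by its density. The deviation is a
function of the neighbours of `A`. Two applications of Cauchy–Schwarz, with `A` and its
neighbourhood doubled, make it smaller by a factor of order `ρ i ^ L`. A part of a crossing edge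
that avoids `A` has lost a vertex, so the deviation is controlled over edges of size at most `i - 1`
only, and induction on `i` applies; its loss `8 / ρ i ^ L` is cancelled by the gain. For the lower
bound, the vertices of `A` are added one by one. The densities of edges of size at most `i` cancel
between the two bounds, and only larger edges cost something, at most `ρ (i + 1) ^ L`. This is why
`η_i` may depend on `ρ i` alone.

`extends_weight` closes the argument by induction on the number of vertices: the transfer for `U ∖
u` needs vertex extension only inside `U ∖ u`. Collisions cost at most `η_1` per vertex, which is
negligible against the density of the edges at a vertex. The doubled sets fit into `2 * Δ ^ (2 * k)`
vertices when `Δ ≥ 2`; for `Δ = 1` edges have at most two vertices and independence suffices.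
Finally, families of doubled edges are realized as `2Δ`-blowups (`copyComplex`), which turns the
counting hypothesis into `Regular`. -/

theorem apply_piecewise_of_subset {f : (∀ v, Y v) → ℝ} {A B : Finset V}
    (hf : DependsOn f (A : Set V)) (h : A ⊆ B) (x y : ∀ v, Y v) :
    f (B.piecewise x y) = f x :=
  hf fun v hv => by simp [h hv]

theorem apply_piecewise_of_disjoint {f : (∀ v, Y v) → ℝ} {A B : Finset V}
    (hf : DependsOn f (A : Set V)) (h : Disjoint A B) (x y : ∀ v, Y v) :
    f (B.piecewise x y) = f y :=
  hf fun v hv => by simp [Finset.disjoint_left.1 h hv]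

variable [Fintype V] [∀ v, Fintype (Y v)]

/-- Exchanging the coordinates in `A` of two points. -/
def swapOn (A : Finset V) : ((∀ v, Y v) × (∀ v, Y v)) ≃ ((∀ v, Y v) × (∀ v, Y v)) where
  toFun p := (A.piecewise p.1 p.2, A.piecewise p.2 p.1)
  invFun p := (A.piecewise p.1 p.2, A.piecewise p.2 p.1)
  left_inv p := by
    ext v <;> by_cases h : v ∈ A <;> simp [h]
  right_inv p := by
    ext v <;> by_cases h : v ∈ A <;> simp [h]

theorem expect_swapOn (A : Finset V) (F : (∀ v, Y v) → (∀ v, Y v) → ℝ) :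
    𝔼 x, 𝔼 y, F (A.piecewise x y) (A.piecewise y x) = 𝔼 x, 𝔼 y, F x y := by
  rw [← Finset.expect_product', ← Finset.expect_product']
  exact Fintype.expect_equiv (swapOn A) _ _ fun p => rfl

variable [∀ v, Nonempty (Y v)]

theorem expect_piecewise (A : Finset V) (F : (∀ v, Y v) → ℝ) :
    𝔼 x, 𝔼 y, F (A.piecewise x y) = 𝔼 x, F x := by
  rw [expect_swapOn A (fun x _ => F x)]
  simp

theorem expect_mul_of_disjoint {f g : (∀ v, Y v) → ℝ} {A B : Finset V}
    (hf : DependsOn f (A : Set V)) (hg : DependsOn g (B : Set V)) (h : Disjoint A B) :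
    𝔼 x, f x * g x = (𝔼 x, f x) * 𝔼 x, g x := by
  rw [← expect_piecewise A]
  simp only [apply_piecewise_of_subset hf subset_rfl,
    apply_piecewise_of_disjoint hg h.symm]
  rw [Finset.expect_mul]
  simp only [Finset.mul_expect]

end Average

/-! ### Cauchy–Schwarz and the box norm. -/

section CauchySchwarz

variable {α β : Type} [Fintype α] [Fintype β]

theorem expect_mul_sq_le (f g : α → ℝ) :
    (𝔼 a, f a * g a) ^ 2 ≤ (𝔼 a, f a ^ 2) * 𝔼 a, g a ^ 2 :=
  Finset.expect_mul_sq_le_sq_mul_sq _ _ _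

theorem expect_expect_mul_sq_le (f g : α → β → ℝ) :
    (𝔼 a, 𝔼 b, f a b * g a b) ^ 2 ≤ (𝔼 a, 𝔼 b, f a b ^ 2) * 𝔼 a, 𝔼 b, g a b ^ 2 := by
  simp only [← Finset.expect_product']
  exact Finset.expect_mul_sq_le_sq_mul_sq _ _ _

/-- The Cauchy–Schwarz bound by the box norm of the kernel `k`. -/
theorem expect_sq_le_box (I q : α → ℝ) (I' : β → ℝ) (k : α → β → ℝ)
    (hI : ∀ x, I x = 0 ∨ I x = 1) {M : ℝ} (hM : 0 ≤ M)
    (hbox : 𝔼 x, 𝔼 x', 𝔼 y, 𝔼 y', I x * I x' * (I' y * I' y') *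
      ((k x y * k x' y) * (k x y' * k x' y')) ≤ M ^ 2) :
    𝔼 y, I' y * (𝔼 x, q x * I x * k x y) ^ 2 ≤ (𝔼 x, q x ^ 2 * I x) * M := by
  have hII : ∀ x, I x ^ 2 = I x := fun x => by rcases hI x with h | h <;> simp [h]
  have hI0 : ∀ x, 0 ≤ I x := fun x => by rcases hI x with h | h <;> simp [h]
  set Z : α → α → ℝ := fun x x' => 𝔼 y, I' y * (k x y * k x' y) with hZ
  -- The square is expanded and `y` averaged first. Since `I` is idempotent, it can be attached both
  -- to `q` and to the kernel before Cauchy–Schwarz is applied over the pairs `(x, x')`.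
  have h1 : 𝔼 y, I' y * (𝔼 x, q x * I x * k x y) ^ 2 =
      𝔼 x, 𝔼 x', (q x * q x' * (I x * I x')) * (I x * I x' * Z x x') := by
    have : ∀ y, I' y * (𝔼 x, q x * I x * k x y) ^ 2 =
        𝔼 x, 𝔼 x', q x * q x' * (I x * I x') * (I x * I x') * (I' y * (k x y * k x' y)) := by
      intro y
      rw [sq, Finset.expect_mul, Finset.mul_expect]
      refine Finset.expect_congr rfl fun x _ => ?_
      rw [Finset.mul_expect, Finset.mul_expect]
      refine Finset.expect_congr rfl fun x' _ => ?_
      calc _ = q x * q x' * (I x * I x') * (I' y * (k x y * k x' y)) := by ring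
        _ = q x * q x' * (I x ^ 2 * I x' ^ 2) * (I' y * (k x y * k x' y)) := by rw [hII, hII]
        _ = _ := by ring
    simp only [this]
    rw [Finset.expect_comm]
    refine Finset.expect_congr rfl fun x _ => ?_
    rw [Finset.expect_comm]
    refine Finset.expect_congr rfl fun x' _ => ?_
    rw [hZ, ← Finset.mul_expect]
    ring
  have h2 : 𝔼 x, 𝔼 x', (q x * q x' * (I x * I x')) ^ 2 = (𝔼 x, q x ^ 2 * I x) ^ 2 := by
    rw [sq (𝔼 x, q x ^ 2 * I x), Finset.expect_mul]
    refine Finset.expect_congr rfl fun x _ => ?_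
    rw [Finset.mul_expect]
    refine Finset.expect_congr rfl fun x' _ => ?_
    calc _ = q x ^ 2 * I x ^ 2 * (q x' ^ 2 * I x' ^ 2) := by ring
      _ = _ := by rw [hII, hII]
  have h3 : 𝔼 x, 𝔼 x', (I x * I x' * Z x x') ^ 2 ≤ M ^ 2 := by
    refine le_trans (le_of_eq ?_) hbox
    refine Finset.expect_congr rfl fun x _ => Finset.expect_congr rfl fun x' _ => ?_
    rw [mul_pow, mul_pow, hII, hII, sq, hZ]
    simp only []
    rw [Finset.expect_mul, Finset.mul_expect]
    refine Finset.expect_congr rfl fun y _ => ?_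
    rw [Finset.mul_expect, Finset.mul_expect]
    refine Finset.expect_congr rfl fun y' _ => ?_
    ring
  have h0 : 0 ≤ 𝔼 x, q x ^ 2 * I x :=
    Finset.expect_nonneg fun x _ => mul_nonneg (sq_nonneg _) (hI0 x)
  rw [h1]
  refine le_of_sq_le_sq ?_ (mul_nonneg h0 hM)
  calc _ ≤ _ := expect_expect_mul_sq_le _ _
    _ ≤ (𝔼 x, q x ^ 2 * I x) ^ 2 * M ^ 2 := by
        rw [h2]; exact mul_le_mul_of_nonneg_left h3 (sq_nonneg _)
    _ = _ := by ring

end CauchySchwarz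

/-! ### Centered moments by inclusion–exclusion. -/

section Expansion

variable {κ α : Type} [Fintype κ] [DecidableEq κ] [Nonempty κ] [Fintype α]

/-- If the moments `𝔼 F ∏_{s ∈ t} J s` are within a factor `1 ± δ` of the values
that they would have if all `J s` were equal to `D`, then the centered moment is small. -/
theorem expect_mul_prod_sub_le (F : α → ℝ) (J : κ → α → ℝ) {D P δ : ℝ} (hD : 0 ≤ D)
    (h : ∀ t : Finset κ, |𝔼 a, F a * ∏ s ∈ t, J s a - P * D ^ #t| ≤ δ * (P * D ^ #t)) :
    𝔼 a, F a * ∏ s, (J s a - D) ≤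
      2 ^ Fintype.card κ * δ * (P * D ^ Fintype.card κ) := by
  have h1 : ∀ a, F a * ∏ s, (J s a - D) =
      ∑ t : Finset κ, (-D) ^ (Fintype.card κ - #t) * (F a * ∏ s ∈ t, J s a) := by
    intro a
    simp only [sub_eq_add_neg]
    rw [Finset.prod_add, Finset.powerset_univ, Finset.mul_sum]
    refine Finset.sum_congr rfl fun t _ => ?_
    rw [Finset.prod_const, Finset.card_sdiff_of_subset (Finset.subset_univ t), Finset.card_univ]
    ring
  -- The main terms are the expansion of `P * ∏ (D - D)`, which vanishes because `κ` is nonempty.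
  -- Only the errors survive, each at most `δ * P * D ^ |κ|`.
  have h2 : ∑ t : Finset κ, (-D) ^ (Fintype.card κ - #t) * (P * D ^ #t) = 0 := by
    have : P * ∏ _s : κ, (D - D) =
        ∑ t : Finset κ, (-D) ^ (Fintype.card κ - #t) * (P * D ^ #t) := by
      simp only [sub_eq_add_neg]
      rw [Finset.prod_add, Finset.powerset_univ, Finset.mul_sum]
      refine Finset.sum_congr rfl fun t _ => ?_
      rw [Finset.prod_const, Finset.prod_const,
        Finset.card_sdiff_of_subset (Finset.subset_univ t), Finset.card_univ]
      ring
    rw [← this]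
    simp
  calc 𝔼 a, F a * ∏ s, (J s a - D)
      = ∑ t : Finset κ, (-D) ^ (Fintype.card κ - #t) * 𝔼 a, F a * ∏ s ∈ t, J s a := by
        simp only [h1]
        rw [Finset.expect_sum_comm]
        simp only [Finset.mul_expect]
    _ = ∑ t : Finset κ, (-D) ^ (Fintype.card κ - #t) *
          (𝔼 a, F a * ∏ s ∈ t, J s a - P * D ^ #t) := by
        simp only [mul_sub, Finset.sum_sub_distrib]
        rw [h2, sub_zero]
    _ ≤ ∑ t : Finset κ, δ * (P * D ^ Fintype.card κ) := by
        refine Finset.sum_le_sum fun t _ => ?_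
        have hc : Fintype.card κ - #t + #t = Fintype.card κ :=
          Nat.sub_add_cancel (Finset.card_le_univ t)
        calc _ ≤ |(-D) ^ (Fintype.card κ - #t) * (𝔼 a, F a * ∏ s ∈ t, J s a - P * D ^ #t)| :=
              le_abs_self _
          _ = D ^ (Fintype.card κ - #t) * |𝔼 a, F a * ∏ s ∈ t, J s a - P * D ^ #t| := by
              rw [abs_mul, abs_pow, abs_neg, abs_of_nonneg hD]
          _ ≤ D ^ (Fintype.card κ - #t) * (δ * (P * D ^ #t)) :=
              mul_le_mul_of_nonneg_left (h t) (pow_nonneg hD _)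
          _ = δ * (P * D ^ (Fintype.card κ - #t + #t)) := by rw [pow_add]; ring
          _ = _ := by rw [hc]
    _ = _ := by
        rw [Finset.sum_const, Finset.card_univ, Fintype.card_finset, nsmul_eq_mul]
        push_cast
        ring

end Expansion

theorem one_sub_pow_bounds {h : ℝ} {n : ℕ} (h0 : 0 ≤ h) (h1 : h ≤ 1) (hn : n * h ≤ 1) :
    1 - n * h ≤ (1 - h) ^ n ∧ (1 + h) ^ n ≤ 1 + 2 * (n * h) := by
  constructor
  · have := one_add_mul_le_pow (a := -h) (by linarith) n
    simpa [sub_eq_add_neg] using this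
  · have hnh : 0 ≤ (n : ℝ) * h := by positivity
    have h3 : (1 + h) ^ n ≤ Real.exp (n * h) := by
      rw [Real.exp_nat_mul]
      exact pow_le_pow_left₀ (by linarith) (by linarith [Real.add_one_le_exp h]) _
    have h4 := Real.abs_exp_sub_one_le (x := n * h) (by rwa [abs_of_nonneg hnh])
    rw [abs_of_nonneg hnh] at h4
    linarith [le_abs_self (Real.exp (n * h) - 1)]

/-! ### Abstract edge systems and counts of doubled edges. -/

/-- The visible edges of a complex as vertex sets, with the events that they are embedded by a
random point of `∀ v, Y v`, and with their relative densities. -/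
structure EdgeSystem (V : Type) (Y : V → Type) (E : Type) where
  vs : E → Finset V
  ind : E → (∀ v, Y v) → ℝ
  dens : E → ℝ
  vs_nonempty : ∀ e, (vs e).Nonempty
  vs_injective : Function.Injective vs
  exists_vs_eq : ∀ e s, s ⊆ vs e → s.Nonempty → ∃ e', vs e' = s
  ind_eq : ∀ e x, ind e x = 0 ∨ ind e x = 1
  dependsOn_ind : ∀ e, DependsOn (ind e) (vs e : Set V)
  dens_pos : ∀ e, 0 < dens e
  dens_le_one : ∀ e, dens e ≤ 1

namespace EdgeSystem

variable {V : Type} {Y : V → Type} {E : Type} (R : EdgeSystem V Y E)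

/-- The indicator of the event that all edges in `s` are embedded. -/
def Ind (s : Finset E) (x : ∀ v, Y v) : ℝ := ∏ e ∈ s, R.ind e x

/-- The product of the densities of the edges in `s`. -/
def D (s : Finset E) : ℝ := ∏ e ∈ s, R.dens e

theorem ind_nonneg (e : E) (x : ∀ v, Y v) : 0 ≤ R.ind e x := by
  rcases R.ind_eq e x with h | h <;> simp [h]

theorem ind_le_one (e : E) (x : ∀ v, Y v) : R.ind e x ≤ 1 := by
  rcases R.ind_eq e x with h | h <;> simp [h]

theorem Ind_nonneg (s : Finset E) (x : ∀ v, Y v) : 0 ≤ R.Ind s x :=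
  Finset.prod_nonneg fun e _ => R.ind_nonneg e x

theorem Ind_le_one (s : Finset E) (x : ∀ v, Y v) : R.Ind s x ≤ 1 :=
  Finset.prod_le_one (fun e _ => R.ind_nonneg e x) fun e _ => R.ind_le_one e x

theorem Ind_eq (s : Finset E) (x : ∀ v, Y v) : R.Ind s x = 0 ∨ R.Ind s x = 1 := by
  by_cases h : ∃ e ∈ s, R.ind e x = 0
  · obtain ⟨e, he, h⟩ := h
    exact Or.inl (Finset.prod_eq_zero he h)
  · push Not at h
    exact Or.inr (Finset.prod_eq_one fun e he => (R.ind_eq e x).resolve_left (h e he))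

theorem Ind_anti {s t : Finset E} (h : s ⊆ t) (x : ∀ v, Y v) : R.Ind t x ≤ R.Ind s x :=
  Finset.prod_le_prod_of_subset_of_le_one h (fun e _ => R.ind_nonneg e x)
    fun e _ _ => R.ind_le_one e x

theorem dependsOn_Ind {s : Finset E} {W : Finset V} (h : ∀ e ∈ s, R.vs e ⊆ W) :
    DependsOn (R.Ind s) (W : Set V) := fun _ _ hxy =>
  Finset.prod_congr rfl fun e he => R.dependsOn_ind e fun v hv => hxy v (h e he hv)

theorem D_pos (s : Finset E) : 0 < R.D s := Finset.prod_pos fun e _ => R.dens_pos e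

theorem pow_le_D {s : Finset E} {a : ℝ} {L : ℕ} (ha : 0 ≤ a) (ha1 : a ≤ 1) (hs : #s ≤ L)
    (h : ∀ e ∈ s, a ≤ R.dens e) : a ^ L ≤ R.D s :=
  calc a ^ L ≤ a ^ #s := pow_le_pow_of_le_one ha ha1 hs
    _ = ∏ _e ∈ s, a := by rw [Finset.prod_const]
    _ ≤ R.D s := Finset.prod_le_prod (fun _ _ => ha) h

theorem card_le_of_vs_subset {s : Finset E} {W : Finset V} (h : ∀ e ∈ s, R.vs e ⊆ W) :
    #s ≤ 2 ^ #W := by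
  rw [← Finset.card_powerset]
  exact Finset.card_le_card_of_injOn R.vs (fun e he => by simpa using h e he)
    R.vs_injective.injOn

variable [DecidableEq V] [Fintype E]

/-- The family `T` assigns to each edge `e` a set of subsets of `e`; the pair `(e, t)` with
`t ∈ T e` stands for the copy of `e` that uses the second copies of the vertices in `t` and the
first copies of the other vertices. -/
structure IsClosedFamily (T : E → Finset (Finset V)) (Z : Finset (V × Bool)) : Prop where
  subset : ∀ e, ∀ t ∈ T e, t ⊆ R.vs e
  inter_mem : ∀ e, ∀ t ∈ T e, ∀ e', R.vs e' ⊆ R.vs e → t ∩ R.vs e' ∈ T e'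
  mem : ∀ e, ∀ t ∈ T e, ∀ v ∈ R.vs e, (v, decide (v ∈ t)) ∈ Z

/-- A copy is determined by the pair `(vs e, t)` of subsets of the projection of `Z`, and there are
at most `2 ^ M * 2 ^ M` such pairs. This is the origin of `L = 4 ^ M`. -/
theorem sum_card_le {T : E → Finset (Finset V)} {Z : Finset (V × Bool)}
    (hT : R.IsClosedFamily T Z) {M : ℕ} (hM : #Z ≤ M) : ∑ e, #(T e) ≤ 4 ^ M := by
  rw [← Finset.card_sigma]
  set W := Z.image Prod.fst with hW
  have hWM : #W ≤ M := Finset.card_image_le.trans hM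
  have h1 : #((univ : Finset E).sigma T) ≤ #(W.powerset ×ˢ W.powerset) := by
    refine Finset.card_le_card_of_injOn (fun p => (R.vs p.1, p.2)) ?_ ?_
    · rintro ⟨e, t⟩ h
      simp only [Finset.coe_sigma, Set.mem_sigma_iff, Finset.mem_coe] at h
      have hv : R.vs e ⊆ W := fun v hv =>
        Finset.mem_image.2 ⟨_, hT.mem e t h.2 v hv, rfl⟩
      simpa using ⟨hv, (hT.subset e t h.2).trans hv⟩
    · rintro ⟨e, t⟩ _ ⟨e', t'⟩ _ h
      simp only [Prod.mk.injEq] at h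
      obtain ⟨h1, rfl⟩ := h
      obtain rfl := R.vs_injective h1
      rfl
  refine h1.trans ?_
  rw [Finset.card_product, Finset.card_powerset, ← mul_pow]
  exact Nat.pow_le_pow_right (by norm_num) hWM

variable [Fintype V] [∀ v, Fintype (Y v)]

/-- The probability that all copies of edges in the family `T` are embedded. -/
noncomputable def count (T : E → Finset (Finset V)) : ℝ :=
  𝔼 x : (∀ v, Y v), 𝔼 y : (∀ v, Y v), ∏ e, ∏ t ∈ T e, R.ind e (t.piecewise y x)

/-- All families of copies of edges on at most `M` vertices are counted with the errors `η`. -/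
def Regular (M : ℕ) (η : ℕ → ℝ) : Prop :=
  ∀ (T : E → Finset (Finset V)) (Z : Finset (V × Bool)), R.IsClosedFamily T Z → #Z ≤ M →
    ∏ e, ∏ _t ∈ T e, ((1 - η #(R.vs e)) * R.dens e) ≤ R.count T ∧
    R.count T ≤ ∏ e, ∏ _t ∈ T e, ((1 + η #(R.vs e)) * R.dens e)

/-- At most `4 ^ M` factors `1 ± h` are multiplied, and `4 ^ M * h ≤ 1` keeps the accumulated error
linear in `h`. -/
theorem abs_count_sub_le {M : ℕ} {η : ℕ → ℝ} (hR : R.Regular M η)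
    {T : E → Finset (Finset V)} {Z : Finset (V × Bool)} (hT : R.IsClosedFamily T Z)
    (hM : #Z ≤ M) {h : ℝ} (hη0 : ∀ e, (T e).Nonempty → 0 ≤ η #(R.vs e))
    (hη : ∀ e, (T e).Nonempty → η #(R.vs e) ≤ h) (h0 : 0 ≤ h) (h1 : (4 ^ M : ℕ) * h ≤ 1) :
    |R.count T - ∏ e, R.dens e ^ #(T e)| ≤
      2 * (4 ^ M : ℕ) * h * ∏ e, R.dens e ^ #(T e) := by
  obtain ⟨hl, hu⟩ := hR T Z hT hM
  set n := ∑ e, #(T e) with hn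
  have hnM : n ≤ 4 ^ M := R.sum_card_le hT hM
  have hnh : (n : ℝ) * h ≤ (4 ^ M : ℕ) * h :=
    mul_le_mul_of_nonneg_right (by exact_mod_cast hnM) h0
  set P := ∏ e, R.dens e ^ #(T e) with hP
  have hP0 : 0 < P := Finset.prod_pos fun e _ => pow_pos (R.dens_pos e) _
  have hh1 : h ≤ 1 := by
    have : (1 : ℝ) ≤ (4 ^ M : ℕ) := by exact_mod_cast Nat.one_le_pow _ _ (by norm_num)
    nlinarith
  have hlow : (1 - h) ^ n * P ≤ R.count T := by
    refine le_trans (le_of_eq_of_le (b := ∏ e, ∏ _t ∈ T e, ((1 - h) * R.dens e)) ?_ ?_) hl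
    · simp only [Finset.prod_const, mul_pow, Finset.prod_mul_distrib]
      rw [Finset.prod_pow_eq_pow_sum]
    · refine Finset.prod_le_prod
        (fun e _ => Finset.prod_nonneg fun t ht => mul_nonneg (by linarith) (R.dens_pos e).le)
        fun e _ => Finset.prod_le_prod
          (fun t ht => mul_nonneg (by linarith) (R.dens_pos e).le) fun t ht => ?_
      exact mul_le_mul_of_nonneg_right (by linarith [hη e ⟨t, ht⟩]) (R.dens_pos e).le
  have hupp : R.count T ≤ (1 + h) ^ n * P := by
    refine hu.trans (le_of_le_of_eq (b := ∏ e, ∏ _t ∈ T e, ((1 + h) * R.dens e)) ?_ ?_)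
    · refine Finset.prod_le_prod
        (fun e _ => Finset.prod_nonneg fun t ht =>
          mul_nonneg (by linarith [hη0 e ⟨t, ht⟩]) (R.dens_pos e).le)
        fun e _ => Finset.prod_le_prod
          (fun t ht => mul_nonneg (by linarith [hη0 e ⟨t, ht⟩]) (R.dens_pos e).le)
          fun t ht => ?_
      exact mul_le_mul_of_nonneg_right (by linarith [hη e ⟨t, ht⟩]) (R.dens_pos e).le
    · simp only [Finset.prod_const, mul_pow, Finset.prod_mul_distrib]
      rw [Finset.prod_pow_eq_pow_sum]
  obtain ⟨hb1, hb2⟩ := one_sub_pow_bounds h0 hh1 (hnh.trans h1)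
  rw [abs_le]
  constructor
  · nlinarith
  · nlinarith

/-! ### Moments of centered edge indicators. -/

section Centered

variable [DecidableEq E] {κ : Type} [Fintype κ] [DecidableEq κ] [Nonempty κ]

/-- The set `π s` says which vertices use their second copy in copy `s`. All copies of the edges in
`E₀` are always present, with coinciding copies counted once. Expanding the product over a subset
`u` of the copies of `E₁` gives a closed family. The injectivity hypothesis keeps the copies of an
edge of `E₁` distinct, so the model value is exactly a power of `R.D E₁` and the main terms cancel.
-/
theorem expect_centered_le {M : ℕ} {η : ℕ → ℝ} (hR : R.Regular M η)
    (π : κ → Finset V) {E₀ E₁ : Finset E} {Z : Finset (V × Bool)}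
    (hdisj : Disjoint E₀ E₁)
    (h₀ : ∀ e ∈ E₀, ∀ e', R.vs e' ⊆ R.vs e → e' ∈ E₀)
    (h₁ : ∀ e ∈ E₁, ∀ e', R.vs e' ⊆ R.vs e → e' ∈ E₀ ∨ e' ∈ E₁)
    (hinj : ∀ e ∈ E₁, Function.Injective fun s => π s ∩ R.vs e)
    (hZ : ∀ e, e ∈ E₀ ∨ e ∈ E₁ → ∀ s, ∀ v ∈ R.vs e, (v, decide (v ∈ π s)) ∈ Z)
    (hM : #Z ≤ M) {h : ℝ} (hη0 : ∀ e, e ∈ E₀ ∨ e ∈ E₁ → 0 ≤ η #(R.vs e))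
    (hη : ∀ e, e ∈ E₀ ∨ e ∈ E₁ → η #(R.vs e) ≤ h) (h0 : 0 ≤ h) (h1 : (4 ^ M : ℕ) * h ≤ 1) :
    𝔼 x : (∀ v, Y v), 𝔼 y : (∀ v, Y v),
      (∏ e ∈ E₀, ∏ t ∈ univ.image (fun s => π s ∩ R.vs e), R.ind e (t.piecewise y x)) *
        ∏ s, (R.Ind E₁ ((π s).piecewise y x) - R.D E₁) ≤
      2 ^ Fintype.card κ * (2 * (4 ^ M : ℕ) * h) *
        ((∏ e ∈ E₀, R.dens e ^ #(univ.image (fun s => π s ∩ R.vs e))) *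
          R.D E₁ ^ Fintype.card κ) := by
  rw [← Finset.expect_product']
  refine expect_mul_prod_sub_le
    (F := fun p : (∀ v, Y v) × (∀ v, Y v) =>
      ∏ e ∈ E₀, ∏ t ∈ univ.image (fun s => π s ∩ R.vs e), R.ind e (t.piecewise p.2 p.1))
    (J := fun s p => R.Ind E₁ ((π s).piecewise p.2 p.1)) (R.D_pos _).le ?_
  intro u
  set T : E → Finset (Finset V) := fun e =>
    if e ∈ E₀ then univ.image (fun s => π s ∩ R.vs e)
    else if e ∈ E₁ then u.image (fun s => π s ∩ R.vs e) else ∅ with hTdef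
  have hTmem : ∀ e, ∀ t ∈ T e, (e ∈ E₀ ∨ e ∈ E₁) ∧ ∃ s, π s ∩ R.vs e = t := by
    intro e t ht
    simp only [hTdef] at ht
    split_ifs at ht with ha hb
    · exact ⟨Or.inl ha, by simpa using ht⟩
    · obtain ⟨s, _, hs⟩ := Finset.mem_image.1 ht
      exact ⟨Or.inr hb, s, hs⟩
    · simp at ht
  have hT : R.IsClosedFamily T Z := by
    refine ⟨?_, ?_, ?_⟩
    · intro e t ht
      obtain ⟨_, s, rfl⟩ := hTmem e t ht
      exact Finset.inter_subset_right
    · intro e t ht e' he'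
      have key : ∀ s, π s ∩ R.vs e ∩ R.vs e' = π s ∩ R.vs e' := fun s => by
        rw [Finset.inter_assoc, Finset.inter_eq_right.2 he']
      simp only [hTdef] at ht ⊢
      by_cases ha : e ∈ E₀
      · have hb := h₀ e ha e' he'
        rw [if_pos ha] at ht
        rw [if_pos hb]
        obtain ⟨s, _, rfl⟩ := Finset.mem_image.1 ht
        exact Finset.mem_image.2 ⟨s, Finset.mem_univ _, (key s).symm⟩
      · rw [if_neg ha] at ht
        by_cases hb : e ∈ E₁
        · rw [if_pos hb] at ht
          obtain ⟨s, hs, rfl⟩ := Finset.mem_image.1 ht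
          rw [key]
          by_cases hc : e' ∈ E₀
          · rw [if_pos hc]
            exact Finset.mem_image_of_mem _ (Finset.mem_univ _)
          · rw [if_neg hc, if_pos ((h₁ e hb e' he').resolve_left hc)]
            exact Finset.mem_image_of_mem _ hs
        · simp [hb] at ht
    · intro e t ht v hv
      obtain ⟨he, s, rfl⟩ := hTmem e t ht
      have := hZ e he s v hv
      simpa [hv] using this
  have hne : ∀ e, (T e).Nonempty → e ∈ E₀ ∨ e ∈ E₁ := fun e ⟨t, ht⟩ => (hTmem e t ht).1
  have hsplit : ∀ f : E → Finset (Finset V) → ℝ, (∀ e, f e ∅ = 1) → ∏ e, f e (T e) =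
      (∏ e ∈ E₀, f e (univ.image (fun s => π s ∩ R.vs e))) *
        ∏ e ∈ E₁, f e (u.image (fun s => π s ∩ R.vs e)) := by
    intro f hf
    rw [← Finset.prod_subset (Finset.subset_univ (E₀ ∪ E₁)), Finset.prod_union hdisj]
    · congr 1
      · exact Finset.prod_congr rfl fun e he => by simp [hTdef, he]
      · exact Finset.prod_congr rfl fun e he => by
          simp [hTdef, he, Finset.disjoint_right.1 hdisj he]
    · intro e _ he
      have : T e = ∅ := by
        rw [Finset.mem_union] at he
        exact Finset.not_nonempty_iff_eq_empty.1 fun h => he (hne e h)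
      rw [this, hf]
  have hcount : R.count T = 𝔼 p : (∀ v, Y v) × (∀ v, Y v),
      (∏ e ∈ E₀, ∏ t ∈ univ.image (fun s => π s ∩ R.vs e), R.ind e (t.piecewise p.2 p.1)) *
        ∏ s ∈ u, R.Ind E₁ ((π s).piecewise p.2 p.1) := by
    rw [count, ← Finset.expect_product']
    refine Finset.expect_congr rfl fun p _ => ?_
    rw [hsplit (fun e S => ∏ t ∈ S, R.ind e (t.piecewise p.2 p.1)) (fun e => by simp)]
    congr 1
    simp only [Ind]
    rw [Finset.prod_comm]
    refine Finset.prod_congr rfl fun e he => ?_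
    rw [Finset.prod_image (hinj e he).injOn]
    refine Finset.prod_congr rfl fun s _ => R.dependsOn_ind e fun v hv => ?_
    have hv' : v ∈ R.vs e := hv
    simp [Finset.piecewise, hv']
  have hdens : ∏ e, R.dens e ^ #(T e) =
      (∏ e ∈ E₀, R.dens e ^ #(univ.image (fun s => π s ∩ R.vs e))) * R.D E₁ ^ #u := by
    rw [hsplit (fun e S => R.dens e ^ #S) (fun e => by simp), D, ← Finset.prod_pow]
    congr 1
    exact Finset.prod_congr rfl fun e he => by
      rw [Finset.card_image_of_injective _ (hinj e he)]
  have := R.abs_count_sub_le hR hT hM (fun e he => hη0 e (hne e he))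
    (fun e he => hη e (hne e he)) h0 h1
  rw [hcount, hdens] at this
  exact this

end Centered

end EdgeSystem

namespace EdgeSystem

variable {V : Type} {Y : V → Type} {E : Type} (R : EdgeSystem V Y E)

/-! ### Neighbourhoods; edges inside, crossing and touching a set. -/

section Sets

variable [DecidableEq V] [Fintype V] [Fintype E]

open Classical in
/-- The neighbors in `U ∖ A` of the vertices of `A`. -/
noncomputable def nbr (A U : Finset V) : Finset V :=
  {w ∈ U \ A | ∃ a ∈ A, ∃ e, R.vs e = {a, w}}

open Classical in
/-- The edges in `A` of size at most `i`. -/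
noncomputable def inside (A : Finset V) (i : ℕ) : Finset E :=
  {e | R.vs e ⊆ A ∧ #(R.vs e) ≤ i}

open Classical in
/-- The edges in `U` of size at most `i` with vertices both in `A` and outside `A`. -/
noncomputable def cross (A U : Finset V) (i : ℕ) : Finset E :=
  {e | R.vs e ⊆ U ∧ ¬ Disjoint (R.vs e) A ∧ ¬ R.vs e ⊆ A ∧ #(R.vs e) ≤ i}

open Classical in
/-- The edges in `U` that meet `A`. -/
noncomputable def touch (A U : Finset V) : Finset E :=
  {e | R.vs e ⊆ U ∧ ¬ Disjoint (R.vs e) A}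

variable {R}

theorem mem_nbr {A U : Finset V} {w : V} :
    w ∈ R.nbr A U ↔ (w ∈ U ∧ w ∉ A) ∧ ∃ a ∈ A, ∃ e, R.vs e = {a, w} := by
  simp [nbr]

theorem mem_inside {A : Finset V} {i : ℕ} {e : E} :
    e ∈ R.inside A i ↔ R.vs e ⊆ A ∧ #(R.vs e) ≤ i := by
  simp [inside]

theorem mem_cross {A U : Finset V} {i : ℕ} {e : E} :
    e ∈ R.cross A U i ↔
      R.vs e ⊆ U ∧ ¬ Disjoint (R.vs e) A ∧ ¬ R.vs e ⊆ A ∧ #(R.vs e) ≤ i := by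
  simp [cross]

theorem mem_touch {A U : Finset V} {e : E} :
    e ∈ R.touch A U ↔ R.vs e ⊆ U ∧ ¬ Disjoint (R.vs e) A := by
  simp [touch]

theorem not_disjoint_of_vs_subset {A : Finset V} {e : E} (h : R.vs e ⊆ A) :
    ¬ Disjoint (R.vs e) A := by
  obtain ⟨v, hv⟩ := R.vs_nonempty e
  exact Finset.not_disjoint_iff.2 ⟨v, hv, h hv⟩

theorem inside_zero (A : Finset V) : R.inside A 0 = ∅ := by
  ext e
  simpa [mem_inside, Finset.card_eq_zero] using fun _ => (R.vs_nonempty e).ne_empty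

theorem cross_zero (A U : Finset V) : R.cross A U 0 = ∅ := by
  ext e
  simpa [mem_cross, Finset.card_eq_zero] using fun _ _ _ => (R.vs_nonempty e).ne_empty

theorem nbr_subset (A U : Finset V) : R.nbr A U ⊆ U \ A := fun w hw => by
  rw [mem_nbr] at hw
  simpa using hw.1

theorem disjoint_nbr (A U : Finset V) : Disjoint A (R.nbr A U) :=
  Finset.disjoint_left.2 fun _ ha hn => (mem_nbr.1 hn).1.2 ha

/-- An edge that meets `A` lies in `A` and the neighborhood of `A`. -/
theorem vs_subset_of_touch {A U : Finset V} {e : E} (he : e ∈ R.touch A U) :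
    R.vs e ⊆ A ∪ R.nbr A U := by
  obtain ⟨heU, hA⟩ := mem_touch.1 he
  obtain ⟨a, hae, haA⟩ := Finset.not_disjoint_iff.1 hA
  intro w hw
  by_cases hwA : w ∈ A
  · exact Finset.mem_union_left _ hwA
  · refine Finset.mem_union_right _ (mem_nbr.2 ⟨⟨heU hw, hwA⟩, a, haA, ?_⟩)
    exact R.exists_vs_eq e {a, w} (by
      intro v hv
      rcases Finset.mem_insert.1 hv with rfl | hv
      · exact hae
      · rw [Finset.mem_singleton.1 hv]; exact hw) ⟨a, by simp⟩

theorem inside_subset_touch {A U : Finset V} (h : A ⊆ U) (i : ℕ) :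
    R.inside A i ⊆ R.touch A U := fun e he => by
  rw [mem_inside] at he
  exact mem_touch.2 ⟨he.1.trans h, not_disjoint_of_vs_subset he.1⟩

theorem cross_subset_touch (A U : Finset V) (i : ℕ) : R.cross A U i ⊆ R.touch A U :=
  fun e he => by
    rw [mem_cross] at he
    exact mem_touch.2 ⟨he.1, he.2.1⟩

theorem disjoint_inside_cross (A U : Finset V) (i : ℕ) :
    Disjoint (R.inside A i) (R.cross A U i) :=
  Finset.disjoint_left.2 fun _ h1 h2 => (mem_cross.1 h2).2.2.1 (mem_inside.1 h1).1

variable (R) in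
/-- All vertices have at most `Δ` neighbors. -/
def DegreeLE (Δ : ℕ) : Prop :=
  ∀ (v : V) (U : Finset V), #(R.nbr {v} U) ≤ Δ

theorem card_nbr_le {Δ : ℕ} (h : R.DegreeLE Δ) (A U : Finset V) :
    #(R.nbr A U) ≤ #A * Δ := by
  have : R.nbr A U ⊆ A.biUnion fun a => R.nbr {a} U := by
    intro w hw
    obtain ⟨⟨h1, h2⟩, a, ha, e, he⟩ := mem_nbr.1 hw
    refine Finset.mem_biUnion.2 ⟨a, ha, mem_nbr.2 ⟨⟨h1, ?_⟩, a, by simp, e, he⟩⟩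
    rintro h3
    rw [Finset.mem_singleton] at h3
    exact h2 (h3 ▸ ha)
  exact (Finset.card_le_card this).trans (Finset.card_biUnion_le_card_mul _ _ _ fun a _ => h a U)

end Sets

/-! ### Weights and vertex-by-vertex extension. -/

section Weight

variable [DecidableEq V] [Fintype V] [∀ v, Fintype (Y v)] [Fintype E]

/-- A nonnegative weight `ω U` on the points, for each vertex set `U`: the indicator of the event
that all edges in `U` are embedded, possibly together with further conditions on the images of the
vertices in `U` that cost at most `ζ` for each vertex. -/
structure IsWeight (ω : Finset V → (∀ v, Y v) → ℝ) (ζ : ℝ) : Prop where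
  nonneg : ∀ U x, 0 ≤ ω U x
  dependsOn : ∀ U, DependsOn (ω U) (U : Set V)
  le_touch : ∀ U A, A ⊆ U → ∀ x, ω U x ≤ R.Ind (R.touch A U) x * ω (U \ A) x
  expect_empty : 0 < 𝔼 x, ω ∅ x
  le_expect : ∀ U, ∀ u ∈ U, ∀ g : (∀ v, Y v) → ℝ, (∀ x, 0 ≤ g x) → (∀ x, g x ≤ 1) →
    𝔼 x, g x * (R.Ind (R.touch {u} U) x * ω (U \ {u}) x) - ζ * 𝔼 x, ω (U \ {u}) x ≤
      𝔼 x, g x * ω U x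

/-- Each vertex of a subset of `U` can be added at the expected cost, up to the factor `1 - s`. -/
def Extends (ω : Finset V → (∀ v, Y v) → ℝ) (s : ℝ) (U : Finset V) : Prop :=
  ∀ U' ⊆ U, ∀ u ∈ U',
    (1 - s) * R.D (R.touch {u} U') * 𝔼 x, ω (U' \ {u}) x ≤ 𝔼 x, ω U' x

variable {R}

theorem Extends.mono {ω : Finset V → (∀ v, Y v) → ℝ} {s : ℝ} {U U' : Finset V}
    (h : R.Extends ω s U) (hU : U' ⊆ U) : R.Extends ω s U' :=
  fun W hW => h W (hW.trans hU)

/-- The vertices of `A` are removed one at a time. The edges meeting `insert a A` are those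
containing `a` together with those meeting `A` and avoiding `a`; these sets are disjoint, so their
densities multiply. -/
theorem Extends.pow_le {ω : Finset V → (∀ v, Y v) → ℝ} {s : ℝ} (hs : s ≤ 1) (A : Finset V) :
    ∀ {U : Finset V}, R.Extends ω s U → A ⊆ U →
      (1 - s) ^ #A * R.D (R.touch A U) * 𝔼 x, ω (U \ A) x ≤ 𝔼 x, ω U x := by
  classical
  induction A using Finset.induction_on with
  | empty =>
    intro U _ _
    have : R.touch ∅ U = ∅ := by ext e; simp [mem_touch]
    simp [this, D]
  | insert a A ha ih =>
    intro U hU hA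
    have haU : a ∈ U := hA (Finset.mem_insert_self _ _)
    have hAU : A ⊆ U \ {a} := fun v hv => by
      rw [Finset.mem_sdiff, Finset.mem_singleton]
      exact ⟨hA (Finset.mem_insert_of_mem hv), fun h => ha (h ▸ hv)⟩
    have h1 := ih (hU.mono Finset.sdiff_subset) hAU
    have h2 := hU U subset_rfl a haU
    have hsplit : R.touch (insert a A) U = R.touch {a} U ∪ R.touch A (U \ {a}) := by
      ext e
      simp only [mem_touch, Finset.mem_union, Finset.disjoint_insert_right,
        Finset.disjoint_singleton_right, Finset.subset_sdiff]
      tauto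
    have hdisj : Disjoint (R.touch {a} U) (R.touch A (U \ {a})) :=
      Finset.disjoint_left.2 fun e h1 h2 => by
        rw [mem_touch, Finset.subset_sdiff] at h2
        exact (mem_touch.1 h1).2 h2.1.2
    have hD : R.D (R.touch (insert a A) U) =
        R.D (R.touch {a} U) * R.D (R.touch A (U \ {a})) := by
      rw [hsplit, D, Finset.prod_union hdisj]; rfl
    have hset : U \ insert a A = (U \ {a}) \ A := by
      ext v; simp only [Finset.mem_sdiff, Finset.mem_insert, Finset.mem_singleton]; tauto
    rw [hset, hD, Finset.card_insert_of_notMem ha, pow_succ]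
    calc _ = (1 - s) * R.D (R.touch {a} U) * ((1 - s) ^ #A * R.D (R.touch A (U \ {a})) *
            𝔼 x, ω ((U \ {a}) \ A) x) := by ring
      _ ≤ (1 - s) * R.D (R.touch {a} U) * 𝔼 x, ω (U \ {a}) x :=
          mul_le_mul_of_nonneg_left h1 (mul_nonneg (by linarith) (R.D_pos _).le)
      _ ≤ _ := h2

end Weight

/-! ### Second-moment estimates obtained by doubling vertices. -/

section Box

variable [DecidableEq V] [Fintype V] [∀ v, Fintype (Y v)] [∀ v, Nonempty (Y v)] [Fintype E]

theorem Ind_piecewise_of_subset {A : Finset V} {s : Finset E} (h : ∀ e ∈ s, R.vs e ⊆ A)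
    (x y : ∀ v, Y v) : R.Ind s (A.piecewise x y) = R.Ind s x :=
  apply_piecewise_of_subset (R.dependsOn_Ind h) subset_rfl x y

/-- The box norm of the deviation of the crossing edges from their density. -/
theorem expect_box_le {M : ℕ} {η : ℕ → ℝ} (hR : R.Regular M η) {A U : Finset V} {i : ℕ}
    (hM : 2 * (#A + #(R.nbr A U)) ≤ M) {h : ℝ}
    (hη0 : ∀ e, #(R.vs e) ≤ i + 1 → 0 ≤ η #(R.vs e))
    (hη : ∀ e, #(R.vs e) ≤ i + 1 → η #(R.vs e) ≤ h) (h0 : 0 ≤ h)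
    (h1 : (4 ^ M : ℕ) * h ≤ 1) :
    𝔼 x : (∀ v, Y v), 𝔼 x' : (∀ v, Y v), 𝔼 y : (∀ v, Y v), 𝔼 y' : (∀ v, Y v),
      R.Ind (R.inside A (i + 1)) x * R.Ind (R.inside A (i + 1)) x' *
        (R.Ind (R.inside (R.nbr A U) i) y * R.Ind (R.inside (R.nbr A U) i) y') *
      (((R.Ind (R.cross A U (i + 1)) (A.piecewise x y) - R.D (R.cross A U (i + 1))) *
        (R.Ind (R.cross A U (i + 1)) (A.piecewise x' y) - R.D (R.cross A U (i + 1)))) *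
       ((R.Ind (R.cross A U (i + 1)) (A.piecewise x y') - R.D (R.cross A U (i + 1))) *
        (R.Ind (R.cross A U (i + 1)) (A.piecewise x' y') - R.D (R.cross A U (i + 1))))) ≤
      32 * (4 ^ M : ℕ) * h * (R.D (R.inside A (i + 1)) * R.D (R.inside (R.nbr A U) i) *
        R.D (R.cross A U (i + 1)) ^ 2) ^ 2 := by
  classical
  set N := R.nbr A U with hN
  set I := R.inside A (i + 1)
  set I' := R.inside N i
  set J := R.cross A U (i + 1)
  have hAN : Disjoint A N := disjoint_nbr A U
  -- The copies of `A` and of its neighbourhood are chosen independently, so a crossing edge has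
  -- four copies, the corners of the box.
  set π : Bool × Bool → Finset V := fun b => (if b.1 then A else ∅) ∪ (if b.2 then N else ∅)
    with hπ
  have hI : ∀ e ∈ I, R.vs e ⊆ A := fun e he => (mem_inside.1 he).1
  have hI' : ∀ e ∈ I', R.vs e ⊆ N := fun e he => (mem_inside.1 he).1
  have hJ : ∀ e ∈ J, R.vs e ⊆ A ∪ N := fun e he =>
    vs_subset_of_touch (cross_subset_touch _ _ _ he)
  have hII' : Disjoint I I' := Finset.disjoint_left.2 fun e h1 h2 => by
    obtain ⟨v, hv⟩ := R.vs_nonempty e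
    exact Finset.disjoint_left.1 hAN (hI e h1 hv) (hI' e h2 hv)
  have hcross : ∀ e ∈ J, ∃ a ∈ R.vs e, ∃ w ∈ R.vs e, a ∈ A ∧ w ∈ N ∧ a ∉ N ∧ w ∉ A := by
    intro e he
    obtain ⟨_, h2, h3, _⟩ := mem_cross.1 he
    obtain ⟨a, hae, haA⟩ := Finset.not_disjoint_iff.1 h2
    obtain ⟨w, hwe, hwA⟩ := Finset.not_subset.1 h3
    have hwN : w ∈ N := (Finset.mem_union.1 (hJ e he hwe)).resolve_left hwA
    exact ⟨a, hae, w, hwe, haA, hwN, Finset.disjoint_left.1 hAN haA, hwA⟩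
  have hsize : ∀ e, e ∈ I ∪ I' ∨ e ∈ J → #(R.vs e) ≤ i + 1 := by
    rintro e (he | he)
    · rcases Finset.mem_union.1 he with he | he
      · exact (mem_inside.1 he).2
      · exact (mem_inside.1 he).2.trans (Nat.le_succ i)
    · exact (mem_cross.1 he).2.2.2
  have key := R.expect_centered_le hR π (E₀ := I ∪ I') (E₁ := J)
    (Z := (A ∪ N) ×ˢ univ) ?_ ?_ ?_ ?_ ?_ ?_ (h := h) ?_ ?_ h0 h1
  -- An edge inside `A` or inside `N` sees only one of the two flags and so has just two copies;
  -- hence the exponent two of its density.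
  · have himA : ∀ e ∈ I, (univ.image fun s => π s ∩ R.vs e) = {∅, R.vs e} := by
      intro e he
      have h1 : A ∩ R.vs e = R.vs e := Finset.inter_eq_right.2 (hI e he)
      have h2 : N ∩ R.vs e = ∅ := Finset.disjoint_iff_inter_eq_empty.1
        (hAN.symm.mono_right (hI e he))
      ext t
      simp only [Finset.mem_image, Finset.mem_univ, true_and, Prod.exists, Bool.exists_bool, hπ,
        Finset.union_inter_distrib_right, Finset.mem_insert, Finset.mem_singleton]
      simp [h1, h2, eq_comm]
    have himN : ∀ e ∈ I', (univ.image fun s => π s ∩ R.vs e) = {∅, R.vs e} := by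
      intro e he
      have h1 : N ∩ R.vs e = R.vs e := Finset.inter_eq_right.2 (hI' e he)
      have h2 : A ∩ R.vs e = ∅ := Finset.disjoint_iff_inter_eq_empty.1
        (hAN.mono_right (hI' e he))
      ext t
      simp only [Finset.mem_image, Finset.mem_univ, true_and, Prod.exists, Bool.exists_bool, hπ,
        Finset.union_inter_distrib_right, Finset.mem_insert, Finset.mem_singleton]
      simp [h1, h2, eq_comm]
    have him : ∀ e ∈ I ∪ I', (univ.image fun s => π s ∩ R.vs e) = {∅, R.vs e} := fun e he =>
      (Finset.mem_union.1 he).elim (himA e) (himN e)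
    have hne : ∀ e, (∅ : Finset V) ∉ ({R.vs e} : Finset (Finset V)) := fun e h =>
      (R.vs_nonempty e).ne_empty (Finset.mem_singleton.1 h).symm
    have hF : ∀ x y : (∀ v, Y v), (∏ e ∈ I ∪ I',
        ∏ t ∈ univ.image (fun s => π s ∩ R.vs e), R.ind e (t.piecewise y x)) =
        R.Ind I x * R.Ind I y * (R.Ind I' x * R.Ind I' y) := by
      intro x y
      rw [Finset.prod_congr rfl fun e he => by
        rw [him e he, Finset.prod_insert (hne e), Finset.prod_singleton, Finset.piecewise_empty,
          apply_piecewise_of_subset (R.dependsOn_ind e) subset_rfl]]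
      rw [Finset.prod_union hII', Finset.prod_mul_distrib, Finset.prod_mul_distrib]
      rfl
    have hDF : ∏ e ∈ I ∪ I', R.dens e ^ #(univ.image (fun s => π s ∩ R.vs e)) =
        (R.D I * R.D I') ^ 2 := by
      rw [Finset.prod_congr rfl fun e he => by
        rw [him e he, Finset.card_insert_of_notMem (hne e), Finset.card_singleton]]
      rw [Finset.prod_pow, Finset.prod_union hII']
      rfl
    have hJp : ∀ (b : Bool × Bool) (x x' y y' : ∀ v, Y v),
        R.Ind J ((π b).piecewise (A.piecewise x' y') (A.piecewise x y)) =
          R.Ind J (A.piecewise (if b.1 then x' else x) (if b.2 then y' else y)) := by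
      intro b x x' y y'
      refine R.dependsOn_Ind hJ fun v hv => ?_
      rcases Finset.mem_union.1 hv with hv | hv
      · have : v ∉ N := Finset.disjoint_left.1 hAN hv
        rcases b with ⟨_ | _, _ | _⟩ <;> simp [hπ, hv, this]
      · have : v ∉ A := Finset.disjoint_right.1 hAN hv
        rcases b with ⟨_ | _, _ | _⟩ <;> simp [hπ, hv, this]
    have hcard : Fintype.card (Bool × Bool) = 4 := rfl
    rw [hDF, hcard] at key
    refine le_trans (le_of_eq ?_) (key.trans (le_of_eq (by ring)))
    simp only [hF]
    symm
    -- Two independent points are recombined along `A`, so that their parts on `A` and outside `A`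
    -- become the four independent variables of the box.
    refine (expect_piecewise A _).symm.trans ?_
    refine Finset.expect_congr rfl fun x _ => ?_
    rw [Finset.expect_comm (t := univ) (s := univ)
      (f := fun x' y => 𝔼 y' : (∀ v, Y v), R.Ind I x * R.Ind I x' * _ * _)]
    refine Finset.expect_congr rfl fun y _ => ?_
    refine (expect_piecewise A _).symm.trans ?_
    refine Finset.expect_congr rfl fun x' _ => ?_
    refine Finset.expect_congr rfl fun y' _ => ?_
    simp only [hJp]
    rw [Ind_piecewise_of_subset R hI, Ind_piecewise_of_subset R hI,
      apply_piecewise_of_disjoint (R.dependsOn_Ind hI') hAN.symm,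
      apply_piecewise_of_disjoint (R.dependsOn_Ind hI') hAN.symm]
    simp only [Fintype.prod_prod_type, Fintype.prod_bool, if_true, Bool.false_eq_true, if_false]
    ring
  · rw [Finset.disjoint_union_left]
    refine ⟨disjoint_inside_cross _ _ _, Finset.disjoint_left.2 fun e h1 h2 => ?_⟩
    obtain ⟨a, hae, _, _, _, _, haN, _⟩ := hcross e h2
    exact haN (hI' e h1 hae)
  · intro e he e' he'
    have hc := Finset.card_le_card he'
    rcases Finset.mem_union.1 he with he | he
    · obtain ⟨h1, h2⟩ := mem_inside.1 he
      exact Finset.mem_union_left _ (mem_inside.2 ⟨he'.trans h1, hc.trans h2⟩)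
    · obtain ⟨h1, h2⟩ := mem_inside.1 he
      exact Finset.mem_union_right _ (mem_inside.2 ⟨he'.trans h1, hc.trans h2⟩)
  · intro e he e' he'
    have hc := Finset.card_le_card he'
    obtain ⟨h1, h2, h3, h4⟩ := mem_cross.1 he
    by_cases ha : R.vs e' ⊆ A
    · exact Or.inl (Finset.mem_union_left _ (mem_inside.2 ⟨ha, hc.trans h4⟩))
    by_cases hb : Disjoint (R.vs e') A
    · refine Or.inl (Finset.mem_union_right _ (mem_inside.2 ⟨fun v hv => ?_, ?_⟩))
      · exact (Finset.mem_union.1 (hJ e he (he' hv))).resolve_left (Finset.disjoint_left.1 hb hv)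
      -- A part of a crossing edge that avoids `A` is a proper part, hence has size at most `i`.
      -- This drop in size drives the later induction.
      · obtain ⟨a, hae, _, _, haA, _⟩ := hcross e he
        have : R.vs e' ⊂ R.vs e := Finset.ssubset_iff_subset_ne.2
          ⟨he', fun h => Finset.disjoint_left.1 hb (h ▸ hae) haA⟩
        have := Finset.card_lt_card this
        omega
    · exact Or.inr (mem_cross.2 ⟨he'.trans h1, hb, ha, hc.trans h4⟩)
  · intro e he b b' hbb
    obtain ⟨a, hae, w, hwe, haA, hwN, haN, hwA⟩ := hcross e he
    have h1 := Finset.ext_iff.1 hbb a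
    have h2 := Finset.ext_iff.1 hbb w
    rcases b with ⟨_ | _, _ | _⟩ <;> rcases b' with ⟨_ | _, _ | _⟩ <;>
      simp [hπ, hae, hwe, haA, hwN, haN, hwA] at h1 h2 ⊢
  · intro e he s v hv
    refine Finset.mem_product.2 ⟨?_, Finset.mem_univ _⟩
    rcases he with he | he
    · rcases Finset.mem_union.1 he with he | he
      · exact Finset.mem_union_left _ (hI e he hv)
      · exact Finset.mem_union_right _ (hI' e he hv)
    · exact hJ e he hv
  · rw [Finset.card_product, Finset.card_union_of_disjoint hAN, Finset.card_univ,
      Fintype.card_bool]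
    omega
  · exact fun e he => hη0 e (hsize e he)
  · exact fun e he => hη e (hsize e he)

/-- The variance of the density of the edges at a vertex. -/
theorem expect_star_le {M : ℕ} {η : ℕ → ℝ} (hR : R.Regular M η) {U : Finset V} {u : V}
    (hM : 2 * (1 + #(R.nbr {u} U)) ≤ M) {k : ℕ} (hk : ∀ e, #(R.vs e) ≤ k) {h : ℝ}
    (hη0 : ∀ e, 0 ≤ η #(R.vs e)) (hη : ∀ e, η #(R.vs e) ≤ h) (h0 : 0 ≤ h)
    (h1 : (4 ^ M : ℕ) * h ≤ 1) :
    𝔼 y : (∀ v, Y v), R.Ind (R.inside (R.nbr {u} U) (k - 1)) y *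
      (𝔼 x : (∀ v, Y v), (R.Ind (R.touch {u} U) (({u} : Finset V).piecewise x y) -
        R.D (R.touch {u} U))) ^ 2 ≤
      8 * (4 ^ M : ℕ) * h *
        (R.D (R.inside (R.nbr {u} U) (k - 1)) * R.D (R.touch {u} U) ^ 2) := by
  classical
  set N := R.nbr {u} U with hN
  set I := R.inside N (k - 1)
  set J := R.touch {u} U
  have huN : Disjoint {u} N := disjoint_nbr {u} U
  -- Only `u` is doubled: the two copies share their neighbours, and the centered moment is the
  -- second moment of the deviation of the star.
  set π : Bool → Finset V := fun b => if b then {u} else ∅ with hπ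
  have hI : ∀ e ∈ I, R.vs e ⊆ N := fun e he => (mem_inside.1 he).1
  have hJ : ∀ e ∈ J, R.vs e ⊆ {u} ∪ N := fun e he => vs_subset_of_touch he
  have huJ : ∀ e ∈ J, u ∈ R.vs e := fun e he => by
    have := (mem_touch.1 he).2
    simpa using this
  have key := R.expect_centered_le hR π (E₀ := I) (E₁ := J)
    (Z := ({u} ∪ N) ×ˢ univ) ?_ ?_ ?_ ?_ ?_ ?_ (h := h) ?_ ?_ h0 h1
  · have him : ∀ e ∈ I, (univ.image fun s => π s ∩ R.vs e) = {∅} := by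
      intro e he
      have h2 : {u} ∩ R.vs e = ∅ := Finset.disjoint_iff_inter_eq_empty.1
        (huN.mono_right (hI e he))
      ext t
      simp only [Finset.mem_image, Finset.mem_univ, true_and, Bool.exists_bool, hπ,
        Finset.mem_singleton]
      simp [h2, eq_comm]
    have hF : ∀ x y : (∀ v, Y v), (∏ e ∈ I,
        ∏ t ∈ univ.image (fun s => π s ∩ R.vs e), R.ind e (t.piecewise y x)) = R.Ind I x := by
      intro x y
      exact Finset.prod_congr rfl fun e he => by
        rw [him e he, Finset.prod_singleton, Finset.piecewise_empty]
    have hDF : ∏ e ∈ I, R.dens e ^ #(univ.image (fun s => π s ∩ R.vs e)) = R.D I :=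
      Finset.prod_congr rfl fun e he => by rw [him e he, Finset.card_singleton, pow_one]
    rw [hDF, Fintype.card_bool] at key
    refine le_trans (le_of_eq ?_) (key.trans (le_of_eq (by ring)))
    simp only [hF]
    symm
    refine (expect_piecewise ({u} : Finset V) _).symm.trans ?_
    rw [Finset.expect_comm]
    refine Finset.expect_congr rfl fun y _ => ?_
    symm
    rw [sq, Finset.expect_mul, Finset.mul_expect]
    refine Finset.expect_congr rfl fun x _ => ?_
    rw [Finset.mul_expect, Finset.mul_expect]
    refine Finset.expect_congr rfl fun x' _ => ?_
    rw [apply_piecewise_of_disjoint (R.dependsOn_Ind hI) huN.symm]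
    have hp : ({u} : Finset V).piecewise x' (({u} : Finset V).piecewise x y) =
        ({u} : Finset V).piecewise x' y := by
      ext v
      by_cases hv : v ∈ ({u} : Finset V) <;> simp [Finset.piecewise, hv]
    have hπt : π true = {u} := rfl
    have hπf : π false = ∅ := rfl
    rw [Fintype.prod_bool, hπt, hπf, Finset.piecewise_empty, hp]
    ring
  · exact Finset.disjoint_left.2 fun e h1 h2 =>
      Finset.disjoint_left.1 huN (Finset.mem_singleton_self u) (hI e h1 (huJ e h2))
  · intro e he e' he'
    obtain ⟨h1, h2⟩ := mem_inside.1 he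
    exact mem_inside.2 ⟨he'.trans h1, (Finset.card_le_card he').trans h2⟩
  · intro e he e' he'
    by_cases hu : u ∈ R.vs e'
    · exact Or.inr (mem_touch.2 ⟨he'.trans (mem_touch.1 he).1, by simpa using hu⟩)
    · refine Or.inl (mem_inside.2 ⟨fun v hv => ?_, ?_⟩)
      · refine (Finset.mem_union.1 (hJ e he (he' hv))).resolve_left fun h => ?_
        rw [Finset.mem_singleton] at h
        exact hu (h ▸ hv)
      · have : R.vs e' ⊂ R.vs e := Finset.ssubset_iff_subset_ne.2
          ⟨he', fun h => hu (h ▸ huJ e he)⟩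
        have := Finset.card_lt_card this
        have := hk e
        omega
  · intro e he b b' hbb
    have h1 := Finset.ext_iff.1 hbb u
    have := huJ e he
    rcases b with _ | _ <;> rcases b' with _ | _ <;> simp [hπ, this] at h1 ⊢
  · intro e he s v hv
    refine Finset.mem_product.2 ⟨?_, Finset.mem_univ _⟩
    rcases he with he | he
    · exact Finset.mem_union_right _ (hI e he hv)
    · exact hJ e he hv
  · rw [Finset.card_product, Finset.card_union_of_disjoint huN, Finset.card_univ,
      Fintype.card_bool, Finset.card_singleton]
    omega
  · exact fun e _ => hη0 e
  · exact fun e _ => hη e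

end Box

end EdgeSystem

/-! ### The error function. -/

/-- The fourth root of the error allowed for edges whose density exceeds `x`. -/
noncomputable def err (L : ℕ) (x : ℝ) : ℝ := x ^ L / (64 * L)

theorem err_pos {L : ℕ} (hL : 0 < L) {x : ℝ} (hx : 0 < x) : 0 < err L x := by
  unfold err; positivity

/-- This normalization makes a gain of `L * err L x` outweigh the loss `8 / x ^ L` incurred by
changing the weight. -/
theorem mul_err {L : ℕ} (hL : 0 < L) (x : ℝ) : L * err L x = x ^ L / 64 := by
  unfold err
  have : (L : ℝ) ≠ 0 := by positivity
  field_simp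

theorem mul_err_le {L : ℕ} (hL : 0 < L) {x : ℝ} (hx : 0 < x) (hx1 : x ≤ 1) :
    L * err L x ≤ 1 / 64 := by
  rw [mul_err hL]
  have := pow_le_one₀ (n := L) hx.le hx1
  linarith

theorem err_le {L : ℕ} (hL : 0 < L) {x : ℝ} (hx : 0 < x) (hx1 : x ≤ 1) :
    err L x ≤ 1 / 64 := by
  refine le_trans ?_ (mul_err_le hL hx hx1)
  have : (1 : ℝ) ≤ L := by exact_mod_cast hL
  nlinarith [err_pos hL hx]

theorem err_mono {L : ℕ} {x y : ℝ} (hx : 0 ≤ x) (h : x ≤ y) : err L x ≤ err L y := by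
  unfold err
  gcongr

theorem mul_err_pow_le {L : ℕ} (hL : 0 < L) {x : ℝ} (hx : 0 < x) (hx1 : x ≤ 1) :
    L * err L x ^ 4 ≤ 1 / 64 := by
  refine le_trans ?_ (mul_err_le hL hx hx1)
  have h0 := err_pos hL hx
  refine mul_le_mul_of_nonneg_left ?_ (by positivity)
  exact pow_le_of_le_one h0.le ((err_le hL hx hx1).trans (by norm_num)) (by norm_num)

/-! ### Transfer from local averages to averages over all embeddings. -/

namespace EdgeSystem

variable {V : Type} {Y : V → Type} {E : Type} (R : EdgeSystem V Y E)
variable [DecidableEq V] [Fintype V] [∀ v, Fintype (Y v)] [Fintype E]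

/-- The hypotheses on a bounded-degree system of edges of size at most `k`. -/
structure Controlled (k Δ L : ℕ) (ρ : ℕ → ℝ) : Prop where
  one_le_k : 1 ≤ k
  one_le_Δ : 1 ≤ Δ
  L_eq : L = 4 ^ (2 * Δ ^ (2 * k))
  ρ_pos : ∀ i, 1 ≤ i → i ≤ k → 0 < ρ i
  ρ_le_one : ∀ i, 1 ≤ i → i ≤ k → ρ i ≤ 1
  ρ_mono : ∀ i j, 1 ≤ i → i ≤ j → j ≤ k → ρ i ≤ ρ j
  card_le : ∀ e, #(R.vs e) ≤ k
  ρ_le_dens : ∀ e, ρ #(R.vs e) ≤ R.dens e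
  degree : R.DegreeLE Δ
  regular : R.Regular (2 * Δ ^ (2 * k)) fun i => err L (ρ i) ^ 4

/-- The deviation of the expectation of `q` over the embeddings of the small edges in `A` that
extend `y`. -/
noncomputable def deviation (A U : Finset V) (i : ℕ) (q : (∀ v, Y v) → ℝ) (y : ∀ v, Y v) : ℝ :=
  𝔼 x, q x * R.Ind (R.inside A i) x *
    (R.Ind (R.cross A U i) (A.piecewise x y) - R.D (R.cross A U i))

variable {R} {k Δ L : ℕ} {ρ : ℕ → ℝ}

theorem one_le_card_vs (e : E) : 1 ≤ #(R.vs e) := Finset.card_pos.2 (R.vs_nonempty e)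

namespace Controlled

theorem L_pos (hC : R.Controlled k Δ L ρ) : 0 < L := by
  rw [hC.L_eq]; exact Nat.pow_pos (by norm_num)

theorem le_L (hC : R.Controlled k Δ L ρ) : 2 * Δ ^ (2 * k) ≤ L := by
  rw [hC.L_eq]; exact (Nat.lt_pow_self (by norm_num)).le

theorem two_pow_le_L (hC : R.Controlled k Δ L ρ) {n : ℕ} (hn : n ≤ 2 * Δ ^ (2 * k)) :
    2 ^ n ≤ L := by
  rw [hC.L_eq]
  exact (Nat.pow_le_pow_left (by norm_num) n).trans (Nat.pow_le_pow_right (by norm_num) hn)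

theorem error_nonneg (hC : R.Controlled k Δ L ρ) (e : E) : 0 ≤ err L (ρ #(R.vs e)) ^ 4 :=
  pow_nonneg (err_pos hC.L_pos (hC.ρ_pos _ (one_le_card_vs e) (hC.card_le e))).le 4

theorem error_le (hC : R.Controlled k Δ L ρ) {i : ℕ} (hi : i ≤ k) {e : E} (he : #(R.vs e) ≤ i) :
    err L (ρ #(R.vs e)) ^ 4 ≤ err L (ρ i) ^ 4 := by
  have h0 := hC.ρ_pos _ (one_le_card_vs e) (hC.card_le e)
  exact pow_le_pow_left₀ (err_pos hC.L_pos h0).le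
    (err_mono h0.le (hC.ρ_mono _ _ (one_le_card_vs e) he hi)) 4

/-- These edges live on `A` and its neighbours, at most `Δ ^ k + Δ ^ (k + 1) ≤ 2 * Δ ^ (2 * k)`
vertices, and an edge is determined by its vertex set. -/
theorem card_touch_le (hC : R.Controlled k Δ L ρ) {A : Finset V} (hA : #A ≤ Δ ^ k)
    (U : Finset V) : #(R.touch A U) ≤ L := by
  refine (R.card_le_of_vs_subset fun e he => vs_subset_of_touch he).trans (hC.two_pow_le_L ?_)
  refine (Finset.card_union_le _ _).trans ?_
  have h1 := card_nbr_le hC.degree A U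
  have h2 : #A * Δ ≤ Δ ^ k * Δ := Nat.mul_le_mul_right _ hA
  have h3 : Δ ^ k * Δ ≤ Δ ^ (2 * k) := by
    rw [← pow_succ]
    exact Nat.pow_le_pow_right hC.one_le_Δ (by have := hC.one_le_k; omega)
  have h4 : Δ ^ k ≤ Δ ^ (2 * k) := Nat.pow_le_pow_right hC.one_le_Δ (by omega)
  omega

/-- Edges of size greater than `i` that meet a small set have density at least a constant
depending on `ρ (i + 1)`. -/
theorem pow_le_D_of_card_gt (hC : R.Controlled k Δ L ρ) {s : Finset E} (hs : #s ≤ L) {i : ℕ}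
    (hi : i < k) (h : ∀ e ∈ s, i < #(R.vs e)) : ρ (i + 1) ^ L ≤ R.D s :=
  R.pow_le_D (hC.ρ_pos _ (by omega) hi).le (hC.ρ_le_one _ (by omega) hi) hs fun e he =>
    (hC.ρ_mono _ _ (by omega) (h e he) (hC.card_le e)).trans (hC.ρ_le_dens e)

variable [∀ v, Nonempty (Y v)]

/-- The counting hypothesis with nothing doubled: every edge of `s` occurs with its first copy only,
which is encoded by `t = ∅`. -/
theorem abs_expect_Ind_sub_le [DecidableEq E] (hC : R.Controlled k Δ L ρ) {s : Finset E}
    {W : Finset V} (hs : ∀ e ∈ s, ∀ e', R.vs e' ⊆ R.vs e → e' ∈ s) (hW : ∀ e ∈ s, R.vs e ⊆ W)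
    (hM : #W ≤ 2 * Δ ^ (2 * k)) {i : ℕ} (hi : 1 ≤ i) (hik : i ≤ k)
    (hsi : ∀ e ∈ s, #(R.vs e) ≤ i) :
    |𝔼 x, R.Ind s x - R.D s| ≤ 2 * (L * err L (ρ i) ^ 4) * R.D s := by
  set T : E → Finset (Finset V) := fun e => if e ∈ s then {∅} else ∅ with hT
  have hTs : ∀ e, ∀ t ∈ T e, e ∈ s ∧ t = ∅ := by
    intro e t ht
    by_cases he : e ∈ s
    · simp only [hT, if_pos he, Finset.mem_singleton] at ht; exact ⟨he, ht⟩
    · simp [hT, he] at ht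
  have hcl : R.IsClosedFamily T (W ×ˢ {false}) := by
    refine ⟨fun e t ht => ?_, fun e t ht e' he' => ?_, fun e t ht v hv => ?_⟩
    · rw [(hTs e t ht).2]; exact Finset.empty_subset _
    · obtain ⟨he, rfl⟩ := hTs e t ht
      simp [hT, hs e he e' he']
    · obtain ⟨he, rfl⟩ := hTs e t ht
      simpa using hW e he hv
  have hcount : R.count T = 𝔼 x, R.Ind s x := by
    have : ∀ x y : (∀ v, Y v), ∏ e, ∏ t ∈ T e, R.ind e (t.piecewise y x) = R.Ind s x := by
      intro x y
      rw [Ind, ← Finset.prod_subset (Finset.subset_univ s)]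
      · exact Finset.prod_congr rfl fun e he => by simp [hT, he]
      · intro e _ he
        simp [hT, he]
    simp only [count, this, Fintype.expect_const]
  have hdens : ∏ e, R.dens e ^ #(T e) = R.D s := by
    rw [D, ← Finset.prod_subset (Finset.subset_univ s)]
    · exact Finset.prod_congr rfl fun e he => by simp [hT, he]
    · intro e _ he
      simp [hT, he]
  have h0 := hC.ρ_pos i hi hik
  have h1 := hC.ρ_le_one i hi hik
  have := R.abs_count_sub_le hC.regular hcl (by simpa using hM) (h := err L (ρ i) ^ 4)
    (fun e _ => hC.error_nonneg e)
    (fun e ⟨t, ht⟩ => hC.error_le hik (hsi e (hTs e t ht).1))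
    (pow_nonneg (err_pos hC.L_pos h0).le 4)
    (by rw [← hC.L_eq]; linarith [mul_err_pow_le hC.L_pos h0 h1])
  rw [hcount, hdens, ← hC.L_eq] at this
  refine this.trans (le_of_eq (by ring))

theorem expect_inside_le (hC : R.Controlled k Δ L ρ) {A : Finset V}
    (hM : #A ≤ 2 * Δ ^ (2 * k)) {i : ℕ} (hik : i ≤ k) :
    𝔼 x, R.Ind (R.inside A i) x ≤ 2 * R.D (R.inside A i) := by
  classical
  rcases Nat.eq_zero_or_pos i with rfl | hi
  · rw [inside_zero]
    simp [Ind, D]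
  have h := hC.abs_expect_Ind_sub_le (s := R.inside A i) (W := A)
    (fun e he e' he' => by
      rw [mem_inside] at he ⊢
      exact ⟨he'.trans he.1, (Finset.card_le_card he').trans he.2⟩)
    (fun e he => (mem_inside.1 he).1) hM hi hik (fun e he => (mem_inside.1 he).2)
  have h1 := mul_err_pow_le hC.L_pos (hC.ρ_pos i hi hik) (hC.ρ_le_one i hi hik)
  have h2 := (abs_le.1 h).2
  have h3 := R.D_pos (R.inside A i)
  nlinarith

theorem half_le_pow (hC : R.Controlled k Δ L ρ) {n : ℕ} (hn : n ≤ Δ ^ k) :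
    1 / 2 ≤ (1 - err L (ρ k)) ^ n := by
  have h0 := hC.ρ_pos k hC.one_le_k le_rfl
  have h1 := hC.ρ_le_one k hC.one_le_k le_rfl
  have hs := err_le hC.L_pos h0 h1
  have hs0 := err_pos hC.L_pos h0
  have hnL : (n : ℝ) ≤ L := by
    have h4 : Δ ^ k ≤ Δ ^ (2 * k) := Nat.pow_le_pow_right hC.one_le_Δ (by omega)
    have := hC.le_L
    exact_mod_cast (by omega : n ≤ L)
  have := one_add_mul_le_pow (a := -err L (ρ k)) (by linarith) n
  have h2 : n * err L (ρ k) ≤ L * err L (ρ k) := mul_le_mul_of_nonneg_right hnL hs0.le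
  have h3 := mul_err_le hC.L_pos h0 h1
  rw [← sub_eq_add_neg] at this
  linarith

/-- One step of the transfer. Above, `ω U` is bounded by the small edges inside `A` and crossing `A`
times `ω (U \ A)`, and the crossing indicator is split into its density and the deviation. Below,
the vertices of `A` are added one by one. Dividing the bounds cancels the densities of all edges of
size at most `i`. -/
theorem expect_mul_weight_le_of_deviation (hC : R.Controlled k Δ L ρ)
    {ω : Finset V → (∀ v, Y v) → ℝ} {ζ : ℝ} (hω : R.IsWeight ω ζ) {i : ℕ} (hi : i < k)
    {U A : Finset V} {q : (∀ v, Y v) → ℝ} {ε : ℝ} (hU : R.Extends ω (err L (ρ k)) U)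
    (hAU : A ⊆ U) (hA : #A ≤ Δ ^ k) (hq : DependsOn q (A : Set V)) (hq0 : ∀ x, 0 ≤ q x)
    (hε : 0 ≤ ε)
    (hq2 : 𝔼 x, q x ^ 2 * R.Ind (R.inside A i) x ≤ ε ^ 2 * R.D (R.inside A i))
    (hdev : 𝔼 y, |R.deviation A U i q y| * ω (U \ A) y ≤
      2 * ε * R.D (R.inside A i) * R.D (R.cross A U i) * 𝔼 y, ω (U \ A) y) :
    𝔼 x, q x * ω U x ≤ ε * (8 / ρ (i + 1) ^ L) * 𝔼 x, ω U x := by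
  classical
  set I := R.inside A i
  set J := R.cross A U i
  set Ω := 𝔼 y, ω (U \ A) y with hΩ
  have hΩ0 : 0 ≤ Ω := Finset.expect_nonneg fun y _ => hω.nonneg _ y
  have hDI := R.D_pos I
  have hDJ := R.D_pos J
  have hIJt : I ∪ J ⊆ R.touch A U :=
    Finset.union_subset (inside_subset_touch hAU i) (cross_subset_touch A U i)
  have hIJ : Disjoint I J := disjoint_inside_cross A U i
  have hMA : #A ≤ 2 * Δ ^ (2 * k) := by
    have h4 : Δ ^ k ≤ Δ ^ (2 * k) := Nat.pow_le_pow_right hC.one_le_Δ (by omega)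
    omega
  have hEI : 𝔼 x, R.Ind I x ≤ 2 * R.D I := hC.expect_inside_le hMA hi.le
  have hmean0 : 0 ≤ 𝔼 x, q x * R.Ind I x :=
    Finset.expect_nonneg fun x _ => mul_nonneg (hq0 x) (R.Ind_nonneg I x)
  -- Cauchy–Schwarz against the idempotent `R.Ind I`, whose mean is at most `2 * R.D I`; the
  -- constant `√2` is rounded up to `2`.
  have hmean : 𝔼 x, q x * R.Ind I x ≤ 2 * ε * R.D I := by
    have hsq : ∀ x, R.Ind I x ^ 2 = R.Ind I x := fun x => by
      rcases R.Ind_eq I x with h | h <;> simp [h]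
    have h1 := expect_mul_sq_le (fun x => q x * R.Ind I x) (R.Ind I)
    have h2 : ∀ x, q x * R.Ind I x * R.Ind I x = q x * R.Ind I x := fun x => by
      rw [mul_assoc, ← sq, hsq]
    simp only [h2, mul_pow, hsq] at h1
    refine le_of_sq_le_sq ?_ (by positivity)
    calc _ ≤ _ := h1
      _ ≤ (ε ^ 2 * R.D I) * (2 * R.D I) := by
          refine mul_le_mul hq2 hEI ?_ (by positivity)
          exact Finset.expect_nonneg fun x _ => R.Ind_nonneg I x
      _ ≤ _ := by nlinarith [mul_nonneg (sq_nonneg ε) (sq_nonneg (R.D I))]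
  have hupper : 𝔼 x, q x * ω U x ≤ 4 * ε * (R.D I * R.D J) * Ω := by
    calc 𝔼 x, q x * ω U x
        ≤ 𝔼 x, q x * (R.Ind I x * R.Ind J x) * ω (U \ A) x := by
          refine Finset.expect_le_expect fun x _ => ?_
          rw [mul_assoc]
          refine mul_le_mul_of_nonneg_left ((hω.le_touch U A hAU x).trans ?_) (hq0 x)
          refine mul_le_mul_of_nonneg_right ?_ (hω.nonneg _ x)
          refine (R.Ind_anti hIJt x).trans (le_of_eq ?_)
          exact Finset.prod_union hIJ
      _ = 𝔼 y, (R.deviation A U i q y * ω (U \ A) y +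
            (𝔼 x, q x * R.Ind I x) * R.D J * ω (U \ A) y) := by
          rw [← expect_piecewise A, Finset.expect_comm]
          refine Finset.expect_congr rfl fun y _ => ?_
          rw [deviation, ← add_mul, Finset.expect_mul, ← Finset.expect_add_distrib,
            Finset.expect_mul]
          refine Finset.expect_congr rfl fun x _ => ?_
          rw [apply_piecewise_of_subset hq subset_rfl,
            Ind_piecewise_of_subset R (fun e he => (mem_inside.1 he).1),
            apply_piecewise_of_disjoint (hω.dependsOn (U \ A)) Finset.sdiff_disjoint]
          ring
      _ ≤ 𝔼 y, (|R.deviation A U i q y| * ω (U \ A) y +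
            2 * ε * R.D I * R.D J * ω (U \ A) y) := by
          refine Finset.expect_le_expect fun y _ => ?_
          have hy := hω.nonneg (U \ A) y
          refine add_le_add (mul_le_mul_of_nonneg_right (le_abs_self _) hy) ?_
          refine mul_le_mul_of_nonneg_right ?_ hy
          exact mul_le_mul_of_nonneg_right hmean hDJ.le
      _ ≤ 2 * ε * R.D I * R.D J * Ω + 2 * ε * R.D I * R.D J * Ω := by
          rw [Finset.expect_add_distrib, ← Finset.mul_expect]
          exact add_le_add_left hdev _
      _ = _ := by ring
  -- `K` consists of the edges of size greater than `i` that meet `A`, the only ones whose density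
  -- is not matched in the upper bound.
  set K := R.touch A U \ (I ∪ J)
  have hDt : R.D (R.touch A U) = R.D K * (R.D I * R.D J) := by
    have h1 := Finset.prod_sdiff (f := R.dens) hIJt
    rw [Finset.prod_union hIJ] at h1
    exact h1.symm
  have hDK : ρ (i + 1) ^ L ≤ R.D K := by
    refine hC.pow_le_D_of_card_gt ((Finset.card_le_card Finset.sdiff_subset).trans
      (hC.card_touch_le hA U)) hi fun e he => ?_
    rw [Finset.mem_sdiff, mem_touch, Finset.mem_union, mem_inside, mem_cross] at he
    by_contra hcon
    push Not at hcon
    tauto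
  have hρ : 0 < ρ (i + 1) ^ L := pow_pos (hC.ρ_pos _ (by omega) hi) L
  have hs1 : err L (ρ k) ≤ 1 := (err_le hC.L_pos (hC.ρ_pos k hC.one_le_k le_rfl)
    (hC.ρ_le_one k hC.one_le_k le_rfl)).trans (by norm_num)
  have hlower : 1 / 2 * (ρ (i + 1) ^ L * (R.D I * R.D J)) * Ω ≤ 𝔼 x, ω U x := by
    refine le_trans ?_ (Extends.pow_le hs1 A hU hAU)
    rw [hDt]
    refine mul_le_mul_of_nonneg_right ?_ hΩ0
    refine mul_le_mul (hC.half_le_pow hA) ?_ (by positivity)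
      (pow_nonneg (by linarith) _)
    exact mul_le_mul_of_nonneg_right hDK (by positivity)
  calc _ ≤ _ := hupper
    _ = ε * (8 / ρ (i + 1) ^ L) * (1 / 2 * (ρ (i + 1) ^ L * (R.D I * R.D J)) * Ω) := by
        field_simp; ring
    _ ≤ _ := mul_le_mul_of_nonneg_left hlower (by positivity)

theorem dependsOn_deviation (A U : Finset V) (i : ℕ) (q : (∀ v, Y v) → ℝ) :
    DependsOn (R.deviation A U i q) (R.nbr A U : Set V) := by
  intro y y' h
  refine Finset.expect_congr rfl fun x _ => ?_
  congr 2
  refine R.dependsOn_Ind (W := A ∪ R.nbr A U)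
    (fun e he => vs_subset_of_touch (cross_subset_touch _ _ _ he)) fun v hv => ?_
  by_cases hvA : v ∈ A
  · simp [hvA]
  · simp only [Finset.piecewise, if_neg hvA]
    exact h v ((Finset.mem_union.1 hv).resolve_left hvA)

/-- The error `err ^ 4` bounds the fourth-order box average. Its square root `err ^ 2` controls the
mean square of the deviation, so the `L²` norm gains one factor `err`. This is why the errors are
fourth powers. -/
theorem expect_deviation_sq_le (hC : R.Controlled k Δ L ρ) {i : ℕ} (hi : i + 1 ≤ k)
    {U A : Finset V} (hM : 2 * (#A + #(R.nbr A U)) ≤ 2 * Δ ^ (2 * k))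
    {q : (∀ v, Y v) → ℝ} {ε : ℝ}
    (hq2 : 𝔼 x, q x ^ 2 * R.Ind (R.inside A (i + 1)) x ≤ ε ^ 2 * R.D (R.inside A (i + 1))) :
    𝔼 y, R.deviation A U (i + 1) q y ^ 2 * R.Ind (R.inside (R.nbr A U) i) y ≤
      (4 * (L * err L (ρ (i + 1))) * ε * R.D (R.inside A (i + 1)) *
        R.D (R.cross A U (i + 1))) ^ 2 * R.D (R.inside (R.nbr A U) i) := by
  have h0 := hC.ρ_pos (i + 1) (by omega) hi
  have h1 := hC.ρ_le_one (i + 1) (by omega) hi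
  have hs0 := err_pos hC.L_pos h0
  have hDI := R.D_pos (R.inside A (i + 1))
  have hDI' := R.D_pos (R.inside (R.nbr A U) i)
  have hDJ := R.D_pos (R.cross A U (i + 1))
  have hL : (1 : ℝ) ≤ L := by exact_mod_cast hC.L_pos
  have hbox := R.expect_box_le hC.regular (A := A) (U := U) (i := i) hM
    (h := err L (ρ (i + 1)) ^ 4) (fun e _ => hC.error_nonneg e)
    (fun e he => hC.error_le hi he) (by positivity)
    (by rw [← hC.L_eq]; linarith [mul_err_pow_le hC.L_pos h0 h1])
  rw [← hC.L_eq] at hbox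
  have key := expect_sq_le_box (R.Ind (R.inside A (i + 1))) q (R.Ind (R.inside (R.nbr A U) i))
    (fun x y => R.Ind (R.cross A U (i + 1)) (A.piecewise x y) - R.D (R.cross A U (i + 1)))
    (R.Ind_eq _)
    -- The square of the constant is `256 * L ^ 4 * err ^ 4`, which dominates the factor `32 * L *
    -- err ^ 4` of the box estimate.
    (M := (4 * (L * err L (ρ (i + 1)))) ^ 2 * (R.D (R.inside A (i + 1)) *
      R.D (R.inside (R.nbr A U) i) * R.D (R.cross A U (i + 1)) ^ 2)) (by positivity)
    (by
      refine hbox.trans ?_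
      refine le_trans (mul_le_mul_of_nonneg_right ?_ (sq_nonneg _)) (mul_pow _ _ 2).ge
      have h4 : (L : ℝ) ≤ L ^ 4 := le_self_pow₀ hL (by norm_num)
      calc 32 * (L : ℝ) * err L (ρ (i + 1)) ^ 4 ≤ 256 * (L ^ 4 * err L (ρ (i + 1)) ^ 4) := by
            nlinarith [mul_le_mul_of_nonneg_right h4 (pow_pos hs0 4).le,
              mul_pos (pow_pos (lt_of_lt_of_le one_pos hL) 4) (pow_pos hs0 4)]
        _ = _ := by ring)
  calc _ = 𝔼 y, R.Ind (R.inside (R.nbr A U) i) y * (𝔼 x, q x * R.Ind (R.inside A (i + 1)) x *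
        (R.Ind (R.cross A U (i + 1)) (A.piecewise x y) - R.D (R.cross A U (i + 1)))) ^ 2 :=
        Finset.expect_congr rfl fun y _ => mul_comm _ _
    _ ≤ _ := key
    _ ≤ _ := mul_le_mul_of_nonneg_right hq2 (by positivity)
    _ = _ := by ring

/-- Passing from the embeddings of the small edges in `A` to the embeddings of all edges increases
the expectation of a function of the images of `A` by at most a constant factor. -/
theorem expect_mul_weight_le (hC : R.Controlled k Δ L ρ) (hΔ : 2 ≤ Δ)
    {ω : Finset V → (∀ v, Y v) → ℝ} {ζ : ℝ} (hω : R.IsWeight ω ζ) (i : ℕ) :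
    ∀ {U A : Finset V} {q : (∀ v, Y v) → ℝ} {ε : ℝ}, i < k → R.Extends ω (err L (ρ k)) U →
    A ⊆ U → #A ≤ Δ ^ (k - i) → DependsOn q (A : Set V) → (∀ x, 0 ≤ q x) → 0 ≤ ε →
    𝔼 x, q x ^ 2 * R.Ind (R.inside A i) x ≤ ε ^ 2 * R.D (R.inside A i) →
    𝔼 x, q x * ω U x ≤ ε * (8 / ρ (i + 1) ^ L) * 𝔼 x, ω U x := by
  induction i with
  | zero =>
    intro U A q ε hi hU hAU hA hq hq0 hε hq2
    refine hC.expect_mul_weight_le_of_deviation hω hi hU hAU (by simpa using hA) hq hq0 hε hq2 ?_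
    -- There are no edges of size `0`, so nothing crosses and nothing deviates.
    have : ∀ y, R.deviation A U 0 q y = 0 := fun y => by
      simp [deviation, cross_zero, Ind, D]
    simp only [this, abs_zero, zero_mul, Finset.expect_const_zero]
    have h1 := R.D_pos (R.inside A 0)
    have h2 := R.D_pos (R.cross A U 0)
    have h3 : 0 ≤ 𝔼 y, ω (U \ A) y := Finset.expect_nonneg fun y _ => hω.nonneg _ y
    positivity
  | succ i ih =>
    intro U A q ε hi hU hAU hA hq hq0 hε hq2
    have hA1 : #A ≤ Δ ^ (k - 1) :=
      hA.trans (Nat.pow_le_pow_right hC.one_le_Δ (by omega))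
    have hkk : Δ ^ (k - 1) * Δ = Δ ^ k := by
      rw [← pow_succ, Nat.sub_add_cancel hC.one_le_k]
    have hk1 : Δ ^ (k - 1) ≤ Δ ^ k := Nat.pow_le_pow_right hC.one_le_Δ (by omega)
    have hN := card_nbr_le hC.degree A U
    have hNk : #(R.nbr A U) ≤ Δ ^ k := by
      rw [← hkk]; exact hN.trans (Nat.mul_le_mul_right _ hA1)
    -- Here `Δ ≥ 2` is needed: it makes room for two copies of `A` and of its neighbourhood.
    have h2k : 2 * Δ ^ k ≤ Δ ^ (2 * k) := by
      calc 2 * Δ ^ k ≤ Δ * Δ ^ k := Nat.mul_le_mul_right _ hΔ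
        _ = Δ ^ (k + 1) := (pow_succ' _ _).symm
        _ ≤ _ := Nat.pow_le_pow_right hC.one_le_Δ (by omega)
    refine hC.expect_mul_weight_le_of_deviation hω hi hU hAU (hA1.trans hk1) hq hq0 hε hq2 ?_
    have hsq := hC.expect_deviation_sq_le hi.le (U := U) (A := A) (by omega) hq2
    have h0 := hC.ρ_pos (i + 1) (by omega) hi.le
    have hs0 := err_pos hC.L_pos h0
    have hDI := R.D_pos (R.inside A (i + 1))
    have hDJ := R.D_pos (R.cross A U (i + 1))
    have h3 : 0 ≤ 𝔼 y, ω (U \ A) y := Finset.expect_nonneg fun y _ => hω.nonneg _ y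
    -- The deviation becomes the new test function on the neighbourhood of `A`, weighted by `U \ A`.
    -- The bound on the size of the set grows by a factor `Δ` while `i` drops by one.
    have key := ih (U := U \ A) (A := R.nbr A U) (q := fun y => |R.deviation A U (i + 1) q y|)
      (ε := 4 * (L * err L (ρ (i + 1))) * ε * R.D (R.inside A (i + 1)) *
        R.D (R.cross A U (i + 1))) (by omega) (hU.mono Finset.sdiff_subset) (nbr_subset A U)
      (by
        have : k - i = k - (i + 1) + 1 := by omega
        rw [this, pow_succ]
        exact hN.trans (Nat.mul_le_mul_right _ hA))
      (fun y y' h => congrArg abs (dependsOn_deviation A U (i + 1) q h))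
      (fun y => abs_nonneg _) (by positivity) (by simpa only [sq_abs] using hsq)
    refine key.trans (mul_le_mul_of_nonneg_right ?_ h3)
    rw [mul_err hC.L_pos]
    have hρ : 0 < ρ (i + 1) ^ L := pow_pos h0 L
    -- Gain times loss is `4 * 8 / 64 = 1 / 2`, well below the allowed `2`.
    have : 4 * (ρ (i + 1) ^ L / 64) * ε * R.D (R.inside A (i + 1)) *
        R.D (R.cross A U (i + 1)) * (8 / ρ (i + 1) ^ L) =
        1 / 2 * (ε * R.D (R.inside A (i + 1)) * R.D (R.cross A U (i + 1))) := by
      field_simp; ring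
    rw [this]
    have : 0 ≤ ε * R.D (R.inside A (i + 1)) * R.D (R.cross A U (i + 1)) := by positivity
    linarith

end Controlled

end EdgeSystem

/-! ### Adding one vertex. -/

namespace EdgeSystem

variable {V : Type} {Y : V → Type} {E : Type} {R : EdgeSystem V Y E}
variable [DecidableEq V] [Fintype V] [∀ v, Fintype (Y v)] [∀ v, Nonempty (Y v)] [Fintype E]
variable {k Δ L : ℕ} {ρ : ℕ → ℝ}

variable (R) in
/-- The probability that a random image of `u` extends `y` to an embedding of all edges at `u`. -/
noncomputable def star (U : Finset V) (u : V) (y : ∀ v, Y v) : ℝ :=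
  𝔼 x : (∀ v, Y v), R.Ind (R.touch {u} U) (({u} : Finset V).piecewise x y)

theorem star_nonneg (U : Finset V) (u : V) (y : ∀ v, Y v) : 0 ≤ R.star U u y :=
  Finset.expect_nonneg fun _ _ => R.Ind_nonneg _ _

theorem star_le_one (U : Finset V) (u : V) (y : ∀ v, Y v) : R.star U u y ≤ 1 :=
  Finset.expect_le (Finset.univ_nonempty) fun _ _ => R.Ind_le_one _ _

theorem dependsOn_star (U : Finset V) (u : V) :
    DependsOn (R.star U u) (R.nbr {u} U : Set V) := by
  intro y y' h
  refine Finset.expect_congr rfl fun x _ => ?_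
  refine R.dependsOn_Ind (W := {u} ∪ R.nbr {u} U)
    (fun e he => vs_subset_of_touch he) fun v hv => ?_
  by_cases hvA : v ∈ ({u} : Finset V)
  · rw [Finset.mem_singleton.1 hvA]; simp
  · simp only [Finset.piecewise, if_neg hvA]
    exact h v ((Finset.mem_union.1 hv).resolve_left hvA)

/-- Resampling the coordinate `u` alone leaves `g` unchanged, so the average over that coordinate
can be taken first. -/
theorem expect_star_mul {g : (∀ v, Y v) → ℝ} {U W : Finset V} {u : V}
    (hg : DependsOn g (W : Set V)) (hu : u ∉ W) :
    𝔼 y, R.star U u y * g y = 𝔼 x, R.Ind (R.touch {u} U) x * g x := by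
  rw [← expect_piecewise ({u} : Finset V) (fun x => R.Ind (R.touch {u} U) x * g x),
    Finset.expect_comm]
  refine Finset.expect_congr rfl fun y _ => ?_
  rw [star, Finset.expect_mul]
  refine Finset.expect_congr rfl fun x _ => ?_
  rw [apply_piecewise_of_disjoint hg (Finset.disjoint_singleton_right.2 hu)]

namespace Controlled

/-- The collision allowance is negligible against the density of any `L` edges, which is at least `ρ
1 ^ L`: one factor `err L (ρ 1)` is at most `R.D s / 64`, and another is at most `err L (ρ k)`. -/
theorem error_one_le (hC : R.Controlled k Δ L ρ) {s : Finset E} (hs : #s ≤ L) :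
    err L (ρ 1) ^ 4 ≤ err L (ρ k) / 64 * R.D s := by
  have h0 := hC.ρ_pos 1 le_rfl hC.one_le_k
  have h1 := hC.ρ_le_one 1 le_rfl hC.one_le_k
  have hs0 := err_pos hC.L_pos h0
  have hs1 := err_le hC.L_pos h0 h1
  have hsk : err L (ρ 1) ≤ err L (ρ k) := err_mono h0.le (hC.ρ_mono 1 k le_rfl hC.one_le_k le_rfl)
  have hD : ρ 1 ^ L ≤ R.D s := hC.pow_le_D_of_card_gt hs (i := 0)
    (by have := hC.one_le_k; omega) fun e _ => one_le_card_vs e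
  have hL : (1 : ℝ) ≤ L := by exact_mod_cast hC.L_pos
  have hm : err L (ρ 1) ≤ R.D s / 64 := by
    have := mul_err hC.L_pos (ρ 1)
    nlinarith
  calc err L (ρ 1) ^ 4 = err L (ρ 1) * err L (ρ 1) * err L (ρ 1) ^ 2 := by ring
    _ ≤ err L (ρ 1) * err L (ρ 1) * 1 := by
        refine mul_le_mul_of_nonneg_left ?_ (by positivity)
        exact pow_le_one₀ hs0.le (by linarith)
    _ ≤ err L (ρ k) * (R.D s / 64) := by
        rw [mul_one]
        exact mul_le_mul hsk hm hs0.le (hs0.le.trans hsk)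
    _ = _ := by ring

theorem card_singleton_le (hC : R.Controlled k Δ L ρ) (u : V) : #({u} : Finset V) ≤ Δ ^ k := by
  rw [Finset.card_singleton]
  exact Nat.one_le_pow _ _ hC.one_le_Δ

/-- The variance bound and the comparison of weights give the expected number of extensions. -/
theorem le_expect_touch_of_two_le (hC : R.Controlled k Δ L ρ) (hΔ : 2 ≤ Δ)
    {ω : Finset V → (∀ v, Y v) → ℝ} {ζ : ℝ} (hω : R.IsWeight ω ζ) {U : Finset V} {u : V}
    (hU : R.Extends ω (err L (ρ k)) (U \ {u})) :
    (1 - err L (ρ k) / 2) * R.D (R.touch {u} U) * 𝔼 x, ω (U \ {u}) x ≤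
      𝔼 x, R.Ind (R.touch {u} U) x * ω (U \ {u}) x := by
  set d := R.D (R.touch {u} U) with hd
  set N := R.nbr {u} U with hN
  set s := err L (ρ k) with hs
  have hd0 : 0 < d := R.D_pos _
  have h0 := hC.ρ_pos k hC.one_le_k le_rfl
  have h1 := hC.ρ_le_one k hC.one_le_k le_rfl
  have hs0 : 0 < s := err_pos hC.L_pos h0
  have hL : (1 : ℝ) ≤ L := by exact_mod_cast hC.L_pos
  have hNΔ : #N ≤ Δ := hC.degree u U
  have hM : 2 * (1 + #N) ≤ 2 * Δ ^ (2 * k) := by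
    have h2 : Δ ^ 2 ≤ Δ ^ (2 * k) :=
      Nat.pow_le_pow_right hC.one_le_Δ (by have := hC.one_le_k; omega)
    have h3 : 1 + Δ ≤ Δ ^ 2 := by nlinarith
    omega
  have hΩ0 : 0 ≤ 𝔼 x, ω (U \ {u}) x := Finset.expect_nonneg fun y _ => hω.nonneg _ y
  have hvar := R.expect_star_le hC.regular hM hC.card_le (h := s ^ 4) hC.error_nonneg
    (fun e => hC.error_le le_rfl (hC.card_le e)) (by positivity)
    (by rw [← hC.L_eq]; linarith [mul_err_pow_le hC.L_pos h0 h1])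
  rw [← hC.L_eq] at hvar
  have hstar : ∀ y : (∀ v, Y v), 𝔼 x : (∀ v, Y v),
      (R.Ind (R.touch {u} U) (({u} : Finset V).piecewise x y) - R.D (R.touch {u} U)) =
      R.star U u y - d := fun y => by
    rw [Finset.expect_sub_distrib, Fintype.expect_const, star]
  simp only [hstar] at hvar
  -- The level `i = k - 1` makes the loss depend on `ρ k` only. The value of `ε` comes from the
  -- variance factor: `8 * L * s ^ 4 ≤ (3 * L * s ^ 2) ^ 2`.
  have key := hC.expect_mul_weight_le hΔ hω (k - 1) (U := U \ {u}) (A := N)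
    (q := fun y => |R.star U u y - d|) (ε := 3 * L * s ^ 2 * d)
    (by have := hC.one_le_k; omega) hU (nbr_subset {u} U)
    (by
      have : k - (k - 1) = 1 := by have := hC.one_le_k; omega
      rw [this, pow_one]; exact hNΔ)
    (fun y y' h => by simp only [dependsOn_star U u h]) (fun y => abs_nonneg _) (by positivity)
    (by
      simp only [sq_abs]
      calc _ = 𝔼 y, R.Ind (R.inside N (k - 1)) y * (R.star U u y - d) ^ 2 :=
            Finset.expect_congr rfl fun y _ => mul_comm _ _
        _ ≤ _ := hvar
        _ ≤ (9 * L ^ 2) * s ^ 4 * (R.D (R.inside N (k - 1)) * d ^ 2) := by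
            have := R.D_pos (R.inside N (k - 1))
            refine mul_le_mul_of_nonneg_right ?_ (by positivity)
            refine mul_le_mul_of_nonneg_right ?_ (by positivity)
            nlinarith
        _ = _ := by ring)
  rw [Nat.sub_add_cancel hC.one_le_k] at key
  -- With `L * s = ρ k ^ L / 64` the relative error is `3 * 8 / 64 = 3 / 8` of `s`, below the half
  -- that may be spent.
  have hconst : 3 * L * s ^ 2 * d * (8 / ρ k ^ L) = 3 / 8 * s * d := by
    have hρ : 0 < ρ k ^ L := pow_pos h0 L
    have hLs : (L : ℝ) * s = ρ k ^ L / 64 := mul_err hC.L_pos _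
    calc 3 * L * s ^ 2 * d * (8 / ρ k ^ L) = 3 * (L * s) * s * d * (8 / ρ k ^ L) := by ring
      _ = _ := by rw [hLs]; field_simp; ring
  rw [hconst] at key
  rw [← expect_star_mul (hω.dependsOn (U \ {u})) (by simp)]
  have hlow : 𝔼 y, (d * ω (U \ {u}) y - |R.star U u y - d| * ω (U \ {u}) y) ≤
      𝔼 y, R.star U u y * ω (U \ {u}) y := by
    refine Finset.expect_le_expect fun y _ => ?_
    rw [← sub_mul]
    refine mul_le_mul_of_nonneg_right ?_ (hω.nonneg _ y)
    linarith [neg_abs_le (R.star U u y - d)]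
  rw [Finset.expect_sub_distrib, ← Finset.mul_expect] at hlow
  have : 0 ≤ s * d * 𝔼 x, ω (U \ {u}) x := by positivity
  nlinarith

theorem two_mul_error_le (hC : R.Controlled k Δ L ρ) :
    2 * (L * err L (ρ k) ^ 4) ≤ err L (ρ k) / 32 := by
  have h0 := hC.ρ_pos k hC.one_le_k le_rfl
  have h1 := hC.ρ_le_one k hC.one_le_k le_rfl
  have hs0 := err_pos hC.L_pos h0
  have hs1 := err_le hC.L_pos h0 h1
  have hm := mul_err_le hC.L_pos h0 h1
  calc 2 * (L * err L (ρ k) ^ 4) = 2 * (L * err L (ρ k)) * err L (ρ k) * err L (ρ k) ^ 2 := by ring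
    _ ≤ 2 * (1 / 64) * err L (ρ k) * 1 := by
        have : err L (ρ k) ^ 2 ≤ 1 := pow_le_one₀ hs0.le (by linarith)
        gcongr
    _ = _ := by ring

/-- If the degrees are at most one, then the images of an edge are independent of the rest. -/
theorem le_expect_touch_of_one (hC : R.Controlled k 1 L ρ)
    {ω : Finset V → (∀ v, Y v) → ℝ} (hω : R.IsWeight ω (err L (ρ 1) ^ 4)) {U : Finset V} {u : V}
    (hu : u ∈ U) :
    (1 - err L (ρ k) / 2) * R.D (R.touch {u} U) * 𝔼 x, ω (U \ {u}) x ≤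
      𝔼 x, R.Ind (R.touch {u} U) x * ω (U \ {u}) x := by
  classical
  set J := R.touch {u} U with hJ
  set N := R.nbr {u} U with hN
  set s := err L (ρ k) with hs
  have hd0 : 0 < R.D J := R.D_pos _
  have h0 := hC.ρ_pos k hC.one_le_k le_rfl
  have h1 := hC.ρ_le_one k hC.one_le_k le_rfl
  have hs0 : 0 < s := err_pos hC.L_pos h0
  have hs1 : s ≤ 1 / 64 := err_le hC.L_pos h0 h1
  have hδ : 2 * (L * s ^ 4) ≤ s / 32 := hC.two_mul_error_le
  have hΩ0 : ∀ W, 0 ≤ 𝔼 x, ω W x := fun W => Finset.expect_nonneg fun y _ => hω.nonneg _ y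
  have hJN : ∀ e ∈ J, R.vs e ⊆ {u} ∪ N := fun e he => vs_subset_of_touch he
  have hcount : ∀ {S : Finset E} {W : Finset V}, (∀ e ∈ S, ∀ e', R.vs e' ⊆ R.vs e → e' ∈ S) →
      (∀ e ∈ S, R.vs e ⊆ W) → #W ≤ 2 → |𝔼 x, R.Ind S x - R.D S| ≤ s / 32 * R.D S := by
    intro S W hS hW hW2
    refine (hC.abs_expect_Ind_sub_le hS hW (by simpa using hW2) hC.one_le_k le_rfl
      fun e _ => hC.card_le e).trans ?_
    exact mul_le_mul_of_nonneg_right hδ (R.D_pos S).le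
  rcases N.eq_empty_or_nonempty with hNe | ⟨w, hw⟩
  -- Without neighbours, the edges at `u` depend on the image of `u` only and are independent of the
  -- weight.
  · rw [hNe, Finset.union_empty] at hJN
    rw [expect_mul_of_disjoint (R.dependsOn_Ind hJN) (hω.dependsOn (U \ {u}))
      Finset.disjoint_sdiff]
    refine mul_le_mul_of_nonneg_right ?_ (hΩ0 _)
    have := hcount (S := J) (W := {u}) (fun e he e' he' => ?_) hJN (by simp)
    · have := (abs_le.1 this).1
      nlinarith
    · refine mem_touch.2 ⟨he'.trans (mem_touch.1 he).1, ?_⟩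
      exact not_disjoint_of_vs_subset (he'.trans (hJN e he))
  · have hNw : N = {w} := by
      have : #N ≤ 1 := hC.degree u U
      exact (Finset.eq_of_subset_of_card_le (Finset.singleton_subset_iff.2 hw)
        (by simpa using this)).symm
    rw [hNw] at hJN
    obtain ⟨⟨hwU, hwu⟩, a, ha, e₀, he₀⟩ := mem_nbr.1 hw
    rw [Finset.mem_singleton] at ha hwu
    subst ha
    set F := R.touch {w} (U \ {a}) with hF
    -- The only neighbour of `w` is the vertex being added, so the remaining edges at `w` consist of
    -- `w` alone and the pair is independent of the rest.
    have hFw : ∀ e ∈ F, R.vs e ⊆ {w} := by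
      intro e he
      have h2 : #(R.nbr {w} U) ≤ 1 := hC.degree w U
      have h3 : a ∈ R.nbr {w} U := mem_nbr.2 ⟨⟨hu, by simpa using Ne.symm hwu⟩, w, by simp, e₀, by
        rw [he₀, Finset.pair_comm]⟩
      have h4 : R.nbr {w} (U \ {a}) = ∅ := by
        by_contra hne
        obtain ⟨b, hb⟩ := Finset.nonempty_iff_ne_empty.2 hne
        obtain ⟨⟨hbU, hbw⟩, hbe⟩ := mem_nbr.1 hb
        rw [Finset.mem_sdiff, Finset.mem_singleton] at hbU
        have hb' : b ∈ R.nbr {w} U := mem_nbr.2 ⟨⟨hbU.1, hbw⟩, hbe⟩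
        exact hbU.2 (Finset.card_le_one.1 h2 b hb' a h3)
      have := vs_subset_of_touch he
      rwa [h4, Finset.union_empty] at this
    have hFclosed : ∀ e ∈ F, ∀ e', R.vs e' ⊆ R.vs e → e' ∈ F := fun e he e' he' =>
      mem_touch.2 ⟨he'.trans (mem_touch.1 he).1,
        not_disjoint_of_vs_subset (he'.trans (hFw e he))⟩
    have hFJ : Disjoint F J := Finset.disjoint_left.2 fun e h1 h2 => by
      have h3 := (mem_touch.1 h2).2
      rw [Finset.disjoint_singleton_right, not_not] at h3
      exact hwu (Finset.mem_singleton.1 (hFw e h1 h3)).symm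
    have hFJclosed : ∀ e ∈ F ∪ J, ∀ e', R.vs e' ⊆ R.vs e → e' ∈ F ∪ J := by
      intro e he e' he'
      rcases Finset.mem_union.1 he with he | he
      · exact Finset.mem_union_left _ (hFclosed e he e' he')
      · have hU' := he'.trans (mem_touch.1 he).1
        by_cases hau : a ∈ R.vs e'
        · exact Finset.mem_union_right _ (mem_touch.2 ⟨hU', by simpa using hau⟩)
        · have hsub : R.vs e' ⊆ {w} := fun v hv => by
            refine (Finset.mem_union.1 (hJN e he (he' hv))).resolve_left fun h => ?_
            exact hau (Finset.mem_singleton.1 h ▸ hv)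
          refine Finset.mem_union_left _ (mem_touch.2 ⟨?_, not_disjoint_of_vs_subset hsub⟩)
          exact Finset.subset_sdiff.2 ⟨hU', Finset.disjoint_singleton_right.2 hau⟩
    have hFJW : ∀ e ∈ F ∪ J, R.vs e ⊆ {a} ∪ {w} := fun e he =>
      (Finset.mem_union.1 he).elim
        (fun h => (hFw e h).trans Finset.subset_union_right) (hJN e)
    have hcardW : #({a} ∪ {w} : Finset V) ≤ 2 :=
      (Finset.card_union_le _ _).trans (by simp)
    have hc1 := (abs_le.1 (hcount hFJclosed hFJW hcardW)).1
    have hc2 := (abs_le.1 (hcount hFclosed hFw (by simp))).2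
    have hDFJ : R.D (F ∪ J) = R.D F * R.D J := Finset.prod_union hFJ
    have hDF := R.D_pos F
    have hζ : err L (ρ 1) ^ 4 ≤ s / 64 * R.D (F ∪ J) :=
      hC.error_one_le ((R.card_le_of_vs_subset hFJW).trans
        (hC.two_pow_le_L (by simpa using hcardW)))
    set Ω := 𝔼 x, ω ((U \ {a}) \ {w}) x with hΩ
    have hΩ' : 0 ≤ Ω := hΩ0 _
    have hwU' : w ∈ U \ {a} := by simp [hwU, hwu]
    have hfac : 𝔼 x, R.star U a x * (R.Ind F x * ω ((U \ {a}) \ {w}) x) =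
        (𝔼 x, R.Ind (F ∪ J) x) * Ω := by
      have hdep : DependsOn (fun x => R.star U a x * R.Ind F x) (({w} : Finset V) : Set V) := by
        intro x y hxy
        have h5 := dependsOn_star (R := R) U a
        rw [← hN, hNw] at h5
        simp only [h5 hxy, R.dependsOn_Ind hFw hxy]
      simp only [← mul_assoc]
      rw [expect_mul_of_disjoint hdep (hω.dependsOn ((U \ {a}) \ {w})) Finset.disjoint_sdiff,
        expect_star_mul (R.dependsOn_Ind hFw) (by simpa using Ne.symm hwu)]
      congr 1
      refine Finset.expect_congr rfl fun x _ => ?_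
      rw [mul_comm]
      exact (Finset.prod_union hFJ).symm
    have hup : 𝔼 x, ω (U \ {a}) x ≤ (1 + s / 32) * R.D F * Ω := by
      calc 𝔼 x, ω (U \ {a}) x ≤ 𝔼 x, R.Ind F x * ω ((U \ {a}) \ {w}) x :=
            Finset.expect_le_expect fun x _ =>
              hω.le_touch (U \ {a}) {w} (Finset.singleton_subset_iff.2 hwU') x
        _ = (𝔼 x, R.Ind F x) * Ω :=
            expect_mul_of_disjoint (R.dependsOn_Ind hFw) (hω.dependsOn _) Finset.disjoint_sdiff
        _ ≤ _ := mul_le_mul_of_nonneg_right (by linarith) hΩ'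
    -- A general weight does not factor at `w`. The axiom with test function `star` replaces it by a
    -- product at the cost `ζ`, which `hζ` absorbs.
    have hlow := hω.le_expect (U \ {a}) w hwU' (R.star U a) (star_nonneg U a) (star_le_one U a)
    rw [hfac, expect_star_mul (hω.dependsOn (U \ {a})) (by simp)] at hlow
    refine le_trans ?_ hlow
    calc _ ≤ (1 - s / 2) * R.D J * ((1 + s / 32) * R.D F * Ω) :=
          mul_le_mul_of_nonneg_left hup (mul_nonneg (by linarith) hd0.le)
      _ = (1 - s / 2) * (1 + s / 32) * (R.D F * R.D J * Ω) := by ring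
      _ ≤ (1 - s / 32 - s / 64) * (R.D F * R.D J * Ω) :=
          mul_le_mul_of_nonneg_right (by nlinarith) (by positivity)
      _ = ((1 - s / 32) * R.D (F ∪ J) - s / 64 * R.D (F ∪ J)) * Ω := by rw [hDFJ]; ring
      _ ≤ (𝔼 x, R.Ind (F ∪ J) x - err L (ρ 1) ^ 4) * Ω :=
          mul_le_mul_of_nonneg_right (by linarith) hΩ'
      _ = _ := by ring

theorem le_expect_touch (hC : R.Controlled k Δ L ρ)
    {ω : Finset V → (∀ v, Y v) → ℝ} (hω : R.IsWeight ω (err L (ρ 1) ^ 4)) {U : Finset V} {u : V}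
    (hu : u ∈ U) (hU : R.Extends ω (err L (ρ k)) (U \ {u})) :
    (1 - err L (ρ k) / 2) * R.D (R.touch {u} U) * 𝔼 x, ω (U \ {u}) x ≤
      𝔼 x, R.Ind (R.touch {u} U) x * ω (U \ {u}) x := by
  rcases Nat.lt_or_ge Δ 2 with h | h
  · obtain rfl : Δ = 1 := by have := hC.one_le_Δ; omega
    exact hC.le_expect_touch_of_one hω hu
  · exact hC.le_expect_touch_of_two_le h hω hU

theorem error_one_mul_le (hC : R.Controlled k Δ L ρ) {U : Finset V} {u : V} {a : ℝ} (ha : 0 ≤ a) :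
    err L (ρ 1) ^ 4 * a ≤ err L (ρ k) / 2 * R.D (R.touch {u} U) * a := by
  have h := hC.error_one_le (hC.card_touch_le (hC.card_singleton_le u) U)
  have hD := R.D_pos (R.touch {u} U)
  have hs0 : 0 < err L (ρ k) := err_pos hC.L_pos (hC.ρ_pos k hC.one_le_k le_rfl)
  refine mul_le_mul_of_nonneg_right (h.trans ?_) ha
  nlinarith [mul_pos hs0 hD]

/-- Induction on the size of `U`: adding `u` uses extension only inside `U' \ {u}`. Half of the
error `err L (ρ k)` pays for the deviation of the star, the other half for the further conditions in
the weight. -/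
theorem extends_weight (hC : R.Controlled k Δ L ρ)
    {ω : Finset V → (∀ v, Y v) → ℝ} (hω : R.IsWeight ω (err L (ρ 1) ^ 4)) (U : Finset V) :
    R.Extends ω (err L (ρ k)) U := by
  suffices ∀ n, ∀ U : Finset V, #U ≤ n → R.Extends ω (err L (ρ k)) U from this _ U le_rfl
  intro n
  induction n with
  | zero =>
    intro U hU U' hU' u hu
    rw [Nat.le_zero, Finset.card_eq_zero] at hU
    subst hU
    exact absurd (hU' hu) (Finset.notMem_empty u)
  | succ n ih =>
    intro U hU U' hU' u hu
    have hcard : #(U' \ {u}) ≤ n := by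
      have h1 : #(U' \ {u}) < #U' := Finset.card_lt_card
        (Finset.sdiff_ssubset (Finset.singleton_subset_iff.2 hu) (Finset.singleton_nonempty u))
      have := Finset.card_le_card hU'
      omega
    have h1 := hC.le_expect_touch hω hu (ih _ hcard)
    have h2 := hω.le_expect U' u hu (fun _ => 1) (fun _ => zero_le_one) (fun _ => le_rfl)
    simp only [one_mul] at h2
    have h3 := hC.error_one_mul_le (U := U') (u := u) (a := 𝔼 x, ω (U' \ {u}) x)
      (Finset.expect_nonneg fun y _ => hω.nonneg _ y)
    nlinarith

theorem pow_mul_D_le (hC : R.Controlled k Δ L ρ)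
    {ω : Finset V → (∀ v, Y v) → ℝ} (hω : R.IsWeight ω (err L (ρ 1) ^ 4)) (U : Finset V) :
    (1 - err L (ρ k)) ^ #U * R.D (R.touch U U) * 𝔼 x, ω ∅ x ≤ 𝔼 x, ω U x := by
  have h := Extends.pow_le ((err_le hC.L_pos (hC.ρ_pos k hC.one_le_k le_rfl)
    (hC.ρ_le_one k hC.one_le_k le_rfl)).trans (by norm_num)) U (hC.extends_weight hω U) subset_rfl
  rwa [Finset.sdiff_self] at h

theorem expect_weight_pos (hC : R.Controlled k Δ L ρ)
    {ω : Finset V → (∀ v, Y v) → ℝ} (hω : R.IsWeight ω (err L (ρ 1) ^ 4)) (U : Finset V) :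
    0 < 𝔼 x, ω U x := by
  have hs := err_le hC.L_pos (hC.ρ_pos k hC.one_le_k le_rfl) (hC.ρ_le_one k hC.one_le_k le_rfl)
  refine lt_of_lt_of_le ?_ (hC.pow_mul_D_le hω U)
  exact mul_pos (mul_pos (pow_pos (by linarith) _) (R.D_pos _)) hω.expect_empty

end Controlled

end EdgeSystem

/-! ### Concrete edges as vertex sets. -/

section Edges

variable {ι : Type} {k : ℕ} {X : ι → Type}

/-- An edge as an injective map from its index to the vertices. -/
def EdgeOn.emb {I : Finset ι} (e : EdgeOn X I) : I ↪ Vertex X where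
  toFun i := ⟨i.1, e i⟩
  inj' _ _ h := Subtype.ext (congrArg Sigma.fst h)

/-- The vertex set of an edge. -/
def Edge.verts (e : Edge k X) : Finset (Vertex X) := e.1.1.attach.map e.2.emb

theorem Edge.mem_verts {e : Edge k X} {v : Vertex X} : v ∈ e.verts ↔ e.Contains v := by
  rw [Edge.verts, Finset.mem_map]
  constructor
  · rintro ⟨j, _, rfl⟩
    exact ⟨j.2, rfl⟩
  · rintro ⟨h, h'⟩
    exact ⟨⟨v.1, h⟩, Finset.mem_attach _ _, Sigma.ext rfl (heq_of_eq h')⟩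

theorem Edge.mk_mem_verts (e : Edge k X) (i : e.1.1) : (⟨i.1, e.2 i⟩ : Vertex X) ∈ e.verts :=
  Edge.mem_verts.2 ⟨i.2, rfl⟩

theorem Edge.card_verts (e : Edge k X) : #e.verts = e.size := by
  simp [Edge.verts, Edge.size]

/-- The part of an edge with index `J`. -/
def Edge.part (e : Edge k X) (J : Index ι k) (h : J.1 ⊆ e.1.1) : Edge k X :=
  ⟨J, e.2.restrict h⟩

theorem Edge.eq_part_of_verts_subset {e e' : Edge k X} (h : e'.verts ⊆ e.verts) :
    ∃ hJ : e'.1.1 ⊆ e.1.1, e' = e.part e'.1 hJ := by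
  have key : ∀ i : e'.1.1, ∃ hi : i.1 ∈ e.1.1, e.2 ⟨i.1, hi⟩ = e'.2 i := fun i =>
    Edge.mem_verts.1 (h (e'.mk_mem_verts i))
  refine ⟨fun i hi => (key ⟨i, hi⟩).1, ?_⟩
  rcases e' with ⟨J, e'⟩
  refine Sigma.ext rfl (heq_of_eq (funext fun i => ?_))
  exact (key i).2.symm

theorem Edge.verts_injective : Function.Injective (Edge.verts (k := k) (X := X)) := by
  intro e e' h
  obtain ⟨h1, h2⟩ := Edge.eq_part_of_verts_subset h.subset
  obtain ⟨h3, _⟩ := Edge.eq_part_of_verts_subset h.symm.subset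
  have h4 : e.1 = e'.1 := Subtype.ext (Finset.Subset.antisymm h1 h3)
  rcases e with ⟨I, e⟩
  rcases e' with ⟨I', e'⟩
  obtain rfl : I = I' := h4
  exact h2

theorem Edge.exists_part_verts_eq (e : Edge k X) {s : Finset (Vertex X)} (hs : s ⊆ e.verts)
    (hne : s.Nonempty) : ∃ (J : Index ι k) (h : J.1 ⊆ e.1.1), (e.part J h).verts = s := by
  classical
  have hsub : s.image Sigma.fst ⊆ e.1.1 := by
    intro i hi
    obtain ⟨v, hv, rfl⟩ := Finset.mem_image.1 hi
    exact (Edge.mem_verts.1 (hs hv)).1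
  refine ⟨⟨s.image Sigma.fst, hne.image _, (Finset.card_le_card hsub).trans e.1.2.2⟩, hsub, ?_⟩
  ext ⟨i, a⟩
  rw [Edge.mem_verts]
  constructor
  · rintro ⟨h, h'⟩
    obtain ⟨⟨j, b⟩, hv, hj⟩ := Finset.mem_image.1 h
    obtain rfl : j = i := hj
    obtain ⟨h1, h2⟩ := Edge.mem_verts.1 (hs hv)
    obtain rfl : b = a := h2.symm.trans h'
    exact hv
  · intro hv
    exact ⟨Finset.mem_image_of_mem _ hv, (Edge.mem_verts.1 (hs hv)).2⟩

variable {C : Index ι k → Type}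

theorem Complex.Visible.part {B : Complex k X C} {e : Edge k X} (h : B.Visible e) (J : Index ι k)
    (hJ : J.1 ⊆ e.1.1) : B.Visible (e.part J hJ) :=
  fun hnone => h (B.invisible_of_subset e.1 J hJ e.2 hnone)

theorem density_congr {X' Ω : ι → Type} (G : ColoredGraph k Ω C) {B : Complex k X C}
    {S : Complex k X' C} {I : Index ι k} {e : EdgeOn X I.1} {e' : EdgeOn X' I.1}
    (h : ∀ (J : Index ι k) (hJ : J.1 ⊆ I.1),
      B.color J (e.restrict hJ) = S.color J (e'.restrict hJ)) :
    B.density G ⟨I, e⟩ = S.density G ⟨I, e'⟩ := by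
  unfold Complex.density
  congr 1
  funext J hJ
  exact h J hJ

theorem condProb_le_one {α : Type} [Finite α] (q p : α → Prop) : condProb q p ≤ 1 := by
  unfold condProb
  refine div_le_one_of_le₀ ?_ (Nat.cast_nonneg _)
  exact_mod_cast Nat.card_le_card_of_injective
    (fun a : {a : α // q a ∧ p a} => (⟨a.1, a.2.2⟩ : {a : α // p a}))
    fun a b hab => Subtype.ext (congrArg (fun c => c.1) hab)

theorem prob_eq_expect {α : Type} [Fintype α] (p : α → Prop) [DecidablePred p] :
    prob p = 𝔼 a, if p a then (1 : ℝ) else 0 := by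
  rw [Fintype.expect_eq_sum_div_card, prob, Finset.sum_boole, Nat.card_eq_fintype_card,
    Nat.card_eq_fintype_card, Fintype.card_subtype]

/-- A point of the product as a partitionwise map. -/
def toPMap {Ω : ι → Type} (x : ∀ v : Vertex X, Ω v.1) : PMap X Ω := fun i a => x ⟨i, a⟩

/-- Points of the product are partitionwise maps. -/
def pmapEquiv {Ω : ι → Type} : (∀ v : Vertex X, Ω v.1) ≃ PMap X Ω where
  toFun := toPMap
  invFun φ v := φ v.1 v.2
  left_inv _ := rfl
  right_inv _ := rfl

end Edges

/-! ### The edge system of a complex. -/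

section System

variable {ι : Type} {k : ℕ} {X Ω : ι → Type} {C : Index ι k → Type}
  (G : ColoredGraph k Ω C) (B : Complex k X C)

open Classical in
/-- The system of the visible edges of a complex. -/
noncomputable def edgeSystem [Finite ι] [∀ i, Finite (Ω i)]
    (hpos : ∀ e, B.Visible e → 0 < B.density G e) :
    EdgeSystem (Vertex X) (fun v => Ω v.1) {e : Edge k X // B.Visible e} where
  vs e := e.1.verts
  ind e x := if B.color e.1.1 e.1.2 = some (G.color e.1.1 ((toPMap x).onEdge e.1.2)) then 1 else 0
  dens e := B.density G e.1
  vs_nonempty e := Finset.card_pos.1 (by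
    rw [Edge.card_verts]; exact Finset.card_pos.2 e.1.1.2.1)
  vs_injective e e' h := Subtype.ext (Edge.verts_injective h)
  exists_vs_eq e s hs hne := by
    obtain ⟨J, hJ, h⟩ := e.1.exists_part_verts_eq hs hne
    exact ⟨⟨e.1.part J hJ, e.2.part J hJ⟩, h⟩
  ind_eq e x := by
    split_ifs
    · exact Or.inr rfl
    · exact Or.inl rfl
  dependsOn_ind e x y h := by
    have : (toPMap x).onEdge e.1.2 = (toPMap y).onEdge e.1.2 := by
      funext i
      exact h _ (e.1.mk_mem_verts i)
    simp only [this]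
  dens_pos e := hpos e.1 e.2
  dens_le_one e := condProb_le_one _ _

end System

/-! ### Families of copies of edges as blowups. -/

section Copies

variable {ι : Type} {k : ℕ} {X Ω : ι → Type} {C : Index ι k → Type}
  {G : ColoredGraph k Ω C} {B : Complex k X C}

/-- The vertex sets given by a set of copies of vertices. -/
abbrev Copies (Z : Finset (Vertex X × Bool)) : ι → Type :=
  fun i => {p : X i × Bool // ((⟨i, p.1⟩ : Vertex X), p.2) ∈ Z}

variable {Z : Finset (Vertex X × Bool)}

/-- The edge of which an edge on copies of vertices is a copy. -/
def baseEdge {I : Finset ι} (e : EdgeOn (Copies Z) I) : EdgeOn X I := fun i => (e i).1.1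

/-- The vertices of which an edge uses the second copies. -/
def flagSet {I : Finset ι} (e : EdgeOn (Copies Z) I) : Finset (Vertex X) :=
  (I.attach.filter fun i => (e i).1.2 = true).map (baseEdge e).emb

theorem mem_flagSet {I : Finset ι} {e : EdgeOn (Copies Z) I} {i : ι} {a : X i} :
    (⟨i, a⟩ : Vertex X) ∈ flagSet e ↔ ∃ h : i ∈ I, (e ⟨i, h⟩).1 = (a, true) := by
  rw [flagSet, Finset.mem_map]
  constructor
  · rintro ⟨j, hj, h⟩
    have hj' := (Finset.mem_filter.1 hj).2
    obtain rfl : j.1 = i := congrArg Sigma.fst h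
    have h2 : (e j).1.1 = a := eq_of_heq (Sigma.mk.inj h).2
    exact ⟨j.2, Prod.ext h2 hj'⟩
  · rintro ⟨h, h'⟩
    refine ⟨⟨i, h⟩, Finset.mem_filter.2 ⟨Finset.mem_attach _ _, congrArg Prod.snd h'⟩, ?_⟩
    exact Sigma.ext rfl (heq_of_eq (congrArg Prod.fst h'))

theorem mk_mem_flagSet {I : Finset ι} {e : EdgeOn (Copies Z) I} (i : I) :
    (⟨i.1, (e i).1.1⟩ : Vertex X) ∈ flagSet e ↔ (e i).1.2 = true := by
  rw [mem_flagSet]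
  exact ⟨fun ⟨_, h⟩ => congrArg Prod.snd h, fun h => ⟨i.2, Prod.ext rfl h⟩⟩

variable [DecidableEq (Vertex X)] [Fintype {e : Edge k X // B.Visible e}]

theorem flagSet_restrict {I J : Index ι k} (h : J.1 ⊆ I.1) (e : EdgeOn (Copies Z) I.1) :
    flagSet (e.restrict h) = flagSet e ∩ Edge.verts ⟨J, (baseEdge e).restrict h⟩ := by
  ext ⟨i, a⟩
  rw [Finset.mem_inter, mem_flagSet, mem_flagSet, Edge.mem_verts]
  constructor
  · rintro ⟨hi, h'⟩
    exact ⟨⟨h hi, h'⟩, hi, congrArg Prod.fst h'⟩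
  · rintro ⟨⟨_, h'⟩, hi, _⟩
    exact ⟨hi, h'⟩

variable [Finite ι] [∀ i, Finite (Ω i)] {hpos : ∀ e, B.Visible e → 0 < B.density G e}
  {T : {e : Edge k X // B.Visible e} → Finset (Finset (Vertex X))}

/-- An edge on copies of vertices is a member of the family. -/
def IsCopy (T : {e : Edge k X // B.Visible e} → Finset (Finset (Vertex X)))
    (Z : Finset (Vertex X × Bool)) (I : Index ι k) (e : EdgeOn (Copies Z) I.1) : Prop :=
  ∃ h : B.Visible ⟨I, baseEdge e⟩, flagSet e ∈ T ⟨⟨I, baseEdge e⟩, h⟩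

/-- The closure condition `inter_mem` is exactly what makes the copies a complex: a part of a copy
is the copy of the part, with the flags cut down. -/
theorem IsCopy.restrict (hT : (edgeSystem G B hpos).IsClosedFamily T Z) {I J : Index ι k}
    (h : J.1 ⊆ I.1) {e : EdgeOn (Copies Z) I.1} (he : IsCopy T Z I e) :
    IsCopy T Z J (e.restrict h) := by
  obtain ⟨hv, ht⟩ := he
  refine ⟨hv.part J h, ?_⟩
  rw [flagSet_restrict]
  refine hT.inter_mem ⟨⟨I, baseEdge e⟩, hv⟩ _ ht ⟨⟨J, baseEdge (e.restrict h)⟩, hv.part J h⟩ ?_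
  rintro ⟨i, a⟩ hv'
  obtain ⟨hi, h'⟩ := Edge.mem_verts.1 hv'
  exact Edge.mem_verts.2 ⟨h hi, h'⟩

open Classical in
/-- The complex of the copies of edges in a closed family. -/
noncomputable def copyComplex (hT : (edgeSystem G B hpos).IsClosedFamily T Z) :
    Complex k (Copies Z) C where
  color I e := if IsCopy T Z I e then B.color I (baseEdge e) else none
  invisible_of_subset I J h e hnone := by
    by_contra hcon
    by_cases he : IsCopy T Z I e
    · rw [if_pos (he.restrict hT h)] at hnone
      obtain ⟨hv, _⟩ := he
      exact hv.part J h hnone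
    · exact hcon (if_neg he)

theorem visible_copyComplex (hT : (edgeSystem G B hpos).IsClosedFamily T Z) {I : Index ι k}
    {e : EdgeOn (Copies Z) I.1} :
    (copyComplex hT).Visible ⟨I, e⟩ ↔ IsCopy T Z I e := by
  unfold Complex.Visible copyComplex
  simp only []
  split_ifs with h
  · exact ⟨fun _ => h, fun _ => h.1⟩
  · simpa using h

theorem color_copyComplex (hT : (edgeSystem G B hpos).IsClosedFamily T Z) {I : Index ι k}
    {e : EdgeOn (Copies Z) I.1} (he : IsCopy T Z I e) :
    (copyComplex hT).color I e = B.color I (baseEdge e) :=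
  if_pos he

theorem density_copyComplex (hT : (edgeSystem G B hpos).IsClosedFamily T Z) {I : Index ι k}
    {e : EdgeOn (Copies Z) I.1} (he : IsCopy T Z I e) :
    (copyComplex hT).density G ⟨I, e⟩ = B.density G ⟨I, baseEdge e⟩ :=
  density_congr G fun _ hJ => color_copyComplex hT (he.restrict hT hJ)

/-- Each neighbour in `B` has at most two copies, and two copies of one vertex are never adjacent
because they lie in the same part. Hence `2Δ` in the counting hypothesis. -/
theorem degree_copyComplex_le [∀ i, Finite (X i)]
    (hT : (edgeSystem G B hpos).IsClosedFamily T Z) (v : Vertex (Copies Z)) :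
    (copyComplex hT).degree v ≤ 2 * B.degree ⟨v.1, v.2.1.1⟩ := by
  unfold Complex.degree
  refine (Nat.card_le_card_of_injective (β := {w : Vertex X // w ≠ ⟨v.1, v.2.1.1⟩ ∧
    ∃ e : Edge k X, B.Visible e ∧ e.size = 2 ∧ e.Contains ⟨v.1, v.2.1.1⟩ ∧ e.Contains w} × Bool)
    (fun w => (⟨⟨w.1.1, w.1.2.1.1⟩, ?_⟩, w.1.2.1.2)) ?_).trans (le_of_eq ?_)
  · obtain ⟨w, hwv, ⟨I, e⟩, hvis, hsize, ⟨hv1, hv2⟩, hw1, hw2⟩ := w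
    have hcopy := (visible_copyComplex hT).1 hvis
    refine ⟨?_, ⟨I, baseEdge e⟩, hcopy.1, hsize, ⟨hv1, congrArg (fun p => p.1.1) hv2⟩,
      hw1, congrArg (fun p => p.1.1) hw2⟩
    intro h
    apply hwv
    obtain ⟨i, w⟩ := w
    obtain ⟨j, v⟩ := v
    obtain rfl : i = j := congrArg Sigma.fst h
    congr 1
    exact hw2.symm.trans hv2
  · rintro ⟨⟨i, w, hw⟩, hw'⟩ ⟨⟨j, v, hv⟩, hv'⟩ h
    simp only [Prod.mk.injEq, Subtype.mk.injEq, Sigma.mk.injEq] at h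
    obtain ⟨⟨rfl, h1⟩, h2⟩ := h
    obtain rfl : w = v := Prod.ext (eq_of_heq h1) h2
    rfl
  · rw [Nat.card_prod, Nat.card_eq_fintype_card (α := Bool), Fintype.card_bool, mul_comm]

theorem isBlowup_copyComplex [∀ i, Finite (X i)] {Δ : ℕ} {Y : ι → Type} {S : Complex k Y C}
    (hB : B.IsBlowup Δ S) (hT : (edgeSystem G B hpos).IsClosedFamily T Z) :
    (copyComplex hT).IsBlowup (2 * Δ) S := by
  obtain ⟨hdeg, φ, hφ⟩ := hB
  refine ⟨fun v => (degree_copyComplex_le hT v).trans (Nat.mul_le_mul_left 2 (hdeg _)),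
    fun i p => φ i p.1.1, ?_⟩
  rintro ⟨I, e⟩ he
  have hcopy := (visible_copyComplex hT).1 he
  exact (color_copyComplex hT hcopy).trans (hφ ⟨I, baseEdge e⟩ hcopy.1)

theorem card_vertex_copies_le [∀ i, Finite (X i)] : Nat.card (Vertex (Copies Z)) ≤ #Z := by
  rw [← Nat.card_eq_finsetCard Z]
  refine Nat.card_le_card_of_injective
    (fun v : Vertex (Copies Z) => (⟨(⟨v.1, v.2.1.1⟩, v.2.1.2), v.2.2⟩ : Z)) ?_
  rintro ⟨i, w, hw⟩ ⟨j, v, hv⟩ h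
  simp only [Subtype.mk.injEq, Prod.mk.injEq, Sigma.mk.injEq] at h
  obtain ⟨⟨rfl, h1⟩, h2⟩ := h
  obtain rfl : w = v := Prod.ext (eq_of_heq h1) h2
  rfl

end Copies

/-! ### Random images of the copies of vertices. -/

section Sample

variable {ι : Type} {X Ω : ι → Type} {Z : Finset (Vertex X × Bool)}

/-- The images of the copies of vertices under a pair of points. -/
def samplePMap (x y : ∀ v : Vertex X, Ω v.1) : PMap (Copies Z) Ω :=
  fun i p => if p.1.2 = true then y ⟨i, p.1.1⟩ else x ⟨i, p.1.1⟩

variable [DecidableEq (Vertex X)]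

/-- Exchanging the images of the copies of vertices in `Z`. -/
def sampleSwap (p : PMap (Copies Z) Ω × ((∀ v : Vertex X, Ω v.1) × (∀ v : Vertex X, Ω v.1))) :
    PMap (Copies Z) Ω × ((∀ v : Vertex X, Ω v.1) × (∀ v : Vertex X, Ω v.1)) :=
  (samplePMap p.2.1 p.2.2,
    fun v => if h : (v, false) ∈ Z then p.1 v.1 ⟨(v.2, false), h⟩ else p.2.1 v,
    fun v => if h : (v, true) ∈ Z then p.1 v.1 ⟨(v.2, true), h⟩ else p.2.2 v)

theorem sampleSwap_involutive :
    Function.Involutive (sampleSwap (X := X) (Ω := Ω) (Z := Z)) := by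
  rintro ⟨φ, x, y⟩
  refine Prod.ext ?_ (Prod.ext ?_ ?_)
  · funext i ⟨⟨a, b⟩, h⟩
    cases b <;> simp [sampleSwap, samplePMap, h]
  · funext v
    by_cases h : (v, false) ∈ Z <;> simp [sampleSwap, samplePMap, h]
  · funext v
    by_cases h : (v, true) ∈ Z <;> simp [sampleSwap, samplePMap, h]

/-- Two independent points induce a uniformly random map on the copies: `sampleSwap` exchanges the
coordinates in use with an independent map and preserves the uniform distribution, being a
bijection. -/
theorem expect_samplePMap [Fintype (∀ v : Vertex X, Ω v.1)] [Fintype (PMap (Copies Z) Ω)]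
    [Nonempty (∀ v : Vertex X, Ω v.1)] (F : PMap (Copies Z) Ω → ℝ) :
    𝔼 x : (∀ v : Vertex X, Ω v.1), 𝔼 y : (∀ v : Vertex X, Ω v.1), F (samplePMap x y) =
      𝔼 φ, F φ := by
  obtain ⟨x₀⟩ := ‹Nonempty (∀ v : Vertex X, Ω v.1)›
  have : Nonempty (∀ v : Vertex X, Ω v.1) := ⟨x₀⟩
  have : Nonempty (PMap (Copies Z) Ω) := ⟨samplePMap x₀ x₀⟩
  have h := Fintype.expect_equiv (sampleSwap_involutive (X := X) (Ω := Ω) (Z := Z)).toPerm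
    (fun p => F (samplePMap p.2.1 p.2.2)) (fun p => F p.1) fun p => rfl
  rw [← Finset.univ_product_univ, Finset.expect_product, Finset.expect_product] at h
  simp only [Fintype.expect_const] at h
  rw [← h, ← Finset.univ_product_univ, Finset.expect_product]

end Sample

/-! ### Regularity of the edge system from the counting hypothesis. -/

section Regularity

variable {ι : Type} {k : ℕ} {X Ω : ι → Type} {C : Index ι k → Type}
  {G : ColoredGraph k Ω C} {B : Complex k X C} {Z : Finset (Vertex X × Bool)}
  [DecidableEq (Vertex X)] [Fintype {e : Edge k X // B.Visible e}]
  [Finite ι] [∀ i, Finite (Ω i)] {hpos : ∀ e, B.Visible e → 0 < B.density G e}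
  {T : {e : Edge k X // B.Visible e} → Finset (Finset (Vertex X))}

theorem eq_of_baseEdge_eq {I : Finset ι} {e e' : EdgeOn (Copies Z) I}
    (h : baseEdge e = baseEdge e') (h' : flagSet e = flagSet e') : e = e' := by
  funext i
  have h1 : (e i).1.1 = (e' i).1.1 := congrFun h i
  refine Subtype.ext (Prod.ext h1 ?_)
  have h2 := mk_mem_flagSet (e := e) i
  rw [h', h1, mk_mem_flagSet (e := e') i] at h2
  exact (Bool.eq_iff_iff.2 h2).symm

theorem exists_copy (hT : (edgeSystem G B hpos).IsClosedFamily T Z)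
    (e : {e : Edge k X // B.Visible e}) {t : Finset (Vertex X)} (ht : t ∈ T e) :
    ∃ e' : EdgeOn (Copies Z) e.1.1.1, baseEdge e' = e.1.2 ∧ flagSet e' = t := by
  refine ⟨fun i => ⟨(e.1.2 i, decide ((⟨i.1, e.1.2 i⟩ : Vertex X) ∈ t)),
    hT.mem e t ht _ (e.1.mk_mem_verts i)⟩, rfl, ?_⟩
  ext ⟨i, a⟩
  rw [mem_flagSet]
  constructor
  · rintro ⟨h, h'⟩
    obtain ⟨h1, h2⟩ := Prod.mk.inj h'
    have h3 : (⟨i, a⟩ : Vertex X) = ⟨i, e.1.2 ⟨i, h⟩⟩ := Sigma.ext rfl (heq_of_eq h1.symm)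
    rw [h3]
    exact of_decide_eq_true h2
  · intro ha
    obtain ⟨hi, h⟩ := Edge.mem_verts.1 (hT.subset e t ht ha)
    have h3 : (⟨i, e.1.2 ⟨i, hi⟩⟩ : Vertex X) = ⟨i, a⟩ := Sigma.ext rfl (heq_of_eq h)
    exact ⟨hi, Prod.ext h (decide_eq_true (h3.symm ▸ ha))⟩

/-- The visible edges of the copy complex correspond bijectively to the pairs `(e, t)` with `t ∈ T
e`. -/
theorem prod_visible_copyComplex (hT : (edgeSystem G B hpos).IsClosedFamily T Z)
    [Fintype {e // (copyComplex hT).Visible e}] (g : {e // (copyComplex hT).Visible e} → ℝ)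
    (f : {e : Edge k X // B.Visible e} → Finset (Vertex X) → ℝ)
    (hfg : ∀ (I : Index ι k) (e : EdgeOn (Copies Z) I.1) (he : IsCopy T Z I e),
      g ⟨⟨I, e⟩, (visible_copyComplex hT).2 he⟩ = f ⟨⟨I, baseEdge e⟩, he.1⟩ (flagSet e)) :
    ∏ e, g e = ∏ e, ∏ t ∈ T e, f e t := by
  rw [Finset.prod_sigma']
  have hc : ∀ e : {e // (copyComplex hT).Visible e}, IsCopy T Z e.1.1 e.1.2 := fun e =>
    (visible_copyComplex hT).1 e.2
  refine Finset.prod_bij (fun e _ => ⟨⟨⟨e.1.1, baseEdge e.1.2⟩, (hc e).1⟩, flagSet e.1.2⟩)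
    (fun e _ => ?_) (fun e _ e' _ h => ?_) (fun p hp => ?_) (fun e _ => hfg e.1.1 e.1.2 (hc e))
  · exact Finset.mem_sigma.2 ⟨Finset.mem_univ _, (hc e).2⟩
  · obtain ⟨⟨I, e⟩, he⟩ := e
    obtain ⟨⟨I', e'⟩, he'⟩ := e'
    obtain ⟨h1, h2⟩ := Sigma.mk.inj h
    obtain ⟨rfl, h3⟩ := Sigma.mk.inj (Subtype.mk.inj h1)
    obtain rfl := eq_of_baseEdge_eq (eq_of_heq h3) (eq_of_heq h2)
    rfl
  · obtain ⟨⟨⟨I, e⟩, hv⟩, t⟩ := p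
    have ht := (Finset.mem_sigma.1 hp).2
    obtain ⟨e', rfl, rfl⟩ : ∃ e' : EdgeOn (Copies Z) I.1, baseEdge e' = e ∧ flagSet e' = t :=
      exists_copy hT ⟨⟨I, e⟩, hv⟩ ht
    exact ⟨⟨⟨I, e'⟩, (visible_copyComplex hT).2 ⟨hv, ht⟩⟩, Finset.mem_univ _, rfl⟩

theorem onEdge_samplePMap {I : Finset ι} (e : EdgeOn (Copies Z) I)
    (x y : ∀ v : Vertex X, Ω v.1) :
    (samplePMap x y).onEdge e = (toPMap ((flagSet e).piecewise y x)).onEdge (baseEdge e) := by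
  funext i
  have h := mk_mem_flagSet (e := e) i
  by_cases hb : (e i).1.2 = true
  · exact (if_pos hb).trans (if_pos (h.2 hb)).symm
  · exact (if_neg hb).trans (if_neg fun hm => hb (h.1 hm)).symm

variable [∀ i, Finite (X i)] [Fintype (Vertex X)] [∀ i, Fintype (Ω i)] [∀ i, Nonempty (Ω i)]

theorem prob_embeds_copyComplex (hT : (edgeSystem G B hpos).IsClosedFamily T Z) :
    prob (fun φ : PMap (Copies Z) Ω => (copyComplex hT).Embeds φ G) =
      (edgeSystem G B hpos).count T := by
  classical
  haveI : Fintype (PMap (Copies Z) Ω) := Fintype.ofFinite _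
  haveI : Fintype {e // (copyComplex hT).Visible e} := Fintype.ofFinite _
  rw [prob_eq_expect, ← expect_samplePMap]
  refine Finset.expect_congr rfl fun x _ => Finset.expect_congr rfl fun y _ => ?_
  rw [← prod_visible_copyComplex hT
    (fun e => if (copyComplex hT).color e.1.1 e.1.2 =
      some (G.color e.1.1 ((samplePMap x y).onEdge e.1.2)) then 1 else 0)]
  · rw [Finset.prod_boole]
    congr 1
    simp only [Complex.Embeds, Finset.mem_univ, true_imp_iff, Subtype.forall]
  · intro I e he
    simp only [color_copyComplex hT he, onEdge_samplePMap, edgeSystem]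

/-- The hypothesis is applied to `copyComplex`. The condition `η i ≤ 1` makes the lower factors
nonnegative, so the edgewise bounds can be multiplied. -/
theorem regular_edgeSystem {Δ M : ℕ} {Y : ι → Type} {S : Complex k Y C} (hB : B.IsBlowup Δ S)
    {η : ℕ → ℝ} (hη : ∀ i, 1 ≤ i → i ≤ k → η i ≤ 1)
    (hS : ∀ (X' : ι → Type) [∀ i, Finite (X' i)] (S' : Complex k X' C),
      S'.IsBlowup (2 * Δ) S → Nat.card (Vertex X') ≤ M → S'.CountsWithin G η) :
    (edgeSystem G B hpos).Regular M η := by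
  classical
  intro T Z hT hM
  haveI : Fintype {e // (copyComplex hT).Visible e} := Fintype.ofFinite _
  obtain ⟨c, hc, hp⟩ := hS (Copies Z) (copyComplex hT) (isBlowup_copyComplex hB hT)
    (card_vertex_copies_le.trans hM)
  rw [prob_embeds_copyComplex hT, finprod_eq_prod_of_fintype] at hp
  have hsize : ∀ e : {e : Edge k X // B.Visible e}, #((edgeSystem G B hpos).vs e) = e.1.size :=
    fun e => e.1.card_verts
  have hden : ∀ e : {e // (copyComplex hT).Visible e}, 0 ≤ (copyComplex hT).density G e.1 :=
    fun e => div_nonneg (Nat.cast_nonneg _) (Nat.cast_nonneg _)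
  rw [hp]
  constructor
  · rw [← prod_visible_copyComplex hT
      (fun e => (1 - η e.1.size) * (copyComplex hT).density G e.1)]
    · refine Finset.prod_le_prod (fun e _ => mul_nonneg ?_ (hden e)) fun e _ => ?_
      · linarith [hη e.1.size (Finset.card_pos.2 e.1.1.2.1) e.1.1.2.2]
      · exact (le_max_right _ _).trans (hc e).1
    · intro I e he
      rw [density_copyComplex hT he, hsize]
      rfl
  · rw [← prod_visible_copyComplex hT
      (fun e => (1 + η e.1.size) * (copyComplex hT).density G e.1)]
    · refine Finset.prod_le_prod (fun e _ => (le_max_left _ _).trans (hc e).1) fun e _ => ?_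
      exact (hc e).2.trans (min_le_right _ _)
    · intro I e he
      rw [density_copyComplex hT he, hsize]
      rfl

theorem degreeLE_edgeSystem {Δ : ℕ} (hB : ∀ v, B.degree v ≤ Δ) :
    (edgeSystem G B hpos).DegreeLE Δ := by
  intro v U
  refine le_trans ?_ (hB v)
  rw [← Nat.card_eq_finsetCard, Complex.degree]
  refine Nat.card_le_card_of_injective (fun w => ⟨w.1, ?_⟩) fun a b h =>
    Subtype.ext (congrArg (fun c => c.1) h)
  obtain ⟨⟨_, hwv⟩, a, ha, e, he⟩ := EdgeSystem.mem_nbr.1 w.2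
  rw [Finset.mem_singleton] at ha hwv
  subst ha
  have he' : e.1.verts = {a, w.1} := he
  refine ⟨hwv, e.1, e.2, ?_, Edge.mem_verts.1 (by simp [he']), Edge.mem_verts.1 (by simp [he'])⟩
  rw [← Edge.card_verts, he', Finset.card_pair (Ne.symm hwv)]

theorem density_eq_of_embedsComplex {Y : ι → Type} {S : Complex k Y C} {φ : PMap X Y}
    (hφ : B.EmbedsComplex φ S) {e : Edge k X} (he : B.Visible e) :
    S.Visible ⟨e.1, φ.onEdge e.2⟩ ∧ B.density G e = S.density G ⟨e.1, φ.onEdge e.2⟩ := by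
  refine ⟨fun h => he ((hφ e he).trans h), ?_⟩
  exact density_congr G fun J hJ => hφ (e.part J hJ) (he.part J hJ)

end Regularity

section Coordinate

variable {V : Type} [Fintype V] [DecidableEq V] {Y : V → Type} [∀ v, Fintype (Y v)]
  [∀ v, Nonempty (Y v)]

theorem expect_coordinate (u : V) (f : Y u → ℝ) : 𝔼 x : (∀ v, Y v), f (x u) = 𝔼 a, f a := by
  have h := Fintype.expect_equiv (Equiv.piSplitAt u Y) (fun x => f (x u)) (fun p => f p.1)
    fun x => rfl
  rw [h, ← Finset.univ_product_univ, Finset.expect_product]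
  simp only [Fintype.expect_const]

end Coordinate

/-! ### Collisions and the two weights. -/

section Weights

variable {ι : Type} {X Ω : ι → Type} {E : Type} [DecidableEq (Vertex X)] [Fintype (Vertex X)]
  [∀ i, Fintype (Ω i)] [Fintype E]

open Classical in
/-- The indicator of the event that the image of `u` is the image of a vertex in `W`. -/
noncomputable def collision (W : Finset (Vertex X)) (u : Vertex X) (x : ∀ v : Vertex X, Ω v.1) :
    ℝ :=
  if ∃ w ∈ W, (⟨w.1, x w⟩ : Vertex Ω) = ⟨u.1, x u⟩ then 1 else 0

theorem collision_nonneg (W : Finset (Vertex X)) (u : Vertex X) (x : ∀ v : Vertex X, Ω v.1) :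
    0 ≤ collision W u x := by
  unfold collision; split_ifs <;> norm_num

variable [∀ i, Nonempty (Ω i)]

/-- With all other images fixed, a collision forces the image of `u` into the images of the vertices
of its own part, at most a proportion `ζ` of the possible values. -/
theorem expect_collision_mul_le {ζ : ℝ}
    (hζ : ∀ i, (Nat.card (X i) : ℝ) ≤ ζ * Nat.card (Ω i)) [∀ i, Finite (X i)]
    {W : Finset (Vertex X)} {u : Vertex X} (hu : u ∉ W) {g : (∀ v : Vertex X, Ω v.1) → ℝ}
    (hg : DependsOn g (W : Set (Vertex X))) (hg0 : ∀ x, 0 ≤ g x) :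
    𝔼 x, collision W u x * g x ≤ ζ * 𝔼 x, g x := by
  classical
  rw [← expect_piecewise {u}, Finset.expect_comm, Finset.mul_expect]
  refine Finset.expect_le_expect fun y _ => ?_
  simp only [apply_piecewise_of_disjoint hg (Finset.disjoint_singleton_right.2 hu)]
  rw [← Finset.expect_mul]
  refine mul_le_mul_of_nonneg_right ?_ (hg0 y)
  have h1 : ∀ x : (∀ v : Vertex X, Ω v.1), collision W u (({u} : Finset (Vertex X)).piecewise x y) =
      if ∃ w ∈ W, (⟨w.1, y w⟩ : Vertex Ω) = ⟨u.1, x u⟩ then (1 : ℝ) else 0 := by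
    intro x
    unfold collision
    refine if_congr ?_ rfl rfl
    refine exists_congr fun w => and_congr_right fun hw => ?_
    have hwu : w ∉ ({u} : Finset (Vertex X)) := fun h => hu (Finset.mem_singleton.1 h ▸ hw)
    rw [Finset.piecewise_eq_of_notMem _ _ _ hwu,
      Finset.piecewise_eq_of_mem _ _ _ (Finset.mem_singleton_self u)]
  simp only [h1]
  rw [expect_coordinate (Y := fun v : Vertex X => Ω v.1) u
    (fun a => if ∃ w ∈ W, (⟨w.1, y w⟩ : Vertex Ω) = ⟨u.1, a⟩ then (1 : ℝ) else 0),
    Fintype.expect_eq_sum_div_card, Finset.sum_boole,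
    div_le_iff₀ (by exact_mod_cast Fintype.card_pos)]
  haveI : Fintype (X u.1) := Fintype.ofFinite _
  have h2 := hζ u.1
  rw [Nat.card_eq_fintype_card, Nat.card_eq_fintype_card] at h2
  refine le_trans ?_ h2
  have h3 : (univ.filter fun a : Ω u.1 => ∃ w ∈ W, (⟨w.1, y w⟩ : Vertex Ω) = ⟨u.1, a⟩) ⊆
      (univ : Finset (X u.1)).image fun b => y ⟨u.1, b⟩ := by
    intro a ha
    obtain ⟨⟨i, b⟩, _, h⟩ := (Finset.mem_filter.1 ha).2
    obtain rfl : i = u.1 := congrArg Sigma.fst h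
    exact Finset.mem_image.2 ⟨b, Finset.mem_univ _, eq_of_heq (Sigma.mk.inj h).2⟩
  exact_mod_cast (Finset.card_le_card h3).trans (Finset.card_image_le.trans le_rfl)

variable (R : EdgeSystem (Vertex X) (fun v => Ω v.1) E)

/-- The weight given by the indicator that all edges in `U` are embedded and a further factor. -/
noncomputable def weight (χ : Finset (Vertex X) → (∀ v : Vertex X, Ω v.1) → ℝ)
    (U : Finset (Vertex X)) (x : ∀ v : Vertex X, Ω v.1) : ℝ :=
  R.Ind (R.touch U U) x * χ U x

/-- An edge in `U` either meets `A` or lies in `U \ A`, and not both. -/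
theorem Ind_touch_self (U A : Finset (Vertex X)) :
    R.Ind (R.touch U U) = fun x => R.Ind (R.touch A U) x * R.Ind (R.touch (U \ A) (U \ A)) x := by
  classical
  have h : R.touch U U = R.touch A U ∪ R.touch (U \ A) (U \ A) := by
    ext e
    simp only [EdgeSystem.mem_touch, Finset.mem_union]
    constructor
    · rintro ⟨h1, _⟩
      by_cases hd : Disjoint (R.vs e) A
      · have := Finset.subset_sdiff.2 ⟨h1, hd⟩
        exact Or.inr ⟨this, EdgeSystem.not_disjoint_of_vs_subset this⟩
      · exact Or.inl ⟨h1, hd⟩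
    · rintro (⟨h1, _⟩ | ⟨h1, _⟩)
      · exact ⟨h1, EdgeSystem.not_disjoint_of_vs_subset h1⟩
      · have := h1.trans Finset.sdiff_subset
        exact ⟨this, EdgeSystem.not_disjoint_of_vs_subset this⟩
  funext x
  rw [h]
  exact Finset.prod_union (Finset.disjoint_left.2 fun e h1 h2 =>
    (EdgeSystem.mem_touch.1 h1).2 (Finset.subset_sdiff.1 (EdgeSystem.mem_touch.1 h2).1).2)

/-- A further factor `χ` is harmless if, when a vertex `u` is added, it can drop only through a
collision of `u` with an earlier vertex. -/
theorem isWeight_weight {ζ : ℝ} (hζ : ∀ i, (Nat.card (X i) : ℝ) ≤ ζ * Nat.card (Ω i))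
    [∀ i, Finite (X i)] {χ : Finset (Vertex X) → (∀ v : Vertex X, Ω v.1) → ℝ}
    (h0 : ∀ U x, 0 ≤ χ U x) (hdep : ∀ U, DependsOn (χ U) (U : Set (Vertex X)))
    (hanti : ∀ U A x, χ U x ≤ χ (U \ A) x) (hempty : ∀ x, χ ∅ x = 1)
    (hcol : ∀ U, ∀ u ∈ U, ∀ x, χ (U \ {u}) x - collision (U \ {u}) u x * χ (U \ {u}) x ≤ χ U x) :
    R.IsWeight (weight R χ) ζ := by
  have hn : ∀ U x, 0 ≤ weight R χ U x := fun U x => mul_nonneg (R.Ind_nonneg _ _) (h0 U x)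
  have hd : ∀ U, DependsOn (weight R χ U) (U : Set (Vertex X)) := fun U x y h => by
    unfold weight
    rw [hdep U h, R.dependsOn_Ind (fun e he => (EdgeSystem.mem_touch.1 he).1) h]
  refine ⟨hn, hd, fun U A _ x => ?_, ?_, fun U u hu g hg0 hg1 => ?_⟩
  · unfold weight
    rw [Ind_touch_self R U A, ← mul_assoc]
    exact mul_le_mul_of_nonneg_left (hanti U A x)
      (mul_nonneg (R.Ind_nonneg _ _) (R.Ind_nonneg _ _))
  · have : R.touch ∅ ∅ = ∅ := by ext e; simp [EdgeSystem.mem_touch]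
    have h1 : ∀ x : (∀ v : Vertex X, Ω v.1), weight R χ ∅ x = 1 := fun x => by
      unfold weight
      rw [this, hempty]
      simp [EdgeSystem.Ind]
    simp only [h1, Fintype.expect_const, zero_lt_one]
  · have h1 := expect_collision_mul_le hζ (W := U \ {u}) (u := u) (by simp) (hd (U \ {u}))
      (hn (U \ {u}))
    have h2 : 𝔼 x, (g x * (R.Ind (R.touch {u} U) x * weight R χ (U \ {u}) x) -
        collision (U \ {u}) u x * weight R χ (U \ {u}) x) ≤ 𝔼 x, g x * weight R χ U x := by
      refine Finset.expect_le_expect fun x _ => ?_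
      have hK0 := R.Ind_nonneg (R.touch {u} U) x
      have hK1 := R.Ind_le_one (R.touch {u} U) x
      have hI0 := R.Ind_nonneg (R.touch (U \ {u}) (U \ {u})) x
      have hc0 := collision_nonneg (U \ {u}) u x
      have hx0 := h0 (U \ {u}) x
      unfold weight
      rw [Ind_touch_self R U {u}]
      set K := R.Ind (R.touch {u} U) x
      set I := R.Ind (R.touch (U \ {u}) (U \ {u})) x
      set c := collision (U \ {u}) u x
      have hgK1 : g x * K ≤ 1 := mul_le_one₀ (hg1 x) hK0 hK1
      have hgK0 : 0 ≤ g x * K := mul_nonneg (hg0 x) hK0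
      have h3 : g x * K * I * (χ (U \ {u}) x - c * χ (U \ {u}) x) ≤ g x * K * I * χ U x :=
        mul_le_mul_of_nonneg_left (hcol U u hu x) (mul_nonneg hgK0 hI0)
      have h4 : g x * K * (c * (I * χ (U \ {u}) x)) ≤ 1 * (c * (I * χ (U \ {u}) x)) :=
        mul_le_mul_of_nonneg_right hgK1 (mul_nonneg hc0 (mul_nonneg hI0 hx0))
      linarith
    rw [Finset.expect_sub_distrib] at h2
    linarith

theorem isWeight_one {ζ : ℝ} (hζ : ∀ i, (Nat.card (X i) : ℝ) ≤ ζ * Nat.card (Ω i))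
    [∀ i, Finite (X i)] : R.IsWeight (weight R fun _ _ => 1) ζ :=
  isWeight_weight R hζ (fun _ _ => zero_le_one) (fun _ _ _ _ => rfl) (fun _ _ _ => le_rfl)
    (fun _ => rfl) fun U u _ x => by linarith [collision_nonneg (U \ {u}) u x]

open Classical in
/-- The indicator of the event that the images of the vertices in `U` are distinct. -/
noncomputable def injIndicator (U : Finset (Vertex X)) (x : ∀ v : Vertex X, Ω v.1) : ℝ :=
  if Set.InjOn (fun v : Vertex X => (⟨v.1, x v⟩ : Vertex Ω)) U then 1 else 0

theorem isWeight_injIndicator {ζ : ℝ} (hζ : ∀ i, (Nat.card (X i) : ℝ) ≤ ζ * Nat.card (Ω i))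
    [∀ i, Finite (X i)] : R.IsWeight (weight R injIndicator) ζ := by
  classical
  refine isWeight_weight R hζ (fun U x => ?_) (fun U x y h => ?_) (fun U A x => ?_) (fun x => ?_)
    fun U u hu x => ?_
  · unfold injIndicator; split_ifs <;> norm_num
  · unfold injIndicator
    refine if_congr (Set.EqOn.injOn_iff fun v hv => ?_) rfl rfl
    simp only [h v hv]
  · unfold injIndicator
    by_cases h : Set.InjOn (fun v : Vertex X => (⟨v.1, x v⟩ : Vertex Ω)) U
    · rw [if_pos h, if_pos (h.mono (by exact_mod_cast Finset.sdiff_subset))]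
    · rw [if_neg h]
      split_ifs <;> norm_num
  · unfold injIndicator
    rw [if_pos (by simp)]
  · have hc := collision_nonneg (U \ {u}) u x
    have hle : injIndicator (U \ {u}) x ≤ 1 := by
      unfold injIndicator; split_ifs <;> norm_num
    have h0 : 0 ≤ injIndicator (U \ {u}) x := by
      unfold injIndicator; split_ifs <;> norm_num
    have h0' : 0 ≤ injIndicator U x := by
      unfold injIndicator; split_ifs <;> norm_num
    by_cases hcol : ∃ w ∈ U \ {u}, (⟨w.1, x w⟩ : Vertex Ω) = ⟨u.1, x u⟩
    · have : collision (U \ {u}) u x = 1 := if_pos hcol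
      rw [this]; linarith
    · have h1 : collision (U \ {u}) u x = 0 := if_neg hcol
      rw [h1, zero_mul, sub_zero]
      unfold injIndicator
      by_cases h : Set.InjOn (fun v : Vertex X => (⟨v.1, x v⟩ : Vertex Ω)) ↑(U \ {u})
      · rw [if_pos h, if_pos]
        have hU : (U : Set (Vertex X)) = insert u (↑(U \ {u}) : Set (Vertex X)) := by
          ext v
          by_cases hv : v = u <;> simp [hv, hu]
        rw [hU, Set.injOn_insert (by simp)]
        refine ⟨h, ?_⟩
        rintro ⟨w, hw, hwu⟩
        exact hcol ⟨w, hw, hwu⟩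
      · rw [if_neg h]
        split_ifs <;> norm_num

end Weights

/-! ### Conditional averages and deletion of a vertex. -/

section Conditional

variable {α : Type} [Fintype α]

theorem condExpect_eq_div [Nonempty α] (f : α → ℝ) (p : α → Prop) [DecidablePred p] :
    condExpect f p = (𝔼 a, if p a then f a else 0) / 𝔼 a, if p a then (1 : ℝ) else 0 := by
  classical
  have hc : (Fintype.card α : ℝ) ≠ 0 := by exact_mod_cast Fintype.card_ne_zero
  rw [condExpect, Fintype.expect_eq_sum_div_card, Fintype.expect_eq_sum_div_card,
    div_div_div_cancel_right₀ hc, Finset.sum_boole, Nat.card_eq_fintype_card,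
    Fintype.card_subtype, finsum_eq_sum_of_fintype, ← Finset.sum_filter]
  congr 1
  exact (Finset.sum_subtype _ (by simp) f).symm

end Conditional

section Delete

variable {ι : Type} {k : ℕ} {X Ω : ι → Type} {C : Index ι k → Type}

/-- A partitionwise map as a pair of partitionwise maps on all vertices but `u` and on `u`. -/
noncomputable def splitEquiv (u : Vertex X) : (∀ v : Vertex X, Ω v.1) ≃
    PMap (Sub ({u}ᶜ : Set (Vertex X))) Ω × PMap (Sub ({u} : Set (Vertex X))) Ω where
  toFun x := (fun i a => x ⟨i, a.1⟩, fun i a => x ⟨i, a.1⟩)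
  invFun p v := PMap.glue u p.1 p.2 v.1 v.2
  left_inv x := by
    funext v
    by_cases h : (⟨v.1, v.2⟩ : Vertex X) ∈ ({u} : Set (Vertex X)) <;> simp [PMap.glue]
  right_inv p := by
    refine Prod.ext ?_ ?_
    · funext i a
      have h : (⟨i, a.1⟩ : Vertex X) ∉ ({u} : Set (Vertex X)) := a.2
      simp only [PMap.glue, dif_neg h]
    · funext i a
      have h : (⟨i, a.1⟩ : Vertex X) ∈ ({u} : Set (Vertex X)) := a.2
      simp only [PMap.glue, dif_pos h]

theorem glue_splitEquiv (u : Vertex X) (x : ∀ v : Vertex X, Ω v.1) :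
    PMap.glue u (splitEquiv u x).1 (splitEquiv u x).2 = toPMap x := by
  have h := (splitEquiv u).symm_apply_apply x
  funext i a
  exact congrFun h ⟨i, a⟩

theorem embeds_delete_iff {B : Complex k X C} {G : ColoredGraph k Ω C} (u : Vertex X)
    (x : ∀ v : Vertex X, Ω v.1) :
    (B.delete u).Embeds (splitEquiv u x).1 G ↔ ∀ e : {e : Edge k X // B.Visible e},
      u ∉ e.1.verts → B.color e.1.1 e.1.2 = some (G.color e.1.1 ((toPMap x).onEdge e.1.2)) := by
  constructor
  · rintro h ⟨⟨I, e⟩, he⟩ hu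
    have hne : ∀ i : I.1, (⟨i.1, e i⟩ : Vertex X) ∈ ({u}ᶜ : Set (Vertex X)) := fun i hi =>
      hu (hi ▸ Edge.mk_mem_verts ⟨I, e⟩ i)
    exact h ⟨I, fun i => ⟨e i, hne i⟩⟩ he
  · rintro h ⟨I, e⟩ he
    refine h ⟨⟨I, fun i => (e i).1⟩, he⟩ fun hu => ?_
    obtain ⟨hi, h'⟩ := Edge.mem_verts.1 hu
    exact (e ⟨u.1, hi⟩).2 (Sigma.ext rfl (heq_of_eq h'))

end Delete

/-! ### The two inequalities for a controlled system. -/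

section Main

variable {ι : Type} {k : ℕ} {X Ω : ι → Type} {C : Index ι k → Type}
  {G : ColoredGraph k Ω C} {B : Complex k X C} [DecidableEq (Vertex X)] [Fintype (Vertex X)]
  [Finite ι] [∀ i, Finite (X i)] [∀ i, Fintype (Ω i)] [∀ i, Nonempty (Ω i)]
  [Fintype {e : Edge k X // B.Visible e}] {hpos : ∀ e, B.Visible e → 0 < B.density G e}
  {Δ L : ℕ} {ρ : ℕ → ℝ}

open Classical in
theorem Ind_edgeSystem (s : Finset {e : Edge k X // B.Visible e}) (x : ∀ v : Vertex X, Ω v.1) :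
    (edgeSystem G B hpos).Ind s x = if ∀ e ∈ s,
      B.color e.1.1 e.1.2 = some (G.color e.1.1 ((toPMap x).onEdge e.1.2)) then 1 else 0 := by
  refine Finset.prod_boole.trans ?_
  congr

theorem embeds_iff_forall_subtype (x : ∀ v : Vertex X, Ω v.1) :
    B.Embeds (toPMap x) G ↔ ∀ e ∈ (edgeSystem G B hpos).touch univ univ,
      B.color e.1.1 e.1.2 = some (G.color e.1.1 ((toPMap x).onEdge e.1.2)) := by
  simp only [Complex.Embeds, Subtype.forall]
  refine forall₂_congr fun e he => ⟨fun h _ => h, fun h => h ?_⟩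
  exact EdgeSystem.mem_touch.2 ⟨Finset.subset_univ _,
    EdgeSystem.not_disjoint_of_vs_subset (Finset.subset_univ _)⟩

theorem finprod_density_contains (u : Vertex X) :
    ∏ᶠ e : {e : Edge k X // B.Visible e ∧ e.Contains u}, B.density G e.1 =
      (edgeSystem G B hpos).D ((edgeSystem G B hpos).touch {u} univ) := by
  classical
  haveI : Fintype {e : Edge k X // B.Visible e ∧ e.Contains u} := Fintype.ofInjective
    (fun e => (⟨e.1, e.2.1⟩ : {e : Edge k X // B.Visible e}))
    fun a b h => Subtype.ext (congrArg (fun c => c.1) h)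
  have hmem : ∀ e : {e : Edge k X // B.Visible e},
      e ∈ (edgeSystem G B hpos).touch {u} univ ↔ e.1.Contains u := fun e => by
    rw [EdgeSystem.mem_touch, Finset.disjoint_singleton_right, not_not]
    exact ⟨fun h => Edge.mem_verts.1 h.2, fun h => ⟨Finset.subset_univ _, Edge.mem_verts.2 h⟩⟩
  rw [finprod_eq_prod_of_fintype]
  refine Finset.prod_bij (fun e _ => ⟨e.1, e.2.1⟩) (fun e _ => (hmem _).2 e.2.2)
    (fun a _ b _ h => Subtype.ext (congrArg (fun c => c.1) h))
    (fun e he => ⟨⟨e.1, e.2, (hmem e).1 he⟩, Finset.mem_univ _, rfl⟩) fun e _ => rfl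

theorem finprod_density :
    ∏ᶠ e : {e : Edge k X // B.Visible e}, B.density G e.1 =
      (edgeSystem G B hpos).D ((edgeSystem G B hpos).touch univ univ) := by
  have : (edgeSystem G B hpos).touch univ univ = univ := Finset.eq_univ_of_forall fun e =>
    EdgeSystem.mem_touch.2 ⟨Finset.subset_univ _,
      EdgeSystem.not_disjoint_of_vs_subset (Finset.subset_univ _)⟩
  rw [finprod_eq_prod_of_fintype, this]
  rfl

/-- All vertices are added starting from the empty set, where the weight is `1`, with injectivity
built into the weight. -/
theorem le_prob_embeds_injective (hC : (edgeSystem G B hpos).Controlled k Δ L ρ)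
    (hζ : ∀ i, (Nat.card (X i) : ℝ) ≤ err L (ρ 1) ^ 4 * Nat.card (Ω i)) :
    (1 - err L (ρ k)) ^ Nat.card (Vertex X) *
        ∏ᶠ e : {e : Edge k X // B.Visible e}, B.density G e.1 ≤
      prob (fun φ : PMap X Ω => B.Embeds φ G ∧ Function.Injective φ.onVertex) := by
  classical
  haveI : Fintype (PMap X Ω) := Fintype.ofFinite _
  have hω := isWeight_injIndicator (edgeSystem G B hpos) hζ
  have h := hC.pow_mul_D_le hω univ
  have h1 : 𝔼 x, weight (edgeSystem G B hpos) injIndicator ∅ x = 1 := by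
    have : ∀ x, weight (edgeSystem G B hpos) injIndicator ∅ x = 1 := fun x => by
      have : (edgeSystem G B hpos).touch ∅ ∅ = ∅ := by ext e; simp [EdgeSystem.mem_touch]
      rw [weight, this]
      simp [EdgeSystem.Ind, injIndicator]
    simp only [this, Fintype.expect_const]
  rw [h1, mul_one, Finset.card_univ, ← Nat.card_eq_fintype_card, ← finprod_density] at h
  refine h.trans (le_of_eq ?_)
  rw [prob_eq_expect]
  refine Fintype.expect_equiv pmapEquiv _ _ fun x => ?_
  have hinj : Function.Injective (toPMap x).onVertex ↔
      Set.InjOn (fun v : Vertex X => (⟨v.1, x v⟩ : Vertex Ω)) ↑(univ : Finset (Vertex X)) := by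
    rw [Finset.coe_univ, Set.injOn_univ]
    rfl
  rw [weight, Ind_edgeSystem, injIndicator, ite_zero_mul_ite_zero, one_mul]
  refine if_congr ?_ rfl rfl
  rw [← embeds_iff_forall_subtype, ← hinj]
  rfl

/-- The conditioning does not ask for injectivity, so the weight without further conditions is used;
only collisions of `u` are subtracted, at a cost of at most `err L (ρ 1) ^ 4` times the weight. -/
theorem le_condExpect_delete (hC : (edgeSystem G B hpos).Controlled k Δ L ρ)
    (hζ : ∀ i, (Nat.card (X i) : ℝ) ≤ err L (ρ 1) ^ 4 * Nat.card (Ω i)) (u : Vertex X) :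
    (1 - err L (ρ k)) * ∏ᶠ e : {e : Edge k X // B.Visible e ∧ e.Contains u}, B.density G e.1 ≤
      condExpect
        (fun φ : PMap (Sub ({u}ᶜ : Set (Vertex X))) Ω =>
          prob (fun ψ : PMap (Sub ({u} : Set (Vertex X))) Ω =>
            B.Embeds (PMap.glue u φ ψ) G ∧
            (PMap.glue u φ ψ).onVertex u ∉ (PMap.glue u φ ψ).onVertex '' {u}ᶜ))
        (fun φ => (B.delete u).Embeds φ G) := by
  classical
  haveI : Fintype (PMap (Sub ({u}ᶜ : Set (Vertex X))) Ω) := Fintype.ofFinite _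
  haveI : Fintype (PMap (Sub ({u} : Set (Vertex X))) Ω) := Fintype.ofFinite _
  have : Nonempty (PMap (Sub ({u} : Set (Vertex X))) Ω) := ⟨fun _ _ => Classical.arbitrary _⟩
  have : Nonempty (PMap (Sub ({u}ᶜ : Set (Vertex X))) Ω) := ⟨fun _ _ => Classical.arbitrary _⟩
  set R := edgeSystem G B hpos with hR
  set U : Finset (Vertex X) := univ \ {u} with hU
  set ω := weight R (fun _ _ => 1) with hωdef
  have hω : R.IsWeight ω (err L (ρ 1) ^ 4) := isWeight_one R hζ
  have hωpos : 0 < 𝔼 x, ω U x := hC.expect_weight_pos hω U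
  have hIU : ∀ x, ω U x = if (B.delete u).Embeds (splitEquiv u x).1 G then 1 else 0 := by
    intro x
    rw [hωdef, weight, mul_one, Ind_edgeSystem]
    refine if_congr ?_ rfl rfl
    rw [embeds_delete_iff]
    refine forall_congr' fun e => ?_
    have : e ∈ R.touch U U ↔ u ∉ e.1.verts := by
      rw [EdgeSystem.mem_touch]
      constructor
      · intro h hu
        simpa [hU] using h.1 hu
      · intro hu
        have : R.vs e ⊆ U := fun v hv => by
          rw [hU, Finset.mem_sdiff, Finset.mem_singleton]
          exact ⟨Finset.mem_univ _, fun h => hu (h ▸ hv)⟩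
        exact ⟨this, EdgeSystem.not_disjoint_of_vs_subset this⟩
    rw [this]
  have hden : (𝔼 φ : PMap (Sub ({u}ᶜ : Set (Vertex X))) Ω,
      if (B.delete u).Embeds φ G then (1 : ℝ) else 0) = 𝔼 x, ω U x := by
    simp only [hIU]
    rw [Fintype.expect_equiv (splitEquiv u) _
      (fun p => if (B.delete u).Embeds p.1 G then (1 : ℝ) else 0) fun x => rfl,
      ← Finset.univ_product_univ, Finset.expect_product]
    exact Finset.expect_congr rfl fun φ _ => (Fintype.expect_const _).symm
  -- Under the gluing bijection, the event is that `B ∖ u` and all edges at `u` are embedded, minus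
  -- the part where `u` collides.
  have hnum : (𝔼 φ : PMap (Sub ({u}ᶜ : Set (Vertex X))) Ω, if (B.delete u).Embeds φ G then
      prob (fun ψ : PMap (Sub ({u} : Set (Vertex X))) Ω => B.Embeds (PMap.glue u φ ψ) G ∧
        (PMap.glue u φ ψ).onVertex u ∉ (PMap.glue u φ ψ).onVertex '' {u}ᶜ) else 0) =
      𝔼 x, (R.Ind (R.touch {u} univ) x * ω U x -
        R.Ind (R.touch {u} univ) x * (collision U u x * ω U x)) := by
    simp only [prob_eq_expect]
    have h1 : ∀ φ : PMap (Sub ({u}ᶜ : Set (Vertex X))) Ω, (if (B.delete u).Embeds φ G then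
        𝔼 ψ : PMap (Sub ({u} : Set (Vertex X))) Ω, (if B.Embeds (PMap.glue u φ ψ) G ∧
          (PMap.glue u φ ψ).onVertex u ∉ (PMap.glue u φ ψ).onVertex '' {u}ᶜ then (1 : ℝ) else 0)
        else 0) = 𝔼 ψ : PMap (Sub ({u} : Set (Vertex X))) Ω, if (B.delete u).Embeds φ G then
          (if B.Embeds (PMap.glue u φ ψ) G ∧
          (PMap.glue u φ ψ).onVertex u ∉ (PMap.glue u φ ψ).onVertex '' {u}ᶜ then (1 : ℝ) else 0)
          else 0 := by
      intro φ
      split_ifs <;> simp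
    simp only [h1]
    rw [← Finset.expect_product', Finset.univ_product_univ]
    symm
    refine Fintype.expect_equiv (splitEquiv u) _ _ fun x => ?_
    rw [glue_splitEquiv, hIU]
    split_ifs with hdel hemb
    · have hI : R.Ind (R.touch {u} univ) x = 1 := by
        rw [Ind_edgeSystem, if_pos]
        intro e _
        exact hemb.1 e.1 e.2
      have hc : collision U u x = 0 := if_neg fun ⟨w, hw, h⟩ => hemb.2
        ⟨w, by simpa [hU] using hw, h⟩
      rw [hI, hc]; norm_num
    · by_cases hB : B.Embeds (toPMap x) G
      · have hc : collision U u x = 1 := if_pos (by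
          by_contra hcon
          refine hemb ⟨hB, fun ⟨w, hw, h⟩ => hcon ⟨w, ?_, h⟩⟩
          simpa [hU] using hw)
        rw [hc]; ring
      · have hI : R.Ind (R.touch {u} univ) x = 0 := by
          rw [Ind_edgeSystem, if_neg]
          intro hall
          refine hB fun e he => ?_
          by_cases hu : u ∈ e.verts
          · exact hall ⟨e, he⟩ (EdgeSystem.mem_touch.2
              ⟨Finset.subset_univ _, by rw [Finset.disjoint_singleton_right, not_not]; exact hu⟩)
          · exact (embeds_delete_iff u x).1 hdel ⟨e, he⟩ hu
        rw [hI]; ring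
    · simp only [mul_zero, sub_zero]
  rw [condExpect_eq_div, hden, hnum, le_div_iff₀ hωpos, Finset.expect_sub_distrib,
    finprod_density_contains (hpos := hpos)]
  have h1 := hC.le_expect_touch hω (Finset.mem_univ u) (hC.extends_weight hω _)
  have h2 := expect_collision_mul_le hζ (W := U) (u := u) (by simp [hU]) (hω.dependsOn U)
    (hω.nonneg U)
  have h3 := hC.error_one_mul_le (U := univ) (u := u) hωpos.le
  have h4 : 𝔼 x, R.Ind (R.touch {u} univ) x * (collision U u x * ω U x) ≤
      𝔼 x, collision U u x * ω U x := Finset.expect_le_expect fun x _ =>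
    mul_le_of_le_one_left (mul_nonneg (collision_nonneg U u x) (hω.nonneg U x))
      (R.Ind_le_one _ x)
  linarith

end Main

end BlowupCounting

/-! ### Choice of the functions and conclusion. -/

theorem mainTheorem3 (k Δ : ℕ) (hk : 1 ≤ k) (hΔ : 1 ≤ Δ) :
    ∃ η : ℕ → ℝ → ℝ,
      (∀ i ∈ Finset.Icc 1 k, ∀ x : ℝ, 0 < x → x < 1 → 0 < η i x) ∧
      ∀ ρ : ℕ → ℝ,
        (∀ i ∈ Finset.Icc 1 k, 0 < ρ i ∧ ρ i < 1) →
        (∀ i ∈ Finset.Icc 1 k, ∀ j ∈ Finset.Icc 1 k, i ≤ j → ρ i ≤ ρ j) →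
      ∀ (ι : Type) [Finite ι], k ≤ Nat.card ι →
      ∀ (Ω : ι → Type) [∀ i, Finite (Ω i)]
        (C : BlowupCounting.Index ι k → Type) [∀ I, Finite (C I)],
        (∀ I, (Nat.card (C I) : ℝ) ≤ 1 / ρ I.1.card) →
      ∀ (G : BlowupCounting.ColoredGraph k Ω C) (h : ℕ), 1 ≤ h →
      ∀ (Y : ι → Type) [∀ i, Finite (Y i)], (∀ i, Nat.card (Y i) = h) →
      ∀ (S : BlowupCounting.Complex k Y C),
        (∀ (X' : ι → Type) [∀ i, Finite (X' i)] (S' : BlowupCounting.Complex k X' C),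
          S'.IsBlowup (2 * Δ) S →
          Nat.card (BlowupCounting.Vertex X') ≤ 2 * Δ ^ (2 * k) →
          S'.CountsWithin G (fun i => η i (ρ i))) →
        (∀ e : BlowupCounting.Edge k Y, S.Visible e → ρ e.size < S.density G e) →
      ∀ (X : ι → Type) [∀ i, Finite (X i)] (B : BlowupCounting.Complex k X C),
        B.IsBlowup Δ S →
        (∀ i, (Nat.card (X i) : ℝ) < η 1 (ρ 1) * (Nat.card (Ω i) : ℝ)) →
        (∀ u : BlowupCounting.Vertex X,
          (1 - η k (ρ k) ^ (1 / 4 : ℝ)) *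
              ∏ᶠ e : {e : BlowupCounting.Edge k X // B.Visible e ∧ e.Contains u}, B.density G e.1 ≤
            BlowupCounting.condExpect
              (fun φ : BlowupCounting.PMap
                  (BlowupCounting.Sub ({u}ᶜ : Set (BlowupCounting.Vertex X))) Ω =>
                BlowupCounting.prob
                  (fun ψ : BlowupCounting.PMap
                      (BlowupCounting.Sub ({u} : Set (BlowupCounting.Vertex X))) Ω =>
                    B.Embeds (BlowupCounting.PMap.glue u φ ψ) G ∧
                    (BlowupCounting.PMap.glue u φ ψ).onVertex u ∉
                      (BlowupCounting.PMap.glue u φ ψ).onVertex '' {u}ᶜ))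
              (fun φ => (B.delete u).Embeds φ G)) ∧
        (1 - η k (ρ k) ^ (1 / 4 : ℝ)) ^ Nat.card (BlowupCounting.Vertex X) *
              ∏ᶠ e : {e : BlowupCounting.Edge k X // B.Visible e}, B.density G e.1 ≤
            BlowupCounting.prob
              (fun φ : BlowupCounting.PMap X Ω =>
                B.Embeds φ G ∧ Function.Injective φ.onVertex) ∧
        0 < (1 - η k (ρ k) ^ (1 / 4 : ℝ)) ^ Nat.card (BlowupCounting.Vertex X) *
              ∏ᶠ e : {e : BlowupCounting.Edge k X // B.Visible e}, B.density G e.1 := by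
  -- One function serves all sizes: the fourth power of `err`, so that `η_k ^ (1/4)` is exactly the
  -- loss per vertex. The exponent of `4` is the vertex bound of the counting hypothesis.
  refine ⟨fun _ x => BlowupCounting.err (4 ^ (2 * Δ ^ (2 * k))) x ^ 4, fun i _ x hx _ =>
    pow_pos (BlowupCounting.err_pos (Nat.pow_pos (by norm_num)) hx) 4, ?_⟩
  intro ρ hρ hmono ι _ _ Ω _ C _ _ G h _ Y _ _ S hS hdens X _ B hB hX
  classical
  set L := 4 ^ (2 * Δ ^ (2 * k)) with hL
  have hL0 : 0 < L := Nat.pow_pos (by norm_num)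
  have hρk := hρ k (Finset.mem_Icc.2 ⟨hk, le_rfl⟩)
  have hroot : (BlowupCounting.err L (ρ k) ^ 4) ^ (1 / 4 : ℝ) = BlowupCounting.err L (ρ k) := by
    have := Real.pow_rpow_inv_natCast (BlowupCounting.err_pos hL0 hρk.1).le (n := 4) (by norm_num)
    rwa [show ((4 : ℕ) : ℝ)⁻¹ = 1 / 4 by norm_num] at this
  -- The strict bound on the part sizes already forces every target part to be nonempty.
  have hΩ : ∀ i, Nonempty (Ω i) := fun i => by
    by_contra hne
    rw [not_nonempty_iff] at hne
    have := hX i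
    rw [Nat.card_of_isEmpty (α := Ω i), Nat.cast_zero, mul_zero] at this
    exact absurd this (not_lt.2 (Nat.cast_nonneg _))
  haveI : ∀ i, Fintype (Ω i) := fun i => Fintype.ofFinite _
  haveI : Fintype (BlowupCounting.Vertex X) := Fintype.ofFinite _
  haveI : Fintype {e : BlowupCounting.Edge k X // B.Visible e} := Fintype.ofFinite _
  -- A relative density depends only on the colors of the edge and its parts, which the map of `B`
  -- into `S` preserves.
  have hge : ∀ e, B.Visible e → ρ e.size < B.density G e := fun e he => by
    obtain ⟨φ, hφ⟩ := hB.2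
    obtain ⟨h1, h2⟩ := BlowupCounting.density_eq_of_embedsComplex (G := G) hφ he
    rw [h2]
    exact hdens _ h1
  have hsize : ∀ e : BlowupCounting.Edge k X, e.size ∈ Finset.Icc 1 k := fun e =>
    Finset.mem_Icc.2 ⟨Finset.card_pos.2 e.1.2.1, e.1.2.2⟩
  have hpos : ∀ e, B.Visible e → 0 < B.density G e := fun e he =>
    (hρ _ (hsize e)).1.trans (hge e he)
  have hC : (BlowupCounting.edgeSystem G B hpos).Controlled k Δ L ρ := by
    refine ⟨hk, hΔ, hL, fun i h1 h2 => (hρ i (Finset.mem_Icc.2 ⟨h1, h2⟩)).1,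
      fun i h1 h2 => (hρ i (Finset.mem_Icc.2 ⟨h1, h2⟩)).2.le,
      fun i j h1 h2 h3 => hmono i (Finset.mem_Icc.2 ⟨h1, h2.trans h3⟩) j
        (Finset.mem_Icc.2 ⟨h1.trans h2, h3⟩) h2,
      fun e => ?_, fun e => ?_, BlowupCounting.degreeLE_edgeSystem hB.1,
      BlowupCounting.regular_edgeSystem hB (fun i h1 h2 => ?_) hS⟩
    · exact e.1.card_verts.trans_le e.1.1.2.2
    · exact (congrArg ρ e.1.card_verts).trans_le (hge e.1 e.2).le
    · have h3 := hρ i (Finset.mem_Icc.2 ⟨h1, h2⟩)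
      exact pow_le_one₀ (BlowupCounting.err_pos hL0 h3.1).le
        ((BlowupCounting.err_le hL0 h3.1 h3.2.le).trans (by norm_num))
  rw [hroot]
  refine ⟨BlowupCounting.le_condExpect_delete hC fun i => (hX i).le,
    BlowupCounting.le_prob_embeds_injective hC fun i => (hX i).le, ?_⟩
  refine mul_pos (pow_pos ?_ _) ?_
  · linarith [BlowupCounting.err_le hL0 hρk.1 hρk.2.le]
  · rw [BlowupCounting.finprod_density (hpos := hpos)]
    exact BlowupCounting.EdgeSystem.D_pos _ _
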